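/- **Setting.** Let $g$ be a probability density on $\mathbf R$, real analytic, with a meromorphic continuation (again denoted $g$) to the upper half plane, such that for every $\gamma>0$ there is $C>0$ with $|g(z)|<Ce^{-\gamma|z|}$ for all $z\in\mathbf R$, and, for some fixed $\delta>0$, the same holds for all $z$ in the sectors $|\arg z|\le\delta$, $|\arg z-\pi|\le\delta$. For integers $\beta\ge 0$, $n\ge 1$ let $\mathrm{Exp}_+(\beta,n)$ be the Banach space of functions $\phi$ that are holomorphic on $\mathrm{Im}\,z>-1/n$, continuous on $\mathrm{Im}\,z\ge-1/n$, with $\|\phi\|_{\beta,n}=\sup_{\mathrm{Im} z\ge -1/n}e^{-\beta|z|}|\phi(z)|<\infty$, and let $\mathrm{Exp}_+=\bigcup_{\beta,n}\mathrm{Exp}_+(\beta,n)$ with the inductive limit topology ($U$ is open iff $U\cap \mathrm{Exp}_+(\beta,n)$ is open for all $\beta,n$). Let $\mathrm{Exp}_+'$ be the space of continuous linear functionals $\phi\mapsto\langle\phi\,|\,\mu\rangle$ on $\mathrm{Exp}_+$. Its weak dual topology is that of pointwise convergence, its strong dual topology that of uniform convergence on bounded sets, and its projective topology the coarsest one making all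 restriction maps $\mathrm{Exp}_+'\to\mathrm{Exp}_+(\beta,n)'$ continuous for the dual norms $\|\cdot\|^*_{\beta,n}$. Put $$d_\beta(\mu,\nu)=\sum_{n\ge1}\frac1{2^n}\frac{\|\mu-\nu\|^*_{\beta,n}}{1+\|\mu-\nu\|^*_{\beta,n}},\qquad d(\mu,\nu)=\sum_{\beta\ge0}\frac1{2^\beta}\frac{d_\beta(\mu,\nu)}{1+d_\beta(\mu,\nu)}.$$ Let $i:\mathrm{Exp}_+\to\mathrm{Exp}_+'$, $i(\psi)(\phi)=\int_{\mathbf R}\phi\,\psi\,g\,d\omega$, and for $C\ge1$, $\alpha\ge0$ let $V_{C,\alpha}=\{\phi\in\mathrm{Exp}_+ : |\phi(z)|e^{-\alpha|z|}\le C \text{ for } \mathrm{Im}\,z\ge0\}$. Let $K\in\mathbf R$ and $D(\lambda)=\int_{\mathbf R}\frac{g(\omega)}{\lambda-\sqrt{-1}\,\omega}d\omega$. A *resonance pole* is a root $\lambda$ of $D(\lambda)+2\pi g(-\sqrt{-1}\lambda)=2/K$ with $\mathrm{Re}\,\lambda<0$, or a point $\lambda$ of the imaginary axis at which $D$ has the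 limit $2/K$ from the right and $D+2\pi g(-\sqrt{-1}\,\cdot)$ has the limit $2/K$ from the left along the horizontal line through $\lambda$. It is *simple* if the limit $D_\lambda=\lim_{z\to\lambda,\ \mathrm{Re}z<0}\frac{1}{z-\lambda}\bigl(1-\frac K2D(z)-\pi Kg(-\sqrt{-1}z)\bigr)$ exists and is nonzero. The set $\mathcal K_1\subset\mathbf C\cup\{\infty\}$ consists of $0$, $\infty$ and all $K$ such that $D(\lambda)+2\pi g(-\sqrt{-1}\lambda)=\frac2K+o(|\lambda|^{-n})$ for every $n=0,1,2,\dots$ along some path tending to $\infty$ inside $\pi/2+\delta<\arg\lambda<3\pi/2-\delta$. The generalized eigenfunction $\mu_\lambda$ of a resonance pole $\lambda$ is given by $\langle\phi\,|\,\mu_\lambda\rangle=\int_{\mathbf R}\frac{\phi(\omega)g(\omega)}{\lambda-\sqrt{-1}\omega}d\omega+2\pi\phi(-\sqrt{-1}\lambda)g(-\sqrt{-1}\lambda)$ if $\mathrm{Re}\,\lambda<0$, and by $\langle\phi\,|\,\mu_\lambda\rangle=\lim_{x\to+0}\int_{\mathbf R}\frac{\phi(\omega)g(\omega)}{\lambda+x-\sqrt{-1}\omega}d\omega$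 if $\mathrm{Re}\,\lambda=0$. **Theorem.** For all $C\ge1$ and $\alpha\ge0$: (i) On $i(V_{C,\alpha})\subset\mathrm{Exp}_+'$ the weak dual topology, the projective topology and the strong dual topology coincide. (ii) For each of these three topologies, the closure of $i(V_{C,\alpha})$ in $\mathrm{Exp}_+'$ is connected and compact, and its topology is induced by the metric $d$. (iii) If $K\notin\mathcal K_1$, then for every simple resonance pole $\lambda$, $\mu_\lambda$ is a well-defined element of $\mathrm{Exp}_+'$, and the projection $$\Pi_\lambda:i(V_{C,\alpha})\to\mathrm{Exp}_+',\qquad \Pi_\lambda\, i(\psi)=\frac{K}{2D_\lambda}\langle\psi\,|\,\mu_\lambda\rangle\,\mu_\lambda ,$$ is well defined, continuous with respect to the projective topology, and sequentially continuous with respect to the weak dual topology. (iv) Let $h$ be a probability measure on the circle $\mathbf R/2\pi\mathbf Z$, and let $\rho_t(\cdot,\omega)$ ($t\ge0$, $\omega\in\mathbf R$) be probability measures on the circle, measurable in $\omega$, with $\rho_0(\cdot,\omega)=h$, whose moments $Z_j(t,\omega)=\int e^{\sqrt{-1}j\theta}d\rho_t(\theta,\omega)$ solve $$\frac{dZ_j}{dt}=\sqrt{-1}\,j\omega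 Z_j+\frac{jK}{2}\bigl(\eta(t)Z_{j-1}-\overline{\eta(t)}Z_{j+1}\bigr),\quad j\ge1,\qquad \eta(t)=\int_{\mathbf R}Z_1(t,\omega)g(\omega)d\omega,$$ for $t\ge 0$ (the continuous Kuramoto model; note $Z_0=1$). Then for all $t\ge0$ and $j\ge1$, $Z_j(t,\cdot)$ is the restriction to $\mathbf R$ of a function in $V_{1,0}$. -/

import Mathlib

open MeasureTheory ProbabilityTheory Filter Topology Asymptotics

namespace Kuramoto

noncomputable section

/-! ### The natural frequency density -/

/-- `g` is a probability density on `ℝ`, real analytic, with meromorphic continuation `G` to the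
upper half plane; `g` decays faster than every exponential on `ℝ`, and so does `G` in the sectors
of opening `δ` around the real axis.

`G` is used only on the closed upper half plane, which is why the sectors `|arg z| ≤ δ` and
`|arg z - π| ≤ δ` are cut down to it: the continuation to the lower half plane is the reflection
`conj (G (conj z))`, of the same modulus. Normal form means that `G` has no removable singularities
(and that Lean assigns it the value `0` at its poles). -/
structure IsGaussianType (g : ℝ → ℝ) (G : ℂ → ℂ) (δ : ℝ) : Prop where
  nonneg : ∀ ω, 0 ≤ g ω
  integral_eq_one : ∫ ω, g ω = 1
  continuation : ∀ ω : ℝ, G ω = g ω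
  analyticAt_real : ∀ ω : ℝ, AnalyticAt ℂ G ω
  meromorphic : MeromorphicNFOn G {z : ℂ | 0 < z.im}
  decay : ∀ γ : ℝ, 0 < γ → ∃ C : ℝ, 0 < C ∧ ∀ ω : ℝ, |g ω| < C * Real.exp (-γ * |ω|)
  delta_pos : 0 < δ
  sector_decay : ∀ γ : ℝ, 0 < γ → ∃ C : ℝ, 0 < C ∧ ∀ z : ℂ, 0 ≤ z.im →
    (|z.arg| ≤ δ ∨ |z.arg - Real.pi| ≤ δ) → ‖G z‖ < C * Real.exp (-γ * ‖z‖)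

/-- `D(lam) = ∫ g(ω) / (lam - iω) dω`. -/
def resolventFunction (g : ℝ → ℝ) (lam : ℂ) : ℂ :=
  ∫ ω : ℝ, (g ω : ℂ) / (lam - Complex.I * ω)

/-- `D(lam) + 2π g(-i lam)`: the continuation of `D` from the right to the left half plane. -/
def continuedResolvent (g : ℝ → ℝ) (G : ℂ → ℂ) (lam : ℂ) : ℂ :=
  resolventFunction g lam + 2 * Real.pi * G (-Complex.I * lam)

/-! ### The exceptional set of coupling constants -/

/-- The finite numbers `K` such that, along some path tending to infinity inside the angular domain
`π/2 + δ < arg lam < 3π/2 - δ`, the function `D(lam) + 2π g(-i lam)` converges to `2/K` faster than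
every power of `1/|lam|`. -/
def asymptoticCouplings (g : ℝ → ℝ) (G : ℂ → ℂ) (δ : ℝ) : Set ℂ :=
  {K | ∃ path : ℝ → ℂ, ContinuousOn path (Set.Ici 0) ∧
    Tendsto (fun s => ‖path s‖) atTop atTop ∧
    (∀ s : ℝ, 0 ≤ s → ∃ r ϑ : ℝ, 0 < r ∧ Real.pi / 2 + δ < ϑ ∧ ϑ < 3 * Real.pi / 2 - δ ∧
      path s = r * Complex.exp (Complex.I * ϑ)) ∧
    ∀ n : ℕ, (fun s => continuedResolvent g G (path s) - 2 / K)
      =o[atTop] (fun s => 1 / ‖path s‖ ^ n)}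

/-- The set `𝒦₁` in the Riemann sphere: the values above together with `0` and `∞`. -/
def exceptionalCouplings (g : ℝ → ℝ) (G : ℂ → ℂ) (δ : ℝ) : Set (OnePoint ℂ) :=
  ((fun K : ℂ => (K : OnePoint ℂ)) '' asymptoticCouplings g G δ) ∪ {((0 : ℂ) : OnePoint ℂ)} ∪
    {OnePoint.infty}

/-! ### Resonance poles -/

/-- Resonance poles: the roots of `D(lam) + 2π g(-i lam) = 2/K` on the left half plane, and of the
boundary version of the equation on the imaginary axis. At a root `-i lam` is not a pole of `g`. -/
def IsResonancePole (K : ℝ) (g : ℝ → ℝ) (G : ℂ → ℂ) (lam : ℂ) : Prop :=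
  (lam.re < 0 ∧ AnalyticAt ℂ G (-Complex.I * lam) ∧
    continuedResolvent g G lam = 2 / (K : ℂ)) ∨
  (lam.re = 0 ∧
    Tendsto (fun x : ℝ => resolventFunction g (lam + x)) (𝓝[>] 0) (𝓝 (2 / (K : ℂ))) ∧
    Tendsto (fun x : ℝ => continuedResolvent g G (lam + x)) (𝓝[<] 0) (𝓝 (2 / (K : ℂ))))

/-- `Dn = lim (1 - (K/2) D(z) - π K g(-iz)) / (z - lam)` as `z → lam`, the limit being taken in the
left half plane, where the formula gives the continuation. A resonance pole is simple iff
`Dn ≠ 0`. -/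
def HasPoleConstant (K : ℝ) (g : ℝ → ℝ) (G : ℂ → ℂ) (lam Dn : ℂ) : Prop :=
  Tendsto (fun z : ℂ => (1 - K / 2 * resolventFunction g z - Real.pi * K * G (-Complex.I * z)) /
      (z - lam))
    (𝓝[{z : ℂ | z.re < 0 ∧ z ≠ lam}] lam) (𝓝 Dn)

/-! ### The Banach spaces `Exp₊(β, n)`

The index `n : ℕ` here stands for `n + 1` in the usual indexing by `n = 1, 2, …`. -/

/-- The region `Im z ≥ -1/(n+1)`. -/
def region (n : ℕ) : Set ℂ := {z | -(1 / ((n : ℝ) + 1)) ≤ z.im}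

/-- Functions which are holomorphic in `Im z > -1/(n+1)`, continuous on `Im z ≥ -1/(n+1)`, and
bounded there by a multiple of `exp (β |z|)`. A function on the region is represented by its
extension by `0` to `ℂ`. -/
def expSubmodule (β n : ℕ) : Submodule ℂ (ℂ → ℂ) where
  carrier := {f | DifferentiableOn ℂ f {z | -(1 / ((n : ℝ) + 1)) < z.im} ∧
    ContinuousOn f (region n) ∧ (∀ z ∉ region n, f z = 0) ∧
    ∃ C : ℝ, ∀ z ∈ region n, Real.exp (-(β : ℝ) * ‖z‖) * ‖f z‖ ≤ C}
  add_mem' := by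
    rintro f h ⟨f1, f2, f3, C, f4⟩ ⟨h1, h2, h3, C', h4⟩
    refine ⟨f1.add h1, f2.add h2, fun z hz => by simp [f3 z hz, h3 z hz], C + C', fun z hz => ?_⟩
    calc Real.exp (-(β : ℝ) * ‖z‖) * ‖(f + h) z‖
        ≤ Real.exp (-(β : ℝ) * ‖z‖) * (‖f z‖ + ‖h z‖) := by
          gcongr; exact norm_add_le _ _
      _ ≤ C + C' := by rw [mul_add]; exact add_le_add (f4 z hz) (h4 z hz)
  zero_mem' := ⟨differentiableOn_const 0, continuousOn_const, fun _ _ => rfl, 0, by simp⟩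
  smul_mem' := by
    rintro c f ⟨f1, f2, f3, C, f4⟩
    refine ⟨f1.const_smul c, f2.const_smul c, fun z hz => by simp [f3 z hz], ‖c‖ * C,
      fun z hz => ?_⟩
    have := mul_le_mul_of_nonneg_left (f4 z hz) (norm_nonneg c)
    simp only [Pi.smul_apply, smul_eq_mul, norm_mul]
    linarith

/-- The space `Exp₊(β, n)`. -/
def ExpBanach (β n : ℕ) : Type := ↥(expSubmodule β n)

instance (β n : ℕ) : AddCommGroup (ExpBanach β n) :=
  inferInstanceAs (AddCommGroup ↥(expSubmodule β n))

instance (β n : ℕ) : Module ℂ (ExpBanach β n) :=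
  inferInstanceAs (Module ℂ ↥(expSubmodule β n))

/-- The norm `sup_{Im z ≥ -1/(n+1)} exp (-β |z|) |f z|`. -/
instance (β n : ℕ) : Norm (ExpBanach β n) :=
  ⟨fun f => ⨆ z : region n, Real.exp (-(β : ℝ) * ‖(z : ℂ)‖) * ‖f.1 z‖⟩

theorem expBanach_norm_def {β n : ℕ} (f : ExpBanach β n) :
    ‖f‖ = ⨆ z : region n, Real.exp (-(β : ℝ) * ‖(z : ℂ)‖) * ‖f.1 z‖ := rfl

theorem real_mem_region (n : ℕ) (z : ℂ) (hz : 0 ≤ z.im) : z ∈ region n := by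
  have : (0 : ℝ) < 1 / ((n : ℝ) + 1) := by positivity
  simp only [region, Set.mem_ofPred_eq]
  linarith

theorem expBanach_le_norm {β n : ℕ} (f : ExpBanach β n) {z : ℂ} (hz : z ∈ region n) :
    Real.exp (-(β : ℝ) * ‖z‖) * ‖f.1 z‖ ≤ ‖f‖ := by
  obtain ⟨C, hC⟩ := f.2.2.2.2
  exact le_ciSup (f := fun z : region n => Real.exp (-(β : ℝ) * ‖(z : ℂ)‖) * ‖f.1 z‖)
    ⟨C, by rintro _ ⟨w, rfl⟩; exact hC w w.2⟩ ⟨z, hz⟩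

theorem expBanach_norm_le {β n : ℕ} (f : ExpBanach β n) {C : ℝ}
    (h : ∀ z ∈ region n, Real.exp (-(β : ℝ) * ‖z‖) * ‖f.1 z‖ ≤ C) : ‖f‖ ≤ C := by
  have : Nonempty (region n) := ⟨⟨0, real_mem_region n 0 (by simp)⟩⟩
  exact ciSup_le fun z => h z z.2

theorem expBanach_core (β n : ℕ) : NormedSpace.Core ℂ (ExpBanach β n) where
  norm_nonneg f := Real.iSup_nonneg fun z => by positivity
  norm_smul c f := by
    rw [expBanach_norm_def, expBanach_norm_def, Real.mul_iSup_of_nonneg (norm_nonneg c)]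
    congr 1
    ext z
    have : (c • f).1 z = c * f.1 z := rfl
    rw [this, norm_mul]
    ring
  norm_triangle f h := by
    refine expBanach_norm_le _ fun z hz => ?_
    have e : (f + h).1 z = f.1 z + h.1 z := rfl
    rw [e]
    calc Real.exp (-(β : ℝ) * ‖z‖) * ‖f.1 z + h.1 z‖
        ≤ Real.exp (-(β : ℝ) * ‖z‖) * (‖f.1 z‖ + ‖h.1 z‖) := by
          gcongr; exact norm_add_le _ _
      _ ≤ ‖f‖ + ‖h‖ := by
          rw [mul_add]; exact add_le_add (expBanach_le_norm f hz) (expBanach_le_norm h hz)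
  norm_eq_zero_iff f := by
    constructor
    · intro h
      apply Subtype.ext
      funext z
      by_cases hz : z ∈ region n
      · have h1 := expBanach_le_norm f hz
        rw [h] at h1
        have h2 : ‖f.1 z‖ ≤ 0 := by
          by_contra h3
          push Not at h3
          have := mul_pos (Real.exp_pos (-(β : ℝ) * ‖z‖)) h3
          linarith
        exact norm_le_zero_iff.1 h2
      · exact f.2.2.2.1 z hz
    · rintro rfl
      rw [expBanach_norm_def]
      have : ∀ z : region n,
          Real.exp (-(β : ℝ) * ‖(z : ℂ)‖) * ‖(0 : ExpBanach β n).1 z‖ = 0 := by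
        intro z
        have e : (0 : ExpBanach β n).1 z = 0 := rfl
        simp [e]
      simp only [this]
      exact Real.iSup_const_zero

instance (β n : ℕ) : NormedAddCommGroup (ExpBanach β n) :=
  NormedAddCommGroup.ofCore (expBanach_core β n)

instance (β n : ℕ) : NormedSpace ℂ (ExpBanach β n) :=
  NormedSpace.ofCore (expBanach_core β n)

/-! ### The inductive limit `Exp₊` -/

theorem expSubmodule_mono {β β' n n' : ℕ} (hβ : β ≤ β') (hn : n ≤ n') {f : ℂ → ℂ}
    (hf : f ∈ expSubmodule β n) :
    ∃ f' ∈ expSubmodule β' n', ∀ z : ℂ, 0 ≤ z.im → f' z = f z := by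
  classical
  obtain ⟨h1, h2, h3, C, h4⟩ := hf
  have hle : 1 / ((n' : ℝ) + 1) ≤ 1 / ((n : ℝ) + 1) := by gcongr
  have hsub : region n' ⊆ region n := fun z hz => by
    simp only [region, Set.mem_ofPred_eq] at hz ⊢; linarith
  have heq : Set.EqOn ((region n').indicator f) f (region n') :=
    fun z hz => Set.indicator_of_mem hz f
  refine ⟨(region n').indicator f, ⟨?_, ?_, ?_, C, ?_⟩, ?_⟩
  · refine (h1.mono ?_).congr fun z hz => heq ?_
    · intro z hz; simp only [Set.mem_ofPred_eq] at hz ⊢; linarith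
    · simp only [region, Set.mem_ofPred_eq] at hz ⊢; linarith
  · exact (h2.mono hsub).congr heq
  · exact fun z hz => Set.indicator_of_notMem hz f
  · intro z hz
    rw [heq hz]
    refine le_trans ?_ (h4 z (hsub hz))
    have : (β : ℝ) ≤ β' := by exact_mod_cast hβ
    gcongr
  · exact fun z hz => heq (real_mem_region n' z hz)

/-- The union of the spaces `Exp₊(β, n)`. An element, a holomorphic function near the closed upper
half plane, is represented by its restriction to `Im z ≥ 0` (which determines it, by the identity
theorem), extended by `0` to `ℂ`. -/
def expPlusSubmodule : Submodule ℂ (ℂ → ℂ) where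
  carrier := {f | (∀ z : ℂ, z.im < 0 → f z = 0) ∧
    ∃ β n : ℕ, ∃ F ∈ expSubmodule β n, ∀ z : ℂ, 0 ≤ z.im → f z = F z}
  add_mem' := by
    rintro f h ⟨f0, β, n, F, hF, hf⟩ ⟨h0, β', n', H, hH, hh⟩
    obtain ⟨F', hF', e1⟩ := expSubmodule_mono (le_max_left β β') (le_max_left n n') hF
    obtain ⟨H', hH', e2⟩ := expSubmodule_mono (le_max_right β β') (le_max_right n n') hH
    exact ⟨fun z hz => by simp [f0 z hz, h0 z hz], _, _, F' + H', add_mem hF' hH', fun z hz => by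
      simp [hf z hz, hh z hz, e1 z hz, e2 z hz]⟩
  zero_mem' := ⟨fun _ _ => rfl, 0, 0, 0, zero_mem _, fun _ _ => rfl⟩
  smul_mem' := by
    rintro c f ⟨f0, β, n, F, hF, hf⟩
    exact ⟨fun z hz => by simp [f0 z hz], β, n, c • F, Submodule.smul_mem _ c hF,
      fun z hz => by simp [hf z hz]⟩

/-- The space `Exp₊`. -/
def ExpPlus : Type := ↥expPlusSubmodule

instance : AddCommGroup ExpPlus := inferInstanceAs (AddCommGroup ↥expPlusSubmodule)

instance : Module ℂ ExpPlus := inferInstanceAs (Module ℂ ↥expPlusSubmodule)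

instance : CoeFun ExpPlus (fun _ => ℂ → ℂ) := ⟨fun f => f.1⟩

/-- The inclusion `Exp₊(β, n) → Exp₊`. -/
def inclusionLinear (β n : ℕ) : ExpBanach β n →ₗ[ℂ] ExpPlus where
  toFun f := ⟨{z : ℂ | 0 ≤ z.im}.indicator f.1,
    fun z hz => Set.indicator_of_notMem (by simpa using hz) _,
    β, n, f.1, f.2, fun z hz => Set.indicator_of_mem (by simpa using hz) _⟩
  map_add' f h := Subtype.ext (Set.indicator_add _ f.1 h.1)
  map_smul' c f := Subtype.ext (Set.indicator_const_smul _ c f.1)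

/-- The inductive limit topology: `U` is open iff its preimage in every `Exp₊(β, n)` is open. -/
instance : TopologicalSpace ExpPlus :=
  ⨆ β : ℕ, ⨆ n : ℕ, TopologicalSpace.coinduced (inclusionLinear β n) inferInstance

theorem continuous_inclusionLinear (β n : ℕ) : Continuous (inclusionLinear β n) := by
  rw [continuous_iff_coinduced_le]
  exact le_iSup_of_le β (le_iSup_of_le n le_rfl)

/-- A function on `Exp₊` is continuous iff it is on every `Exp₊(β, n)`. -/
theorem continuous_expPlus_iff {X : Type*} [TopologicalSpace X] {f : ExpPlus → X} :
    Continuous f ↔ ∀ β n : ℕ, Continuous (fun φ => f (inclusionLinear β n φ)) := by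
  constructor
  · exact fun h β n => h.comp (continuous_inclusionLinear β n)
  · intro h
    refine continuous_iSup_dom.2 fun β => continuous_iSup_dom.2 fun n => ?_
    exact continuous_coinduced_dom.2 (h β n)

/-- The inclusion `Exp₊(β, n) → Exp₊` as a continuous linear map. -/
def inclusion (β n : ℕ) : ExpBanach β n →L[ℂ] ExpPlus :=
  ⟨inclusionLinear β n, continuous_inclusionLinear β n⟩

/-! ### The dual space and its three topologies -/

/-- The dual space `Exp₊'`: the continuous linear functionals on `Exp₊`. -/
abbrev ExpPlusDual : Type := ExpPlus →L[ℂ] ℂ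

/-- The weak dual topology: pointwise convergence. -/
@[reducible]
def weakDualTopology : TopologicalSpace ExpPlusDual :=
  TopologicalSpace.induced (fun (μ : ExpPlusDual) (φ : ExpPlus) => μ φ) Pi.topologicalSpace

/-- The projective topology: the coarsest one for which all the restriction maps into the Banach
spaces `Exp₊(β, n)'` (with their operator norms) are continuous. -/
@[reducible]
def projectiveTopology : TopologicalSpace ExpPlusDual :=
  ⨅ β : ℕ, ⨅ n : ℕ, TopologicalSpace.induced
    (fun μ : ExpPlusDual => (μ.comp (inclusion β n) : ExpBanach β n →L[ℂ] ℂ)) inferInstance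

/-- The strong dual topology: uniform convergence on the (von Neumann) bounded subsets of `Exp₊`,
which is Mathlib's topology on spaces of continuous linear maps. -/
@[reducible]
def strongDualTopology : TopologicalSpace ExpPlusDual :=
  ContinuousLinearMap.topologicalSpace

/-- The metric `d_β = ∑_{n ≥ 1} 2^{-n} ‖μ - ν‖*_{β,n} / (1 + ‖μ - ν‖*_{β,n})`. -/
def distBeta (β : ℕ) (μ ν : ExpPlusDual) : ℝ :=
  ∑' n : ℕ, 1 / 2 ^ (n + 1) *
    (‖(μ - ν).comp (inclusion β n)‖ / (1 + ‖(μ - ν).comp (inclusion β n)‖))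

/-- The metric `d = ∑_{β ≥ 0} 2^{-β} d_β / (1 + d_β)`. -/
def dualDist (μ ν : ExpPlusDual) : ℝ :=
  ∑' β : ℕ, 1 / 2 ^ β * (distBeta β μ ν / (1 + distBeta β μ ν))

/-! ### The canonical inclusion -/

theorem IsGaussianType.continuous {g : ℝ → ℝ} {G : ℂ → ℂ} {δ : ℝ} (hg : IsGaussianType g G δ) :
    Continuous g := by
  have h1 : Continuous fun ω : ℝ => G ω := by
    rw [continuous_iff_continuousAt]
    intro ω
    exact ContinuousAt.comp (f := fun x : ℝ => (x : ℂ)) (hg.analyticAt_real ω).continuousAt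
      Complex.continuous_ofReal.continuousAt
  have h2 : g = fun ω : ℝ => (G ω).re := by
    funext ω; rw [hg.continuation ω, Complex.ofReal_re]
  rw [h2]
  exact Complex.continuous_re.comp h1

theorem expPlus_continuous (φ : ExpPlus) : Continuous fun ω : ℝ => φ ω := by
  obtain ⟨-, β, n, F, hF, h⟩ := φ.2
  have e : (fun ω : ℝ => φ ω) = fun ω : ℝ => F ω := by
    funext ω; exact h ω (by simp)
  rw [e]
  exact hF.2.1.comp_continuous Complex.continuous_ofReal fun ω => real_mem_region n _ (by simp)

theorem expPlus_bound (φ : ExpPlus) :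
    ∃ β : ℕ, ∃ C : ℝ, 0 ≤ C ∧ ∀ ω : ℝ, ‖φ ω‖ ≤ C * Real.exp (β * |ω|) := by
  obtain ⟨-, β, n, F, hF, h⟩ := φ.2
  obtain ⟨C, hC⟩ := hF.2.2.2
  refine ⟨β, C, ?_, fun ω => ?_⟩
  · exact le_trans (by positivity) (hC 0 (real_mem_region n 0 (by simp)))
  · have h1 := hC ω (real_mem_region n _ (by simp))
    have e : φ ω = F ω := h ω (by simp)
    rw [e]
    rw [Complex.norm_real, Real.norm_eq_abs, neg_mul, Real.exp_neg] at h1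
    have hp := Real.exp_pos ((β : ℝ) * |ω|)
    rwa [inv_mul_le_iff₀ hp, mul_comm] at h1

theorem integrable_exp_of_neg_abs : Integrable fun ω : ℝ => Real.exp (-|ω|) := by
  rw [← integrableOn_univ, ← Set.Iic_union_Ioi (a := (0 : ℝ))]
  refine IntegrableOn.union ?_ ?_
  · refine (integrableOn_exp_Iic 0).congr_fun (fun x hx => ?_) measurableSet_Iic
    simp only [Set.mem_Iic] at hx
    simp [abs_of_nonpos hx]
  · refine (integrableOn_exp_neg_Ioi 0).congr_fun (fun x hx => ?_) measurableSet_Ioi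
    simp only [Set.mem_Ioi] at hx
    simp [abs_of_pos hx]

theorem IsGaussianType.integrable_exp {g : ℝ → ℝ} {G : ℂ → ℂ} {δ : ℝ}
    (hg : IsGaussianType g G δ) (a : ℝ) : Integrable fun ω : ℝ => Real.exp (a * |ω|) * g ω := by
  obtain ⟨C, -, hC⟩ := hg.decay (|a| + 1) (by positivity)
  have hi : Integrable fun ω : ℝ => C * Real.exp (-|ω|) :=
    integrable_exp_of_neg_abs.const_mul C
  refine hi.mono' ?_ (Eventually.of_forall fun ω => ?_)
  · exact ((Real.continuous_exp.comp (continuous_const.mul continuous_abs)).mul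
      hg.continuous).aestronglyMeasurable
  · rw [norm_mul, Real.norm_eq_abs, Real.norm_eq_abs, Real.abs_exp]
    calc Real.exp (a * |ω|) * |g ω|
        ≤ Real.exp (|a| * |ω|) * (C * Real.exp (-(|a| + 1) * |ω|)) := by
          gcongr
          · exact le_abs_self a
          · exact (hC ω).le
      _ = C * Real.exp (-|ω|) := by
          rw [mul_left_comm, ← Real.exp_add]; congr 2; ring

theorem integrable_pairing {g : ℝ → ℝ} {G : ℂ → ℂ} {δ : ℝ} (hg : IsGaussianType g G δ)
    (ψ φ : ExpPlus) : Integrable fun ω : ℝ => φ ω * ψ ω * (g ω : ℂ) := by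
  obtain ⟨β, C, hC0, hC⟩ := expPlus_bound φ
  obtain ⟨β', C', hC0', hC'⟩ := expPlus_bound ψ
  refine ((hg.integrable_exp (β + β')).const_mul (C * C')).mono' ?_
    (Eventually.of_forall fun ω => ?_)
  · exact (((expPlus_continuous φ).mul (expPlus_continuous ψ)).mul
      (Complex.continuous_ofReal.comp hg.continuous)).aestronglyMeasurable
  · rw [norm_mul, norm_mul, Complex.norm_real, Real.norm_eq_abs, abs_of_nonneg (hg.nonneg ω)]
    calc ‖φ ω‖ * ‖ψ ω‖ * g ω
        ≤ (C * Real.exp (β * |ω|)) * (C' * Real.exp (β' * |ω|)) * g ω := by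
          gcongr
          · exact hg.nonneg ω
          · exact hC ω
          · exact hC' ω
      _ = C * C' * (Real.exp ((β + β') * |ω|) * g ω) := by
          rw [add_mul, Real.exp_add]; ring

/-- `φ ↦ ∫ φ ψ g`, as a linear form. -/
def pairingLinear {g : ℝ → ℝ} {G : ℂ → ℂ} {δ : ℝ} (hg : IsGaussianType g G δ) (ψ : ExpPlus) :
    ExpPlus →ₗ[ℂ] ℂ where
  toFun φ := ∫ ω : ℝ, φ ω * ψ ω * (g ω : ℂ)
  map_add' φ₁ φ₂ := by
    rw [← integral_add (integrable_pairing hg ψ φ₁) (integrable_pairing hg ψ φ₂)]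
    congr 1
    funext ω
    have e : (φ₁ + φ₂) ω = φ₁ ω + φ₂ ω := rfl
    rw [e]
    ring
  map_smul' c φ := by
    rw [RingHom.id_apply, smul_eq_mul, ← integral_const_mul]
    congr 1
    funext ω
    have e : (c • φ) ω = c * φ ω := rfl
    rw [e]
    ring

theorem continuous_pairingLinear {g : ℝ → ℝ} {G : ℂ → ℂ} {δ : ℝ} (hg : IsGaussianType g G δ)
    (ψ : ExpPlus) : Continuous (pairingLinear hg ψ) := by
  rw [continuous_expPlus_iff]
  intro β n
  obtain ⟨β', C', hC0', hC'⟩ := expPlus_bound ψ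
  let L : ExpBanach β n →ₗ[ℂ] ℂ := (pairingLinear hg ψ).comp (inclusionLinear β n)
  refine AddMonoidHomClass.continuous_of_bound L (C' * ∫ ω : ℝ, Real.exp ((β + β') * |ω|) * g ω) fun f => ?_
  have hb : ∀ ω : ℝ, ‖(inclusionLinear β n f) ω‖ ≤ ‖f‖ * Real.exp (β * |ω|) := by
    intro ω
    have e : (inclusionLinear β n f) ω = f.1 ω :=
      Set.indicator_of_mem (by simp) _
    have h1 := expBanach_le_norm f (real_mem_region n (ω : ℂ) (by simp))
    rw [Complex.norm_real, Real.norm_eq_abs, neg_mul, Real.exp_neg] at h1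
    have hp := Real.exp_pos ((β : ℝ) * |ω|)
    rw [e]
    rwa [inv_mul_le_iff₀ hp, mul_comm] at h1
  have hi : Integrable fun ω : ℝ => (C' * ‖f‖) * (Real.exp ((β + β') * |ω|) * g ω) :=
    (hg.integrable_exp (β + β')).const_mul _
  calc ‖∫ ω : ℝ, (inclusionLinear β n f) ω * ψ ω * (g ω : ℂ)‖
      ≤ ∫ ω : ℝ, (C' * ‖f‖) * (Real.exp ((β + β') * |ω|) * g ω) := by
        refine norm_integral_le_of_norm_le hi (Eventually.of_forall fun ω => ?_)
        rw [norm_mul, norm_mul, Complex.norm_real, Real.norm_eq_abs, abs_of_nonneg (hg.nonneg ω)]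
        calc ‖(inclusionLinear β n f) ω‖ * ‖ψ ω‖ * g ω
            ≤ (‖f‖ * Real.exp (β * |ω|)) * (C' * Real.exp (β' * |ω|)) * g ω := by
              gcongr
              · exact hg.nonneg ω
              · exact hb ω
              · exact hC' ω
          _ = (C' * ‖f‖) * (Real.exp ((β + β') * |ω|) * g ω) := by
              rw [add_mul, Real.exp_add]; ring
    _ = C' * (∫ ω : ℝ, Real.exp ((β + β') * |ω|) * g ω) * ‖f‖ := by
        rw [integral_const_mul]; ring

/-- The canonical inclusion `i : Exp₊ → Exp₊'`, `i(ψ)(φ) = ∫ φ(ω) ψ(ω) g(ω) dω`. -/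
def canonicalInclusion {g : ℝ → ℝ} {G : ℂ → ℂ} {δ : ℝ} (hg : IsGaussianType g G δ)
    (ψ : ExpPlus) : ExpPlusDual :=
  ⟨pairingLinear hg ψ, continuous_pairingLinear hg ψ⟩

/-- The set `V_{C,α}` of all `φ ∈ Exp₊` with `|φ(z)| exp (-α |z|) ≤ C` for `Im z ≥ 0`. -/
def boundedSet (C α : ℝ) : Set ExpPlus :=
  {φ | ∀ z : ℂ, 0 ≤ z.im → ‖φ z‖ * Real.exp (-α * ‖z‖) ≤ C}

/-- The set `i(V_{C,α})` in the dual space. -/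
def boundedImage {g : ℝ → ℝ} {G : ℂ → ℂ} {δ : ℝ} (hg : IsGaussianType g G δ) (C α : ℝ) :
    Set ExpPlusDual :=
  canonicalInclusion hg '' boundedSet C α

/-- The topology which a subset of the dual space inherits from the topology `τ`. -/
@[reducible]
def topologyOn (τ : TopologicalSpace ExpPlusDual) (S : Set ExpPlusDual) : TopologicalSpace S :=
  TopologicalSpace.induced ((↑) : S → ExpPlusDual) τ

/-! ### Generalized eigenfunctions -/

/-- `μ = μ(lam)`, the analytic continuation from right to left of the functional
`φ ↦ ∫ φ(ω) g(ω) / (lam - iω) dω`. -/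
def IsGeneralizedEigenfunction (g : ℝ → ℝ) (G : ℂ → ℂ) (lam : ℂ) (μ : ExpPlusDual) : Prop :=
  (lam.re < 0 → ∀ φ : ExpPlus,
    μ φ = (∫ ω : ℝ, φ ω * (g ω : ℂ) / (lam - Complex.I * ω)) +
      2 * Real.pi * φ (-Complex.I * lam) * G (-Complex.I * lam)) ∧
  (lam.re = 0 → ∀ φ : ExpPlus,
    Tendsto (fun x : ℝ => ∫ ω : ℝ, φ ω * (g ω : ℂ) / ((lam + x) - Complex.I * ω))
      (𝓝[>] 0) (𝓝 (μ φ)))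

/-! ### The Kuramoto model -/

/-- The moments `Z_j(t, ω) = ∫ e^{ijθ} dρ_t(θ, ω)` of a family of measures on `ℝ / 2πℤ`
(there, Mathlib's monomial `fourier j` is `θ ↦ e^{ijθ}`). -/
def circleMoment (ρ : ℝ → Kernel ℝ (AddCircle (2 * Real.pi))) (j : ℕ) (t ω : ℝ) : ℂ :=
  ∫ θ : AddCircle (2 * Real.pi), fourier (j : ℤ) θ ∂(ρ t ω)

/-- The order parameter `η(t) = ∫ Z_1(t, ω) g(ω) dω`. -/
def orderParameter (g : ℝ → ℝ) (ρ : ℝ → Kernel ℝ (AddCircle (2 * Real.pi))) (t : ℝ) : ℂ :=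
  ∫ ω : ℝ, circleMoment ρ 1 t ω * (g ω : ℂ)

/-- Weak solutions, for `t ≥ 0`, of the continuous Kuramoto model with coupling `K`, frequency
density `g` and initial distribution `h`: probability measures `ρ_t(·, ω)` on the circle, measurable
in `ω`, with `ρ_0(·, ω) = h`, the moments of which solve
`dZ_j/dt = ijω Z_j + (jK/2) (η Z_{j-1} - conj η Z_{j+1})`, `j ≥ 1` (note that `Z_0 = 1`). -/
structure IsKuramotoSolution (K : ℝ) (g : ℝ → ℝ) (h : Measure (AddCircle (2 * Real.pi)))
    (ρ : ℝ → Kernel ℝ (AddCircle (2 * Real.pi))) : Prop where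
  markov : ∀ t, 0 ≤ t → IsMarkovKernel (ρ t)
  initial : ∀ ω, ρ 0 ω = h
  moments : ∀ j : ℕ, 1 ≤ j → ∀ ω t : ℝ, 0 ≤ t →
    HasDerivWithinAt (fun s => circleMoment ρ j s ω)
      (j * Complex.I * ω * circleMoment ρ j t ω + j * K / 2 *
        (orderParameter g ρ t * circleMoment ρ (j - 1) t ω -
          (starRingEnd ℂ) (orderParameter g ρ t) * circleMoment ρ (j + 1) t ω))
      (Set.Ici 0) t

end

end Kuramoto

namespace Kuramoto

noncomputable section

/-! ### Bounded subsets of the inductive limit -/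

/-! For ψ in V_{C,α} the functional i(ψ) is dominated by C times the L¹-norm on ℝ with weight
e^{α|ω|} g(ω), which is finite on Exp₊ because g beats every exponential. Assertions (i) and (ii)
take place among the functionals with such a bound. They form a weakly compact set by Tychonoff's
theorem (`isCompact_dominatedSet_weak`). Moreover the unit ball of each Exp₊(β,n) is totally bounded
for the dominating norm: Cauchy's estimate makes its elements equi-Lipschitz on compact intervals,
Arzelà–Ascoli applies there, and the tails are small (`exists_finite_net`). Hence pointwise
convergence within the set is already norm convergence on every step
(`tendsto_projective_of_tendsto_weak`). The projective and strong topologies agree on the whole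
dual, since a bounded subset of the inductive limit is bounded in a single step
(`exists_subset_image_closedBall`). The metric d always induces the projective topology, and
connectedness is star-shapedness about 0.

For (iii), the number ⟨ψ | μ_λ⟩ has to depend only on i(ψ), and continuously so, although it may
involve ψ(-iλ) at a point off the real axis. The key is `IsWeaklyNull.tendsto_apply`: if functions
u_k have a common exponential bound in the half plane and i(u_k) tends weakly to 0, then u_k tends
to 0 at every point of the open half plane. Products φg are dense in the weighted L¹-space, so the
integrals of u_k over real segments tend to 0; a maximum principle on a square carries this upwards,
and Cauchy's estimate passes from short segments to points. Then μ_λ is a sum of integrals against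
rapidly decaying kernels on ℝ and of integrals or evaluations in the open half plane; on the
imaginary axis this takes a deformation of the contour around the singularity. Sequences are enough
because d metrizes the topology.

For (iv), with η regarded as given, each frequency moves the circle by the Riccati equation ζ' = iωζ
+ (K/2)(η - conj η ζ²), the projectivization of a linear 2×2 system whose solutions are entire in ω
(`IsRiccatiLift.exists_entire`). The averages over h of the j-th powers of the Möbius images of the
circle solve the moment hierarchy, and uniqueness for bounded solutions (`moment_hierarchy_eq_zero`)
identifies them with Z_j for real ω. The form |q|² - |p|² is nondecreasing when Im ω ≥ 0, which
bounds the averages by 1 there; it degrades slowly below the axis, which leaves a strip of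
holomorphy. -/

theorem inclusionLinear_apply {β n : ℕ} (f : ExpBanach β n) {z : ℂ} (hz : 0 ≤ z.im) :
    inclusionLinear β n f z = f.1 z :=
  Set.indicator_of_mem (s := {z : ℂ | 0 ≤ z.im}) hz _

theorem ExpPlus.ext {φ ψ : ExpPlus} (h : ∀ z : ℂ, 0 ≤ z.im → φ z = ψ z) : φ = ψ := by
  refine Subtype.ext (funext fun z => ?_)
  rcases le_or_gt 0 z.im with hz | hz
  · exact h z hz
  · rw [φ.2.1 z hz, ψ.2.1 z hz]

theorem ExpPlus.exists_inclusion (φ : ExpPlus) :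
    ∃ (β n : ℕ) (f : ExpBanach β n), inclusion β n f = φ := by
  obtain ⟨-, β, n, F, hF, h⟩ := φ.2
  refine ⟨β, n, ⟨F, hF⟩, ExpPlus.ext fun z hz => ?_⟩
  exact (inclusionLinear_apply (⟨F, hF⟩ : ExpBanach β n) hz).trans (h z hz).symm

/-- A larger β lowers the weight and a larger n shrinks the region over which the supremum is taken,
so both moves can only decrease the norm. The function is cut off anew because elements are stored
as extensions by zero. -/
theorem exists_norm_le_of_mono {β β' n n' : ℕ} (hβ : β ≤ β') (hn : n ≤ n') (f : ExpBanach β n) :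
    ∃ f' : ExpBanach β' n', inclusion β' n' f' = inclusion β n f ∧ ‖f'‖ ≤ ‖f‖ := by
  obtain ⟨h1, h2, h3, h4⟩ := f.2
  have hle : 1 / ((n' : ℝ) + 1) ≤ 1 / ((n : ℝ) + 1) := by gcongr
  have hsub : region n' ⊆ region n := fun z hz => by
    simp only [region, Set.mem_ofPred_eq] at hz ⊢; linarith
  have heq : Set.EqOn ((region n').indicator f.1) f.1 (region n') :=
    fun z hz => Set.indicator_of_mem hz f.1
  have hb : ∀ z ∈ region n',
      Real.exp (-(β' : ℝ) * ‖z‖) * ‖(region n').indicator f.1 z‖ ≤ ‖f‖ := fun z hz => by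
    rw [heq hz]
    refine le_trans ?_ (expBanach_le_norm f (hsub hz))
    have : (β : ℝ) ≤ β' := by exact_mod_cast hβ
    gcongr
  let f' : ExpBanach β' n' := ⟨(region n').indicator f.1, by
    refine (h1.mono ?_).congr fun z hz => heq ?_
    · intro z hz; simp only [Set.mem_ofPred_eq] at hz ⊢; linarith
    · simp only [region, Set.mem_ofPred_eq] at hz ⊢; linarith,
    (h2.mono hsub).congr heq, fun z hz => Set.indicator_of_notMem hz f.1, ‖f‖, hb⟩
  refine ⟨f', ExpPlus.ext fun z hz => ?_, expBanach_norm_le f' hb⟩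
  exact (inclusionLinear_apply f' hz).trans
    ((heq (real_mem_region n' z hz)).trans (inclusionLinear_apply f hz).symm)

/-- The image only remembers the closed upper half plane. The identity theorem on the connected open
strip, followed by continuity up to its boundary line, recovers the rest. -/
theorem inclusion_injective (β n : ℕ) : Function.Injective (inclusion β n) := by
  rw [injective_iff_map_eq_zero]
  intro f hf
  have h0 : ∀ z : ℂ, 0 ≤ z.im → f.1 z = 0 := fun z hz => by
    rw [← inclusionLinear_apply f hz]
    exact congrFun (congrArg Subtype.val hf) z
  obtain ⟨h1, h2, h3, -⟩ := f.2
  have hn : (0 : ℝ) < 1 / ((n : ℝ) + 1) := by positivity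
  have hopen : IsOpen {z : ℂ | -(1 / ((n : ℝ) + 1)) < z.im} :=
    isOpen_lt continuous_const Complex.continuous_im
  have hconn : IsPreconnected {z : ℂ | -(1 / ((n : ℝ) + 1)) < z.im} :=
    (convex_halfSpace_im_gt _).isPreconnected
  have hint : Set.EqOn f.1 0 {z : ℂ | -(1 / ((n : ℝ) + 1)) < z.im} := by
    refine (h1.analyticOnNhd hopen).eqOn_zero_of_preconnected_of_eventuallyEq_zero hconn
      (z₀ := Complex.I) (by simp only [Set.mem_ofPred_eq, Complex.I_im]; linarith) ?_
    filter_upwards [(isOpen_lt continuous_const Complex.continuous_im).mem_nhds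
      (show (0 : ℝ) < Complex.I.im by simp)] with z hz using h0 z (le_of_lt hz)
  have hcl : region n ⊆ closure {z : ℂ | -(1 / ((n : ℝ) + 1)) < z.im} := by
    rw [Complex.closure_setOfPred_lt_im]; exact fun z hz => hz
  have hreg : Set.EqOn f.1 0 (region n) :=
    hint.of_subset_closure h2 continuousOn_const
      (fun z hz => by simp only [region, Set.mem_ofPred_eq] at hz ⊢; exact hz.le) hcl
  refine Subtype.ext (funext fun z => ?_)
  by_cases hz : z ∈ region n
  · exact hreg hz
  · exact h3 z hz

/-- A bounded subset of the inductive limit is contained in, and bounded in, one of the steps. -/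
theorem exists_subset_image_closedBall {S : Set ExpPlus} (hS : Bornology.IsVonNBounded ℂ S) :
    ∃ k : ℕ, S ⊆ inclusion k k '' Metric.closedBall 0 ((k : ℝ) ^ 2) := by
  by_contra! hcon
  simp only [Set.not_subset] at hcon
  choose f hfS hf using hcon
  -- Here `f k` is an element of `S` outside the ball of radius k² of the step (k, k). Dividing `f
  -- (k + 1)` by k + 1 leaves a point whose norm still exceeds k in every step of index at most k +
  -- 1 that contains it.
  set x : ℕ → ExpPlus := fun k => ((k : ℂ) + 1)⁻¹ • f (k + 1) with hx
  have hne : ∀ k : ℕ, ((k : ℂ) + 1) ≠ 0 := fun k => Nat.cast_add_one_ne_zero k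
  have hlarge : ∀ (β n k : ℕ) (u : ExpBanach β n), β ≤ k + 1 → n ≤ k + 1 →
      inclusion β n u = x k → (k : ℝ) < ‖u‖ := by
    intro β n k u hβ hn hu
    by_contra! hle
    obtain ⟨u', hu', hle'⟩ := exists_norm_le_of_mono hβ hn u
    refine hf (k + 1) ⟨((k : ℂ) + 1) • u', ?_, ?_⟩
    · rw [mem_closedBall_zero_iff, norm_smul]
      have e : ‖(k : ℂ) + 1‖ = (k : ℝ) + 1 := by
        rw [show (k : ℂ) + 1 = ((k + 1 : ℕ) : ℂ) by push_cast; rfl, Complex.norm_natCast]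
        push_cast; rfl
      rw [e]
      push_cast
      nlinarith [norm_nonneg u']
    · rw [map_smul, hu', hu, hx, smul_inv_smul₀ (hne k)]
  have hclosed : IsClosed (Set.range x) := by
    rw [← isOpen_compl_iff]
    -- Closedness in the inductive limit is tested in each step. There the points are at most one
    -- for each k, and their norms tend to infinity, so any ball of radius 1 meets finitely many of
    -- them.
    have : ∀ β n : ℕ, IsClosed (inclusion β n ⁻¹' Set.range x) := by
      intro β n
      rw [← Set.iUnion_singleton_eq_range, Set.preimage_iUnion]
      refine LocallyFinite.isClosed_iUnion ?_ fun k => ?_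
      · intro u
        refine ⟨Metric.ball u 1, Metric.ball_mem_nhds u one_pos, ?_⟩
        obtain ⟨N, hN⟩ := exists_nat_gt (‖u‖ + 1)
        refine (Set.finite_lt_nat (max N (max β n))).subset ?_
        rintro k ⟨v, hv, hvu⟩
        by_contra hk
        simp only [Set.mem_ofPred_eq, not_lt, max_le_iff] at hk
        have h1 := hlarge β n k v (by omega) (by omega) hv
        have h2 : ‖v‖ < ‖u‖ + 1 := by
          have := norm_sub_norm_le v u
          rw [Metric.mem_ball, dist_eq_norm] at hvu
          linarith
        have h3 : (N : ℝ) ≤ k := by exact_mod_cast hk.1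
        linarith
      · refine Set.Subsingleton.isClosed ?_
        intro u hu v hv
        exact inclusion_injective β n (hu.trans hv.symm)
    refine isOpen_iSup_iff.2 fun β => isOpen_iSup_iff.2 fun n => ?_
    exact isOpen_coinduced.2 (this β n).isOpen_compl
  have h0 : (0 : ExpPlus) ∉ Set.range x := by
    rintro ⟨k, hk⟩
    have := hlarge 0 0 k 0 (Nat.zero_le _) (Nat.zero_le _) (by rw [map_zero, hk])
    rw [norm_zero] at this
    exact absurd this (not_lt.2 (Nat.cast_nonneg k))
  -- The complement of the range of `x` is a neighbourhood of 0 and should absorb `S`, but `f (k +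
  -- 1)` is k + 1 times a point of that range, for arbitrarily large k.
  have habs := hS (hclosed.isOpen_compl.mem_nhds h0)
  obtain ⟨r, hr⟩ := habs.exists_pos
  obtain ⟨k, hk⟩ := exists_nat_gt r
  have e : ‖(k : ℂ) + 1‖ = (k : ℝ) + 1 := by
    rw [show (k : ℂ) + 1 = ((k + 1 : ℕ) : ℂ) by push_cast; rfl, Complex.norm_natCast]
    push_cast; rfl
  have := hr.2 ((k : ℂ) + 1) (by rw [e]; linarith) (hfS (k + 1))
  rw [Set.mem_smul_set_iff_inv_smul_mem₀ (hne k)] at this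
  exact this ⟨k, rfl⟩

/-! ### Comparison of the dual topologies -/

theorem tendsto_projective_iff {ι : Type*} {l : Filter ι} {u : ι → ExpPlusDual} {μ : ExpPlusDual} :
    Tendsto u l (@nhds _ projectiveTopology μ) ↔
      ∀ β n : ℕ, Tendsto (fun i => ‖(u i - μ).comp (inclusion β n)‖) l (𝓝 0) := by
  simp only [nhds_iInf, nhds_induced, tendsto_iInf, tendsto_comap_iff]
  refine forall_congr' fun β => forall_congr' fun n => ?_
  rw [tendsto_iff_norm_sub_tendsto_zero]
  rfl

theorem tendsto_weak_iff {ι : Type*} {l : Filter ι} {u : ι → ExpPlusDual} {μ : ExpPlusDual} :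
    Tendsto u l (@nhds _ weakDualTopology μ) ↔ ∀ φ, Tendsto (fun i => u i φ) l (𝓝 (μ φ)) := by
  rw [nhds_induced, tendsto_comap_iff, tendsto_pi_nhds]
  rfl

theorem norm_apply_inclusion_le (μ : ExpPlusDual) {β n : ℕ} (f : ExpBanach β n) :
    ‖μ (inclusion β n f)‖ ≤ ‖μ.comp (inclusion β n)‖ * ‖f‖ :=
  (μ.comp (inclusion β n)).le_opNorm f

/-- A bounded set lies in a ball of one step, so convergence in the norm of that step is uniform on
it. Conversely, restriction to a step is precomposition with a continuous linear map, and the strong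
topology on the dual of a normed space is that of the norm. -/
theorem projective_eq_strong : projectiveTopology = strongDualTopology := by
  refine le_antisymm ?_ ?_
  · rw [← continuous_id_iff_le]
    refine @continuous_iff_continuousAt _ _ projectiveTopology strongDualTopology _ |>.2 fun μ => ?_
    have h := tendsto_projective_iff.1
      (@tendsto_id _ (@nhds _ projectiveTopology μ))
    refine (UniformConvergenceCLM.tendsto_iff_tendstoUniformlyOn (RingHom.id ℂ) ℂ
      {S : Set ExpPlus | Bornology.IsVonNBounded ℂ S}).2 ?_
    intro S hS
    obtain ⟨k, hk⟩ := exists_subset_image_closedBall hS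
    rw [Metric.tendstoUniformlyOn_iff]
    intro ε hε
    have h1 := (h k k).mul_const ((k : ℝ) ^ 2)
    rw [zero_mul] at h1
    filter_upwards [h1.eventually_lt_const hε] with ν hν φ hφ
    obtain ⟨f, hf, rfl⟩ := hk hφ
    rw [dist_comm, dist_eq_norm]
    refine lt_of_le_of_lt ?_ hν
    refine (norm_apply_inclusion_le (ν - μ) f).trans ?_
    rw [mem_closedBall_zero_iff] at hf
    exact mul_le_mul_of_nonneg_left hf (norm_nonneg _)
  · refine le_iInf fun β => le_iInf fun n => ?_
    rw [← continuous_iff_le_induced]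
    exact (ContinuousLinearMap.precomp ℂ (inclusion β n)).continuous

theorem projective_le_weak : projectiveTopology ≤ weakDualTopology := by
  rw [← continuous_id_iff_le]
  refine @continuous_iff_continuousAt _ _ projectiveTopology weakDualTopology _ |>.2 fun μ => ?_
  have h := tendsto_projective_iff.1 (@tendsto_id _ (@nhds _ projectiveTopology μ))
  refine tendsto_weak_iff.2 fun φ => ?_
  obtain ⟨β, n, f, rfl⟩ := φ.exists_inclusion
  rw [tendsto_iff_norm_sub_tendsto_zero]
  have h1 := (h β n).mul_const ‖f‖
  rw [zero_mul] at h1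
  exact squeeze_zero (fun _ => norm_nonneg _)
    (fun ν => norm_apply_inclusion_le (ν - μ) f) h1

theorem t2Space_weak : @T2Space _ weakDualTopology :=
  @T2Space.of_injective_continuous _ _ weakDualTopology _ _ _ DFunLike.coe_injective
    continuous_induced_dom

/-! ### The metric -/

theorem div_one_add_nonneg {a : ℝ} (ha : 0 ≤ a) : 0 ≤ a / (1 + a) := by positivity

theorem div_one_add_lt_one {a : ℝ} (ha : 0 ≤ a) : a / (1 + a) < 1 := by
  rw [div_lt_one (by positivity)]; linarith

theorem div_one_add_mono {a b : ℝ} (ha : 0 ≤ a) (hab : a ≤ b) : a / (1 + a) ≤ b / (1 + b) := by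
  rw [div_le_div_iff₀ (by positivity) (by linarith)]; nlinarith

/-- The bounded rescaling a/(1 + a) is increasing and subadditive, so it preserves triangle
inequalities. -/
theorem div_one_add_le_add {a b c : ℝ} (ha : 0 ≤ a) (hb : 0 ≤ b) (hc : 0 ≤ c) (h : c ≤ a + b) :
    c / (1 + c) ≤ a / (1 + a) + b / (1 + b) := by
  refine (div_one_add_mono hc h).trans ?_
  rw [add_div]
  gcongr <;> linarith

theorem tendsto_div_one_add_iff {ι : Type*} {l : Filter ι} {a : ι → ℝ} (ha : ∀ i, 0 ≤ a i) :
    Tendsto (fun i => a i / (1 + a i)) l (𝓝 0) ↔ Tendsto a l (𝓝 0) := by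
  constructor
  · intro h
    -- If b = a/(1 + a), then a = b/(1 - b), which is continuous at b = 0.
    have h1 : Tendsto (fun i => (a i / (1 + a i)) / (1 - a i / (1 + a i))) l (𝓝 (0 / (1 - 0))) :=
      h.div (tendsto_const_nhds.sub h) (by norm_num)
    rw [zero_div] at h1
    refine h1.congr fun i => ?_
    have := ha i
    have h2 : 1 + a i ≠ 0 := by positivity
    field_simp
    ring
  · intro h
    have h1 := h.div (tendsto_const_nhds (x := (1 : ℝ)).add h) (by norm_num)
    rwa [zero_div] at h1

section BoundedSeries

variable {w : ℕ → ℝ} {a : ℕ → ℝ}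

theorem summable_mul_div_one_add (hw : Summable w) (hw0 : ∀ n, 0 < w n) (ha : ∀ n, 0 ≤ a n) :
    Summable fun n => w n * (a n / (1 + a n)) :=
  hw.of_nonneg_of_le (fun n => mul_nonneg (hw0 n).le (div_one_add_nonneg (ha n)))
    fun n => mul_le_of_le_one_right (hw0 n).le (div_one_add_lt_one (ha n)).le

theorem tsum_mul_div_one_add_le_add {b c : ℕ → ℝ} (hw : Summable w) (hw0 : ∀ n, 0 < w n)
    (ha : ∀ n, 0 ≤ a n) (hb : ∀ n, 0 ≤ b n) (hc : ∀ n, 0 ≤ c n) (h : ∀ n, c n ≤ a n + b n) :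
    ∑' n, w n * (c n / (1 + c n)) ≤
      ∑' n, w n * (a n / (1 + a n)) + ∑' n, w n * (b n / (1 + b n)) := by
  rw [← (summable_mul_div_one_add hw hw0 ha).tsum_add (summable_mul_div_one_add hw hw0 hb)]
  refine (summable_mul_div_one_add hw hw0 hc).tsum_le_tsum (fun n => ?_)
    ((summable_mul_div_one_add hw hw0 ha).add (summable_mul_div_one_add hw hw0 hb))
  rw [← mul_add]
  exact mul_le_mul_of_nonneg_left (div_one_add_le_add (ha n) (hb n) (hc n) (h n)) (hw0 n).le

theorem tsum_mul_div_one_add_eq_zero_iff (hw : Summable w) (hw0 : ∀ n, 0 < w n)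
    (ha : ∀ n, 0 ≤ a n) : ∑' n, w n * (a n / (1 + a n)) = 0 ↔ ∀ n, a n = 0 := by
  rw [← (summable_mul_div_one_add hw hw0 ha).hasSum_iff, hasSum_zero_iff_of_nonneg
    fun n => mul_nonneg (hw0 n).le (div_one_add_nonneg (ha n)), funext_iff]
  refine forall_congr' fun n => ?_
  have := ha n
  have h2 : 1 + a n ≠ 0 := by positivity
  simp [(hw0 n).ne', h2]

/-- Each rescaled term is at most 1, so the weights dominate the series and limits may be taken
termwise. Both layers of the metric d have this shape: the lemma serves for the sum over n inside
and for the sum over β outside. -/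
theorem tendsto_tsum_mul_div_one_add_iff {ι : Type*} {l : Filter ι} {a : ι → ℕ → ℝ}
    (hw : Summable w) (hw0 : ∀ n, 0 < w n) (ha : ∀ i n, 0 ≤ a i n) :
    Tendsto (fun i => ∑' n, w n * (a i n / (1 + a i n))) l (𝓝 0) ↔
      ∀ n, Tendsto (fun i => a i n) l (𝓝 0) := by
  constructor
  · intro h n
    rw [← tendsto_div_one_add_iff fun i => ha i n]
    have h1 := h.const_mul (w n)⁻¹
    rw [mul_zero] at h1
    refine squeeze_zero (fun i => div_one_add_nonneg (ha i n)) (fun i => ?_) h1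
    rw [le_inv_mul_iff₀ (hw0 n)]
    exact (summable_mul_div_one_add hw hw0 (ha i)).le_tsum n
      fun m _ => mul_nonneg (hw0 m).le (div_one_add_nonneg (ha i m))
  · intro h
    have h1 := tendsto_tsum_of_dominated_convergence (f := fun i n => w n * (a i n / (1 + a i n)))
      (𝓕 := l) (g := fun _ => (0 : ℝ)) hw
      (fun n => by
        have := ((tendsto_div_one_add_iff fun i => ha i n).2 (h n)).const_mul (w n)
        rwa [mul_zero] at this)
      (Eventually.of_forall fun i n => by
        rw [Real.norm_of_nonneg (mul_nonneg (hw0 n).le (div_one_add_nonneg (ha i n)))]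
        exact mul_le_of_le_one_right (hw0 n).le (div_one_add_lt_one (ha i n)).le)
    rwa [tsum_zero] at h1

end BoundedSeries

theorem summable_one_div_two_pow : Summable fun n : ℕ => (1 : ℝ) / 2 ^ n := by
  simpa [one_div] using summable_geometric_two

theorem summable_one_div_two_pow_succ : Summable fun n : ℕ => (1 : ℝ) / 2 ^ (n + 1) :=
  (summable_nat_add_iff 1).2 summable_one_div_two_pow

theorem distBeta_nonneg (β : ℕ) (μ ν : ExpPlusDual) : 0 ≤ distBeta β μ ν :=
  tsum_nonneg fun n => mul_nonneg (by positivity) (div_one_add_nonneg (norm_nonneg _))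

theorem dualDist_eq_zero_iff {μ ν : ExpPlusDual} : dualDist μ ν = 0 ↔ μ = ν := by
  rw [dualDist, tsum_mul_div_one_add_eq_zero_iff summable_one_div_two_pow (fun _ => by positivity)
    fun β => distBeta_nonneg β μ ν]
  have h : ∀ β, distBeta β μ ν = 0 ↔ ∀ n, ‖(μ - ν).comp (inclusion β n)‖ = 0 := fun β =>
    tsum_mul_div_one_add_eq_zero_iff summable_one_div_two_pow_succ (fun _ => by positivity)
      fun n => norm_nonneg _
  simp only [h]
  constructor
  · intro h0
    refine ContinuousLinearMap.ext fun φ => ?_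
    obtain ⟨β, n, f, rfl⟩ := φ.exists_inclusion
    have h1 := norm_apply_inclusion_le (μ - ν) f
    rw [h0 β n, zero_mul, norm_le_zero_iff] at h1
    exact sub_eq_zero.1 h1
  · rintro rfl β n
    rw [sub_self, ContinuousLinearMap.zero_comp, norm_zero]

theorem norm_sub_comp_comm (μ ν : ExpPlusDual) (β n : ℕ) :
    ‖(μ - ν).comp (inclusion β n)‖ = ‖(ν - μ).comp (inclusion β n)‖ := by
  rw [ContinuousLinearMap.sub_comp, ContinuousLinearMap.sub_comp, norm_sub_rev]

theorem dualDist_comm (μ ν : ExpPlusDual) : dualDist μ ν = dualDist ν μ := by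
  simp only [dualDist, distBeta, norm_sub_comp_comm μ ν]

theorem dualDist_triangle (μ ν κ : ExpPlusDual) : dualDist μ κ ≤ dualDist μ ν + dualDist ν κ := by
  refine tsum_mul_div_one_add_le_add summable_one_div_two_pow (fun _ => by positivity)
    (fun β => distBeta_nonneg β _ _) (fun β => distBeta_nonneg β _ _)
    (fun β => distBeta_nonneg β _ _) fun β => ?_
  refine tsum_mul_div_one_add_le_add summable_one_div_two_pow_succ (fun _ => by positivity)
    (fun _ => norm_nonneg _) (fun _ => norm_nonneg _) (fun _ => norm_nonneg _) fun n => ?_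
  simp only [ContinuousLinearMap.sub_comp]
  exact norm_sub_le_norm_sub_add_norm_sub _ _ _

theorem tendsto_projective_iff_dualDist {ι : Type*} {l : Filter ι} {u : ι → ExpPlusDual}
    {μ : ExpPlusDual} :
    Tendsto u l (@nhds _ projectiveTopology μ) ↔ Tendsto (fun i => dualDist (u i) μ) l (𝓝 0) := by
  rw [tendsto_projective_iff]
  unfold dualDist
  rw [tendsto_tsum_mul_div_one_add_iff summable_one_div_two_pow (fun _ => by positivity)
    fun i β => distBeta_nonneg β (u i) μ]
  refine forall_congr' fun β => ?_
  unfold distBeta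
  rw [tendsto_tsum_mul_div_one_add_iff summable_one_div_two_pow_succ (fun _ => by positivity)
    fun i n => norm_nonneg _]

/-- The metric `d` on the dual space, or on any subset. -/
@[reducible]
def dualMetricOn (S : Set ExpPlusDual) : MetricSpace S where
  dist x y := dualDist x y
  dist_self _ := dualDist_eq_zero_iff.2 rfl
  dist_comm _ _ := dualDist_comm _ _
  dist_triangle _ _ _ := dualDist_triangle _ _ _
  eq_of_dist_eq_zero h := Subtype.ext (dualDist_eq_zero_iff.1 h)

/-- Convergence is compared along arbitrary filters, not only sequences, so applying the comparison
to the identity along the neighbourhood filters yields equality of the topologies. -/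
theorem dualMetricOn_topology (S : Set ExpPlusDual) :
    (dualMetricOn S).toPseudoMetricSpace.toUniformSpace.toTopologicalSpace =
      topologyOn projectiveTopology S := by
  have key : ∀ (l : Filter S) (x : S),
      Tendsto id l (@nhds _ (dualMetricOn S).toUniformSpace.toTopologicalSpace x) ↔
        Tendsto id l (@nhds _ (topologyOn projectiveTopology S) x) := by
    intro l x
    rw [@nhds_induced _ _ projectiveTopology, tendsto_comap_iff, tendsto_projective_iff_dualDist,
      @tendsto_iff_dist_tendsto_zero _ _ (dualMetricOn S).toPseudoMetricSpace]
    rfl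
  refine TopologicalSpace.ext_nhds fun x => le_antisymm ?_ ?_
  · exact (key _ x).1 tendsto_id
  · exact (key _ x).2 tendsto_id

/-! ### Estimates in `Exp₊(β, n)` -/

theorem expBanach_norm_apply_le {β n : ℕ} (f : ExpBanach β n) {z : ℂ} (hz : z ∈ region n) :
    ‖f.1 z‖ ≤ ‖f‖ * Real.exp (β * ‖z‖) := by
  have h := expBanach_le_norm f hz
  rwa [neg_mul, Real.exp_neg, inv_mul_le_iff₀ (Real.exp_pos _), mul_comm] at h

theorem norm_inclusion_ofReal_le {β n : ℕ} (f : ExpBanach β n) (ω : ℝ) :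
    ‖inclusion β n f ω‖ ≤ ‖f‖ * Real.exp (β * |ω|) := by
  have h := expBanach_norm_apply_le f (real_mem_region n (ω : ℂ) (by simp))
  rwa [Complex.norm_real, Real.norm_eq_abs, ← inclusionLinear_apply f (by simp)] at h

/-- Functions in the unit ball of `Exp₊(β, n)` are uniformly Lipschitz on compact intervals. -/
theorem exists_lipschitz_unitBall (β n : ℕ) (R : ℝ) :
    ∃ M : ℝ, 0 ≤ M ∧ ∀ f : ExpBanach β n, ‖f‖ ≤ 1 → ∀ x y : ℝ, |x| ≤ R → |y| ≤ R →
      ‖inclusion β n f x - inclusion β n f y‖ ≤ M * |x - y| := by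
  -- Half the depth of the strip below the real axis: closed discs of radius `r` about real points
  -- stay in the domain of holomorphy, and Cauchy's estimate on them gives the Lipschitz constant.
  set r : ℝ := 1 / ((n : ℝ) + 1) / 2 with hr
  have hr0 : 0 < r := by positivity
  have hr1 : 1 / ((n : ℝ) + 1) = 2 * r := by rw [hr]; ring
  refine ⟨Real.exp (β * (R + r)) / r, by positivity, fun f hf x y hx hy => ?_⟩
  have hopen : IsOpen {z : ℂ | -(1 / ((n : ℝ) + 1)) < z.im} :=
    isOpen_lt continuous_const Complex.continuous_im
  have hconv : Convex ℝ (Metric.closedBall (0 : ℂ) R ∩ {z : ℂ | z.im = 0}) := by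
    refine (convex_closedBall 0 R).inter ?_
    exact (convex_singleton (0 : ℝ)).linear_preimage Complex.imLm
  have hmem : ∀ x : ℝ, |x| ≤ R → (x : ℂ) ∈ Metric.closedBall (0 : ℂ) R ∩ {z : ℂ | z.im = 0} :=
    fun x hx => ⟨by simpa using hx, by simp⟩
  have hball : ∀ c ∈ Metric.closedBall (0 : ℂ) R ∩ {z : ℂ | z.im = 0},
      Metric.closedBall c r ⊆ {z : ℂ | -(1 / ((n : ℝ) + 1)) < z.im} := by
    rintro c ⟨-, hc⟩ z hz
    have h1 := (Complex.abs_im_le_norm (z - c)).trans (mem_closedBall_iff_norm.1 hz)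
    simp only [Set.mem_ofPred_eq] at hc ⊢
    rw [Complex.sub_im, hc, sub_zero] at h1
    rw [hr1]
    linarith [(abs_le.1 h1).1]
  have h := Convex.norm_image_sub_le_of_norm_deriv_le (𝕜 := ℂ) (f := f.1)
    (s := Metric.closedBall (0 : ℂ) R ∩ {z : ℂ | z.im = 0}) (C := Real.exp (β * (R + r)) / r)
    (fun c hc => f.2.1.differentiableAt (hopen.mem_nhds
      (hball c hc (Metric.mem_closedBall_self hr0.le)))) (fun c hc => ?_) hconv
      (hmem y hy) (hmem x hx)
  · have e : ∀ x : ℝ, inclusion β n f x = f.1 x := fun x => inclusionLinear_apply f (by simp)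
    rwa [← Complex.ofReal_sub, Complex.norm_real, Real.norm_eq_abs, ← e, ← e] at h
  · refine Complex.norm_deriv_le_of_forall_mem_sphere_norm_le hr0 ?_ fun z hz => ?_
    · exact DifferentiableOn.diffContOnCl_ball (f.2.1.mono (hball c hc)) subset_rfl
    · have h0 : -(1 / ((n : ℝ) + 1)) < z.im := hball c hc (Metric.sphere_subset_closedBall hz)
      have h1 : z ∈ region n := h0.le
      refine (expBanach_norm_apply_le f h1).trans ?_
      have h2 : ‖z‖ ≤ R + r := by
        have h3 := mem_closedBall_zero_iff.1 hc.1
        have h4 := mem_sphere_iff_norm.1 hz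
        have h5 := norm_le_norm_add_norm_sub' z c
        linarith
      calc ‖f‖ * Real.exp (β * ‖z‖) ≤ 1 * Real.exp (β * (R + r)) := by gcongr
        _ = _ := one_mul _

section Weight

variable {g : ℝ → ℝ} {G : ℂ → ℂ} {δ : ℝ}

theorem IsGaussianType.exists_tail_lt (hg : IsGaussianType g G δ) (a R₀ : ℝ) {ε : ℝ}
    (hε : 0 < ε) : ∃ R : ℝ, R₀ < R ∧ ∫ ω in (Set.Icc (-R) R)ᶜ, Real.exp (a * |ω|) * g ω < ε := by
  have hi := hg.integrable_exp a
  have h := (aecover_Icc (μ := (volume : Measure ℝ)) tendsto_neg_atTop_atBot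
    tendsto_id).integral_tendsto_of_countably_generated hi
  have h1 := (h.const_sub (∫ ω, Real.exp (a * |ω|) * g ω)).eventually_lt_const
    (show _ - _ < ε by rw [sub_self]; exact hε)
  obtain ⟨R, hR, hR0⟩ := (h1.and (eventually_gt_atTop R₀)).exists
  exact ⟨R, hR0, by rw [setIntegral_compl measurableSet_Icc hi]; exact hR⟩

/-- The `L¹`-norm of the restriction to `ℝ`, for the weight `exp (α |ω|) g(ω)`. -/
def weightedNorm (g : ℝ → ℝ) (α : ℝ) (φ : ExpPlus) : ℝ :=
  ∫ ω : ℝ, ‖φ ω‖ * (Real.exp (α * |ω|) * g ω)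

theorem integrable_weightedNorm (hg : IsGaussianType g G δ) (α : ℝ) (φ : ExpPlus) :
    Integrable fun ω : ℝ => ‖φ ω‖ * (Real.exp (α * |ω|) * g ω) := by
  obtain ⟨β, C, hC0, hC⟩ := expPlus_bound φ
  refine ((hg.integrable_exp (β + α)).const_mul C).mono' ?_ (Eventually.of_forall fun ω => ?_)
  · exact ((expPlus_continuous φ).norm.mul ((Real.continuous_exp.comp
      (continuous_const.mul continuous_abs)).mul hg.continuous)).aestronglyMeasurable
  · have := hg.nonneg ω
    rw [Real.norm_of_nonneg (by positivity), add_mul, Real.exp_add]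
    calc ‖φ ω‖ * (Real.exp (α * |ω|) * g ω)
        ≤ (C * Real.exp (β * |ω|)) * (Real.exp (α * |ω|) * g ω) := by gcongr; exact hC ω
      _ = _ := by ring

theorem weightedNorm_inclusion_le (hg : IsGaussianType g G δ) (α : ℝ) {β n : ℕ}
    (f : ExpBanach β n) :
    weightedNorm g α (inclusion β n f) ≤
      ‖f‖ * ∫ ω : ℝ, Real.exp ((β + α) * |ω|) * g ω := by
  rw [← integral_const_mul]
  refine integral_mono (integrable_weightedNorm hg α _)
    ((hg.integrable_exp (β + α)).const_mul _) fun ω => ?_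
  have := hg.nonneg ω
  simp only [add_mul, Real.exp_add]
  calc ‖inclusion β n f ω‖ * (Real.exp (α * |ω|) * g ω)
      ≤ (‖f‖ * Real.exp (β * |ω|)) * (Real.exp (α * |ω|) * g ω) := by
        gcongr; exact norm_inclusion_ofReal_le f ω
    _ = _ := by ring

/-- The unit ball of `Exp₊(β, n)` is totally bounded for the weighted `L¹`-norm. -/
theorem exists_finite_net (hg : IsGaussianType g G δ) (α : ℝ) (β n : ℕ) {ε : ℝ} (hε : 0 < ε) :
    ∃ t : Set (ExpBanach β n), t.Finite ∧ ∀ f : ExpBanach β n, ‖f‖ ≤ 1 →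
      ∃ f' ∈ t, weightedNorm g α (inclusion β n (f - f')) ≤ ε := by
  -- Differences of elements of the unit ball have norm at most 2, so outside [-R, R] they
  -- contribute at most 2 · ε/4. The choice of `ε'` leaves the other half of ε for the inside.
  obtain ⟨R, hR0, hR⟩ := hg.exists_tail_lt (β + α) 0 (show 0 < ε / 4 by positivity)
  set I : ℝ := ∫ ω, Real.exp (α * |ω|) * g ω with hI
  have hI0 : 0 ≤ I := integral_nonneg fun ω => mul_nonneg (Real.exp_pos _).le (hg.nonneg ω)
  set ε' : ℝ := ε / 2 / (I + 1) with hε'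
  have hε'0 : 0 < ε' := by positivity
  obtain ⟨M, hM0, hM⟩ := exists_lipschitz_unitBall β n R
  let res : ExpBanach β n → BoundedContinuousFunction (Set.Icc (-R) R) ℂ := fun f =>
    BoundedContinuousFunction.mkOfCompact ⟨fun x => inclusion β n f ((x : ℝ) : ℂ),
      (expPlus_continuous _).comp continuous_subtype_val⟩
  -- Arzelà–Ascoli for the restrictions to [-R, R]: the growth bound makes them uniformly bounded,
  -- and the common Lipschitz constant makes them equicontinuous.
  have hcpt : IsCompact (closure (res '' Metric.closedBall 0 1)) := by
    refine BoundedContinuousFunction.arzela_ascoli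
      (Metric.closedBall (0 : ℂ) (Real.exp (β * R))) (isCompact_closedBall _ _) _ ?_ ?_
    · rintro _ x ⟨f, hf, rfl⟩
      rw [mem_closedBall_zero_iff] at hf ⊢
      refine (norm_inclusion_ofReal_le f x).trans ?_
      have hx : |(x : ℝ)| ≤ R := abs_le.2 x.2
      calc ‖f‖ * Real.exp (β * |(x : ℝ)|) ≤ 1 * Real.exp (β * R) := by gcongr
        _ = _ := one_mul _
    · refine (LipschitzWith.uniformEquicontinuous _ M.toNNReal ?_).equicontinuous
      rintro ⟨_, f, hf, rfl⟩
      rw [mem_closedBall_zero_iff] at hf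
      refine LipschitzWith.of_dist_le_mul fun x y => ?_
      rw [dist_eq_norm, Real.coe_toNNReal M hM0, Subtype.dist_eq, Real.dist_eq]
      exact hM f hf x y (abs_le.2 x.2) (abs_le.2 y.2)
  obtain ⟨t, hts, htf, ht'⟩ := Set.exists_subset_image_finite_and.1
    (Metric.finite_approx_of_totallyBounded
      (hcpt.totallyBounded.subset subset_closure) ε' hε'0)
  refine ⟨t, htf, fun f hf => ?_⟩
  obtain ⟨_, ⟨f', hf't, rfl⟩, hff'⟩ : ∃ y ∈ res '' t, res f ∈ Metric.ball y ε' := by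
    simpa only [Set.mem_iUnion, exists_prop] using
      ht' (Set.mem_image_of_mem res (mem_closedBall_zero_iff.2 hf))
  refine ⟨f', hf't, ?_⟩
  have hf' : ‖f'‖ ≤ 1 := mem_closedBall_zero_iff.1 (hts hf't)
  have hsub : ‖f - f'‖ ≤ 2 := (norm_sub_le f f').trans (by linarith)
  have hle : ∀ ω : ℝ, ‖inclusion β n (f - f') ω‖ * (Real.exp (α * |ω|) * g ω) ≤
      ε' * (Real.exp (α * |ω|) * g ω) + (Set.Icc (-R) R)ᶜ.indicator
        (fun ω => 2 * (Real.exp ((β + α) * |ω|) * g ω)) ω := by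
    intro ω
    have hgω := hg.nonneg ω
    by_cases hω : ω ∈ Set.Icc (-R) R
    · rw [Set.indicator_of_notMem (by simpa using hω), add_zero]
      gcongr
      have h1 : inclusion β n (f - f') ω = inclusion β n f ω - inclusion β n f' ω := by
        rw [map_sub]; rfl
      rw [h1, ← dist_eq_norm]
      exact ((res f).dist_coe_le_dist (g := res f') ⟨ω, hω⟩).trans (Metric.mem_ball.1 hff').le
    · rw [Set.indicator_of_mem hω]
      refine le_trans ?_ (le_add_of_nonneg_left (by positivity))
      rw [add_mul, Real.exp_add]
      calc ‖inclusion β n (f - f') ω‖ * (Real.exp (α * |ω|) * g ω)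
          ≤ (2 * Real.exp (β * |ω|)) * (Real.exp (α * |ω|) * g ω) := by
            gcongr
            exact (norm_inclusion_ofReal_le _ ω).trans (by gcongr)
        _ = _ := by ring
  have hi2 : Integrable ((Set.Icc (-R) R)ᶜ.indicator
      fun ω => 2 * (Real.exp ((β + α) * |ω|) * g ω)) :=
    ((hg.integrable_exp (β + α)).const_mul 2).indicator measurableSet_Icc.compl
  have hi1 : Integrable fun ω => ε' * (Real.exp (α * |ω|) * g ω) :=
    (hg.integrable_exp α).const_mul ε'
  refine (integral_mono (integrable_weightedNorm hg α _) (hi1.add hi2) hle).trans ?_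
  simp only [Pi.add_apply]
  rw [integral_add hi1 hi2, integral_const_mul, integral_indicator measurableSet_Icc.compl,
    integral_const_mul, ← hI]
  have h3 : ε' * I ≤ ε / 2 := by
    rw [hε', div_mul_eq_mul_div, div_le_iff₀ (by positivity)]
    nlinarith
  linarith

/-! ### Functionals dominated by the weighted norm -/

/-- The functionals dominated by `M` times the weighted `L¹`-norm. -/
def dominatedSet (g : ℝ → ℝ) (M α : ℝ) : Set ExpPlusDual :=
  {μ | ∀ φ, ‖μ φ‖ ≤ M * weightedNorm g α φ}

theorem boundedImage_subset_dominatedSet (hg : IsGaussianType g G δ) (C α : ℝ) :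
    boundedImage hg C α ⊆ dominatedSet g C α := by
  rintro _ ⟨ψ, hψ, rfl⟩ φ
  rw [weightedNorm, ← integral_const_mul]
  refine norm_integral_le_of_norm_le ((integrable_weightedNorm hg α φ).const_mul C)
    (Eventually.of_forall fun ω => ?_)
  have h := hψ ω (by simp)
  rw [Complex.norm_real, Real.norm_eq_abs, neg_mul, Real.exp_neg,
    mul_inv_le_iff₀ (Real.exp_pos _)] at h
  have hgω := hg.nonneg ω
  rw [norm_mul, norm_mul, Complex.norm_real, Real.norm_of_nonneg hgω]
  calc ‖φ ω‖ * ‖ψ ω‖ * g ω ≤ ‖φ ω‖ * (C * Real.exp (α * |ω|)) * g ω := by gcongr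
    _ = _ := by ring

/-- This is the Banach–Alaoglu argument. In the product over all φ the set becomes a product of
closed discs intersected with the closed conditions of linearity. Nothing is lost in the limit,
because the domination itself implies continuity on every step. -/
theorem isCompact_dominatedSet_weak (hg : IsGaussianType g G δ) {M : ℝ} (hM : 0 ≤ M) (α : ℝ) :
    @IsCompact _ weakDualTopology (dominatedSet g M α) := by
  let _ : TopologicalSpace ExpPlusDual := weakDualTopology
  have hind : Topology.IsInducing (fun (μ : ExpPlusDual) (φ : ExpPlus) => μ φ) := ⟨rfl⟩
  rw [hind.isCompact_iff]
  have himg : (fun (μ : ExpPlusDual) (φ : ExpPlus) => μ φ) '' dominatedSet g M α =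
      Set.univ.pi (fun φ => Metric.closedBall (0 : ℂ) (M * weightedNorm g α φ)) ∩
        ({f | ∀ φ ψ, f (φ + ψ) = f φ + f ψ} ∩ {f | ∀ (c : ℂ) φ, f (c • φ) = c • f φ}) := by
    ext f
    constructor
    · rintro ⟨μ, hμ, rfl⟩
      exact ⟨fun φ _ => mem_closedBall_zero_iff.2 (hμ φ), fun φ ψ => map_add μ φ ψ,
        fun c φ => map_smul μ c φ⟩
    · rintro ⟨h1, h2, h3⟩
      have hb : ∀ φ, ‖f φ‖ ≤ M * weightedNorm g α φ := fun φ =>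
        mem_closedBall_zero_iff.1 (h1 φ trivial)
      let L : ExpPlus →ₗ[ℂ] ℂ := ⟨⟨f, h2⟩, h3⟩
      have hc : Continuous L := by
        rw [continuous_expPlus_iff]
        intro β n
        refine AddMonoidHomClass.continuous_of_bound (L.comp (inclusionLinear β n))
          (M * ∫ ω : ℝ, Real.exp ((β + α) * |ω|) * g ω) fun F => ?_
        refine (hb _).trans ?_
        rw [mul_assoc, mul_comm (∫ ω : ℝ, _)]
        exact mul_le_mul_of_nonneg_left (weightedNorm_inclusion_le hg α F) hM
      exact ⟨⟨L, hc⟩, hb, rfl⟩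
  rw [himg]
  refine (isCompact_univ_pi fun φ => isCompact_closedBall _ _).inter_right ?_
  refine IsClosed.inter ?_ ?_
  · simp only [Set.ofPred_forall]
    exact isClosed_iInter fun φ => isClosed_iInter fun ψ =>
      isClosed_eq (continuous_apply _) (Continuous.add (continuous_apply φ) (continuous_apply ψ))
  · simp only [Set.ofPred_forall]
    exact isClosed_iInter fun c => isClosed_iInter fun φ =>
      isClosed_eq (continuous_apply _) (Continuous.const_smul (continuous_apply φ) c)

/-- On a dominated set, pointwise convergence is uniform on the unit balls of `Exp₊(β, n)`, since
these are totally bounded for the dominating norm. -/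
theorem tendsto_projective_of_tendsto_weak (hg : IsGaussianType g G δ) {M : ℝ} (hM : 0 ≤ M)
    (α : ℝ) {ι : Type*} {l : Filter ι} {u : ι → ExpPlusDual} {μ : ExpPlusDual}
    (hu : ∀ i, u i ∈ dominatedSet g M α) (hμ : μ ∈ dominatedSet g M α)
    (h : Tendsto u l (@nhds _ weakDualTopology μ)) :
    Tendsto u l (@nhds _ projectiveTopology μ) := by
  rw [tendsto_weak_iff] at h
  rw [tendsto_projective_iff]
  intro β n
  rw [Metric.tendsto_nhds]
  intro ε hε
  -- Replacing `f` by a point of the net costs at most 2M times the mesh, once M for `u i` and once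
  -- for `μ`. The mesh keeps this below ε/3, and 2M + 1 avoids dividing by zero.
  obtain ⟨t, htf, ht⟩ := exists_finite_net hg α β n
    (show 0 < ε / 3 / (2 * M + 1) by positivity)
  have h1 : ∀ᶠ i in l, ∀ f ∈ t, ‖(u i - μ) (inclusion β n f)‖ < ε / 3 := by
    rw [htf.eventually_all]
    intro f _
    have := tendsto_iff_norm_sub_tendsto_zero.1 (h (inclusion β n f))
    exact this.eventually_lt_const (by positivity)
  filter_upwards [h1] with i hi
  rw [dist_zero_right, norm_norm]
  refine lt_of_le_of_lt (ContinuousLinearMap.opNorm_le_of_unit_norm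
    (show 0 ≤ ε / 3 + ε / 3 by positivity) fun f hf => ?_) (show ε / 3 + ε / 3 < ε by linarith)
  obtain ⟨f', hf't, hf'⟩ := ht f hf.le
  have e : ((u i - μ).comp (inclusion β n)) f =
      (u i - μ) (inclusion β n f') + (u i - μ) (inclusion β n (f - f')) := by
    rw [← map_add, ← map_add, add_sub_cancel]; rfl
  rw [e]
  refine (norm_add_le _ _).trans (add_le_add (hi f' hf't).le ?_)
  calc ‖(u i - μ) (inclusion β n (f - f'))‖
      ≤ ‖u i (inclusion β n (f - f'))‖ + ‖μ (inclusion β n (f - f'))‖ := norm_sub_le _ _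
    _ ≤ M * (ε / 3 / (2 * M + 1)) + M * (ε / 3 / (2 * M + 1)) :=
        add_le_add ((hu i _).trans (by gcongr)) ((hμ _).trans (by gcongr))
    _ = (2 * M) / (2 * M + 1) * (ε / 3) := by ring
    _ ≤ 1 * (ε / 3) := by
        gcongr
        rw [div_le_one (by positivity)]; linarith
    _ = ε / 3 := one_mul _

theorem topologyOn_weak_eq_projective (hg : IsGaussianType g G δ) {M : ℝ} (hM : 0 ≤ M)
    (α : ℝ) {S : Set ExpPlusDual} (hS : S ⊆ dominatedSet g M α) :
    topologyOn weakDualTopology S = topologyOn projectiveTopology S := by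
  refine le_antisymm ?_ (induced_mono projective_le_weak)
  refine (@continuous_id_iff_le _ (topologyOn weakDualTopology S)
    (topologyOn projectiveTopology S)).1 ?_
  refine @continuous_iff_continuousAt _ _ (topologyOn weakDualTopology S)
    (topologyOn projectiveTopology S) _ |>.2 fun x => ?_
  have e := @nhds_induced _ _ projectiveTopology ((↑) : S → ExpPlusDual) x
  refine (tendsto_comap_iff.2 ?_).mono_right e.ge
  refine tendsto_projective_of_tendsto_weak hg hM α (fun i => hS i.2) (hS x.2) ?_
  exact @Continuous.tendsto _ _ (topologyOn weakDualTopology S) weakDualTopology _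
    (@continuous_induced_dom _ _ _ weakDualTopology) x

theorem isCompact_dominatedSet_projective (hg : IsGaussianType g G δ) {M : ℝ} (hM : 0 ≤ M)
    (α : ℝ) : @IsCompact _ projectiveTopology (dominatedSet g M α) := by
  have h := isCompact_dominatedSet_weak hg hM α
  rw [@isCompact_iff_compactSpace _ weakDualTopology] at h
  rw [@isCompact_iff_compactSpace _ projectiveTopology]
  have e := topologyOn_weak_eq_projective hg hM α (subset_refl (dominatedSet g M α))
  change @CompactSpace _ (topologyOn projectiveTopology (dominatedSet g M α))
  rw [← e]
  exact h

/-! ### Connectedness, compactness and metrizability of the closure -/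

theorem starConvex_boundedImage (hg : IsGaussianType g G δ) (C α : ℝ) {μ : ExpPlusDual}
    (hμ : μ ∈ boundedImage hg C α) {t : ℝ} (ht : t ∈ Set.Icc (0 : ℝ) 1) :
    (t : ℂ) • μ ∈ boundedImage hg C α := by
  obtain ⟨ψ, hψ, rfl⟩ := hμ
  refine ⟨(t : ℂ) • ψ, fun z hz => ?_, ContinuousLinearMap.ext fun φ => ?_⟩
  · have e : ((t : ℂ) • ψ) z = t * ψ z := rfl
    rw [e, norm_mul, Complex.norm_real, Real.norm_of_nonneg ht.1, mul_assoc]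
    refine le_trans ?_ (hψ z hz)
    exact mul_le_of_le_one_left (by positivity) ht.2
  · change ∫ ω : ℝ, φ ω * ((t : ℂ) • ψ) ω * (g ω : ℂ) = (t : ℂ) • ∫ ω : ℝ, φ ω * ψ ω * (g ω : ℂ)
    rw [smul_eq_mul, ← integral_const_mul]
    refine integral_congr_ae (Eventually.of_forall fun ω => ?_)
    change φ ω * (t * ψ ω) * (g ω : ℂ) = t * (φ ω * ψ ω * (g ω : ℂ))
    ring

theorem zero_mem_boundedImage (hg : IsGaussianType g G δ) {C : ℝ} (hC : 0 ≤ C) (α : ℝ) :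
    (0 : ExpPlusDual) ∈ boundedImage hg C α := by
  refine ⟨0, fun z _ => ?_, ContinuousLinearMap.ext fun φ => ?_⟩
  · have e : (0 : ExpPlus) z = 0 := rfl
    simpa [e] using hC
  · change ∫ ω : ℝ, φ ω * (0 : ℂ) * (g ω : ℂ) = 0
    simp

theorem continuous_smul_projective (μ : ExpPlusDual) :
    @Continuous _ _ _ projectiveTopology fun t : ℂ => t • μ := by
  refine @continuous_iff_continuousAt _ _ _ projectiveTopology _ |>.2 fun t => ?_
  refine tendsto_projective_iff.2 fun β n => ?_
  have e : ∀ s : ℂ, ‖(s • μ - t • μ).comp (inclusion β n)‖ =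
      ‖s - t‖ * ‖μ.comp (inclusion β n)‖ := fun s => by
    have e1 : (s • μ - t • μ).comp (inclusion β n) = (s - t) • μ.comp (inclusion β n) := by
      ext f
      change s * μ (inclusion β n f) - t * μ (inclusion β n f) = (s - t) * μ (inclusion β n f)
      ring
    rw [e1, norm_smul]
  simp only [e]
  have : Continuous fun s : ℂ => ‖s - t‖ * ‖μ.comp (inclusion β n)‖ := by fun_prop
  simpa using this.tendsto t

/-- Every point is joined to 0 by a segment inside the set. Segments are continuous for the
projective topology, hence for every coarser one. -/
theorem isConnected_boundedImage (hg : IsGaussianType g G δ) {C : ℝ} (hC : 0 ≤ C) (α : ℝ)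
    {τ : TopologicalSpace ExpPlusDual} (hτ : projectiveTopology ≤ τ) :
    @IsConnected _ τ (boundedImage hg C α) := by
  refine ⟨⟨0, zero_mem_boundedImage hg hC α⟩, isPreconnected_of_forall 0 fun μ hμ => ?_⟩
  refine ⟨(fun t : ℝ => (t : ℂ) • μ) '' Set.Icc 0 1, ?_, ⟨0, by simp, zero_smul ℂ μ⟩,
    ⟨1, by simp, one_smul ℂ μ⟩, ?_⟩
  · rintro _ ⟨t, ht, rfl⟩
    exact starConvex_boundedImage hg C α hμ ht
  · exact isPreconnected_Icc.image _
      ((continuous_le_rng hτ (continuous_smul_projective μ)).comp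
        Complex.continuous_ofReal).continuousOn

/-- The dominated set is compact in the Hausdorff weak topology, hence weakly closed, hence closed
in every finer topology. -/
theorem closure_boundedImage_subset (hg : IsGaussianType g G δ) {C : ℝ} (hC : 0 ≤ C) (α : ℝ)
    {τ : TopologicalSpace ExpPlusDual} (hτ : τ ≤ weakDualTopology) :
    @closure _ τ (boundedImage hg C α) ⊆ dominatedSet g C α := by
  refine closure_minimal (boundedImage_subset_dominatedSet hg C α) ?_
  have h := @IsCompact.isClosed _ weakDualTopology t2Space_weak _
    (isCompact_dominatedSet_weak hg hC α)
  exact h.mono hτ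

/-- The closure is taken in τ itself. For either topology it stays inside the dominated set, which
is compact and on which the two topologies agree, so the metric of the projective topology serves
for both. -/
theorem closure_boundedImage_properties (hg : IsGaussianType g G δ) {C : ℝ} (hC : 0 ≤ C) (α : ℝ)
    {τ : TopologicalSpace ExpPlusDual}
    (hτ : τ = weakDualTopology ∨ τ = projectiveTopology) :
    @IsConnected _ τ (@closure _ τ (boundedImage hg C α)) ∧
      @IsCompact _ τ (@closure _ τ (boundedImage hg C α)) ∧
        ∃ M : MetricSpace (@closure _ τ (boundedImage hg C α)),
          M.toPseudoMetricSpace.toUniformSpace.toTopologicalSpace =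
            topologyOn τ (@closure _ τ (boundedImage hg C α)) ∧
          ∀ x y : @closure _ τ (boundedImage hg C α), dist x y = dualDist x y := by
  have h1 : projectiveTopology ≤ τ := by
    rcases hτ with rfl | rfl
    exacts [projective_le_weak, le_rfl]
  have h2 : τ ≤ weakDualTopology := by
    rcases hτ with rfl | rfl
    exacts [le_rfl, projective_le_weak]
  have h3 : @IsCompact _ τ (dominatedSet g C α) := by
    rcases hτ with rfl | rfl
    exacts [isCompact_dominatedSet_weak hg hC α, isCompact_dominatedSet_projective hg hC α]
  have h4 := closure_boundedImage_subset hg hC α h2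
  refine ⟨(isConnected_boundedImage hg hC α h1).closure,
    h3.of_isClosed_subset isClosed_closure h4, dualMetricOn _, ?_, fun _ _ => rfl⟩
  rw [dualMetricOn_topology]
  rcases hτ with rfl | rfl
  · exact (topologyOn_weak_eq_projective hg hC α h4).symm
  · rfl

end Weight

/-! ### Auxiliary facts of complex analysis -/

/-- The integral of a bounded family of holomorphic functions is holomorphic. -/
theorem differentiableOn_integral_of_norm_le {X : Type*} [MeasurableSpace X] {ν : Measure X}
    [IsFiniteMeasure ν] {f : ℂ → X → ℂ} {U : Set ℂ} (hU : IsOpen U) {B : ℝ}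
    (hm : ∀ z ∈ U, AEStronglyMeasurable (f z) ν)
    (hd : ∀ᵐ x ∂ν, DifferentiableOn ℂ (fun z => f z x) U)
    (hb : ∀ᵐ x ∂ν, ∀ z ∈ U, ‖f z x‖ ≤ B) :
    DifferentiableOn ℂ (fun z => ∫ x, f z x ∂ν) U := by
  intro z₀ hz₀
  obtain ⟨R, hR0, hR⟩ := Metric.isOpen_iff.1 hU z₀ hz₀
  set r : ℝ := R / 3 with hr
  have hr0 : 0 < r := by positivity
  have hsub : ∀ z ∈ Metric.ball z₀ r, Metric.closedBall z r ⊆ U := fun z hz w hw => hR (by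
    have h1 := Metric.mem_ball.1 hz
    have h2 := Metric.mem_closedBall.1 hw
    have h3 := dist_triangle w z z₀
    rw [Metric.mem_ball]
    linarith)
  have hzU : ∀ z ∈ Metric.ball z₀ r, z ∈ U := fun z hz =>
    hsub z hz (Metric.mem_closedBall_self hr0.le)
  have hz₀r : z₀ ∈ Metric.ball z₀ r := Metric.mem_ball_self hr0
  have hder : ∀ᵐ x ∂ν, ∀ z ∈ Metric.ball z₀ r,
      HasDerivAt (fun z => f z x) (deriv (fun z => f z x) z) z := by
    filter_upwards [hd] with x hx z hz
    exact (hx.differentiableAt (hU.mem_nhds (hzU z hz))).hasDerivAt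
  -- Measurability of the derivative in the parameter: it is a pointwise limit of difference
  -- quotients along a sequence of points tending to z₀ without reaching it.
  have hm' : AEStronglyMeasurable (fun x => deriv (fun z => f z x) z₀) ν := by
    have hlim : Tendsto (fun k : ℕ => z₀ + ((r / 2) * (1 / ((k : ℝ) + 1)) : ℝ)) atTop
        (𝓝[≠] z₀) := by
      refine tendsto_nhdsWithin_iff.2 ⟨?_, Eventually.of_forall fun k => ?_⟩
      · have h1 : Tendsto (fun k : ℕ => (r / 2) * (1 / ((k : ℝ) + 1))) atTop (𝓝 0) := by
          simpa using tendsto_one_div_add_atTop_nhds_zero_nat.const_mul (r / 2)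
        have h2 := (Complex.continuous_ofReal.tendsto 0).comp h1
        simpa using h2.const_add z₀
      · have : (r / 2) * (1 / ((k : ℝ) + 1)) ≠ 0 := by positivity
        have h2 : z₀ + (((r / 2) * (1 / ((k : ℝ) + 1)) : ℝ) : ℂ) - z₀ ≠ 0 := by
          rw [add_sub_cancel_left]
          exact Complex.ofReal_ne_zero.2 this
        exact sub_ne_zero.1 h2
    have hmem : ∀ k : ℕ, z₀ + ((r / 2) * (1 / ((k : ℝ) + 1)) : ℝ) ∈ U := by
      intro k
      refine hzU _ ?_
      rw [Metric.mem_ball, dist_eq_norm, add_sub_cancel_left, Complex.norm_real,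
        Real.norm_of_nonneg (by positivity)]
      have : 1 / ((k : ℝ) + 1) ≤ 1 := by
        rw [div_le_one (by positivity)]; linarith [Nat.cast_nonneg (α := ℝ) k]
      nlinarith
    refine aestronglyMeasurable_of_tendsto_ae atTop
      (f := fun (k : ℕ) x => slope (fun z => f z x) z₀
        (z₀ + ((r / 2) * (1 / ((k : ℝ) + 1)) : ℝ))) (fun k => ?_) ?_
    · simp only [slope_def_module]
      exact ((hm _ (hmem k)).fun_sub (hm _ hz₀)).fun_const_smul _
    · filter_upwards [hder] with x hx
      exact (hasDerivAt_iff_tendsto_slope.1 (hx z₀ hz₀r)).comp hlim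
  -- The constant B / r is Cauchy's estimate on discs of radius `r`; those centred in the ball of
  -- radius `r` about z₀ stay in `U`, since 2r < R.
  refine (hasDerivAt_integral_of_dominated_loc_of_deriv_le (bound := fun _ => B / r)
    (F' := fun z x => deriv (fun z => f z x) z) (Metric.ball_mem_nhds z₀ hr0)
    ?_ ?_ hm' ?_ (integrable_const _) hder).2.differentiableAt.differentiableWithinAt
  · filter_upwards [hU.mem_nhds hz₀] with z hz using hm z hz
  · refine (integrable_const B).mono' (hm z₀ hz₀) ?_
    filter_upwards [hb] with x hx using hx z₀ hz₀
  · filter_upwards [hd, hb] with x hx hbx z hz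
    refine Complex.norm_deriv_le_of_forall_mem_sphere_norm_le hr0 ?_ fun w hw =>
      hbx w (hsub z hz (Metric.sphere_subset_closedBall hw))
    exact DifferentiableOn.diffContOnCl_ball (hx.mono (hsub z hz)) subset_rfl

/-- A maximum principle on a square with centre `c`: smallness on one side of the square forces
smallness at the centre. -/
theorem norm_pow_four_le_of_square {f : ℂ → ℂ} {c : ℂ} {s B η : ℝ} (hs : 0 < s)
    (hc : ContinuousOn f {z | |(z - c).re| ≤ s ∧ |(z - c).im| ≤ s})
    (hd : DifferentiableOn ℂ f {z | |(z - c).re| < s ∧ |(z - c).im| < s})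
    (hB : ∀ z, |(z - c).re| ≤ s → |(z - c).im| ≤ s → ‖f z‖ ≤ B)
    (hη : ∀ z, |(z - c).re| ≤ s → (z - c).im = -s → ‖f z‖ ≤ η) :
    ‖f c‖ ^ 4 ≤ B ^ 3 * η := by
  set Q : Set ℂ := Set.Ioo (-s) s ×ℂ Set.Ioo (-s) s with hQ
  have hcl : closure Q = Set.Icc (-s) s ×ℂ Set.Icc (-s) s := by
    rw [hQ, Complex.closure_reProdIm, closure_Ioo (by linarith)]
  -- Consider the product of the four rotations of `f` about `c` by quarter turns. At each boundary
  -- point of the square one factor is evaluated on the bottom side, hence at most η, and the other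
  -- three are at most B. At the centre the product is the fourth power of f(c).
  have hrot : ∀ u : ℂ, (u = 1 ∨ u = Complex.I ∨ u = -1 ∨ u = -Complex.I) →
      DiffContOnCl ℂ (fun z => f (c + u * z)) Q := by
    intro u hu
    have hre : ∀ z, (z ∈ Q → |(u * z).re| < s ∧ |(u * z).im| < s) ∧
        (z ∈ closure Q → |(u * z).re| ≤ s ∧ |(u * z).im| ≤ s) := by
      intro z
      rw [hcl, hQ, Complex.mem_reProdIm, Complex.mem_reProdIm]
      simp only [Set.mem_Ioo, Set.mem_Icc, ← abs_lt, ← abs_le]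
      rcases hu with rfl | rfl | rfl | rfl <;> simp <;> tauto
    refine ⟨hd.comp (by fun_prop) fun z hz => ?_, hc.comp (by fun_prop) fun z hz => ?_⟩
    · simpa using (hre z).1 hz
    · simpa using (hre z).2 hz
  have h1 := hrot 1 (by tauto)
  have h2 := hrot Complex.I (by tauto)
  have h3 := hrot (-1) (by tauto)
  have h4 := hrot (-Complex.I) (by tauto)
  have hprod := ((h1.smul h2).smul h3).smul h4
  have hbd : Bornology.IsBounded Q :=
    (Bornology.IsBounded.reProdIm (Metric.isBounded_Ioo _ _) (Metric.isBounded_Ioo _ _))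
  have h0B : 0 ≤ B := (norm_nonneg _).trans (hB c (by simpa using hs.le) (by simpa using hs.le))
  have hfr : ∀ z ∈ frontier Q, ‖f (c + 1 * z) * f (c + Complex.I * z) * f (c + -1 * z) *
      f (c + -Complex.I * z)‖ ≤ B ^ 3 * η := by
    intro z hz
    rw [hQ, Complex.frontier_reProdIm, closure_Ioo (by linarith), frontier_Ioo (by linarith)] at hz
    have hz' : |z.re| ≤ s ∧ |z.im| ≤ s ∧ (z.im = -s ∨ z.im = s ∨ z.re = -s ∨ z.re = s) := by
      rcases hz with hz | hz <;> rw [Complex.mem_reProdIm] at hz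
      · obtain ⟨h1, h2⟩ := hz
        rcases h2 with h2 | h2 <;> refine ⟨abs_le.2 h1, ?_, by tauto⟩ <;> rw [h2] <;>
          simp [abs_of_pos hs]
      · obtain ⟨h2, h1⟩ := hz
        rcases h2 with h2 | h2 <;> refine ⟨?_, abs_le.2 h1, by tauto⟩ <;> rw [h2] <;>
          simp [abs_of_pos hs]
    obtain ⟨hr, hi, hor⟩ := hz'
    have b1 := hB (c + 1 * z) (by simpa using hr) (by simpa using hi)
    have b2 := hB (c + Complex.I * z) (by simpa using hi) (by simpa using hr)
    have b3 := hB (c + -1 * z) (by simpa using hr) (by simpa using hi)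
    have b4 := hB (c + -Complex.I * z) (by simpa using hi) (by simpa using hr)
    simp only [norm_mul]
    rcases hor with h | h | h | h
    · have e := hη (c + 1 * z) (by simpa using hr) (by simpa using h)
      have h0η := (norm_nonneg _).trans e
      calc _ ≤ η * B * B * B := by gcongr
        _ = _ := by ring
    · have e := hη (c + -1 * z) (by simpa using hr) (by simpa using h)
      have h0η := (norm_nonneg _).trans e
      calc _ ≤ B * B * η * B := by gcongr
        _ = _ := by ring
    · have e := hη (c + Complex.I * z) (by simpa using hi) (by simpa using h)
      have h0η := (norm_nonneg _).trans e
      calc _ ≤ B * η * B * B := by gcongr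
        _ = _ := by ring
    · have e := hη (c + -Complex.I * z) (by simpa using hi) (by simpa using h)
      have h0η := (norm_nonneg _).trans e
      calc _ ≤ B * B * B * η := by gcongr
        _ = _ := by ring
  have := Complex.norm_le_of_forall_mem_frontier_norm_le hbd hprod (C := B ^ 3 * η) hfr
    (z := 0) (by
      rw [hcl, Complex.mem_reProdIm]
      simp [hs.le])
  simpa [norm_mul, pow_succ] using this

/-- Pointwise convergence of uniformly Lipschitz functions on a compact interval is uniform. -/
theorem eventually_forall_norm_le_of_lipschitz {F : ℕ → ℝ → ℂ} {a b L : ℝ} (hL : 0 ≤ L)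
    (hF : ∀ k, ∀ x ∈ Set.Icc a b, ∀ y ∈ Set.Icc a b, ‖F k x - F k y‖ ≤ L * |x - y|)
    (h : ∀ x ∈ Set.Icc a b, Tendsto (fun k => F k x) atTop (𝓝 0)) {ε : ℝ} (hε : 0 < ε) :
    ∀ᶠ k in atTop, ∀ x ∈ Set.Icc a b, ‖F k x‖ ≤ ε := by
  obtain ⟨t, hts, htf, ht⟩ := (isCompact_Icc (a := a) (b := b)).finite_cover_balls
    (show 0 < ε / 2 / (L + 1) by positivity)
  have h1 : ∀ᶠ k in atTop, ∀ y ∈ t, ‖F k y‖ < ε / 2 := by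
    rw [htf.eventually_all]
    intro y hy
    exact (tendsto_zero_iff_norm_tendsto_zero.1 (h y (hts hy))).eventually_lt_const (by positivity)
  filter_upwards [h1] with k hk x hx
  obtain ⟨y, hyt, hxy⟩ : ∃ y ∈ t, x ∈ Metric.ball y (ε / 2 / (L + 1)) := by
    simpa only [Set.mem_iUnion, exists_prop] using ht hx
  have h2 := hF k x hx y (hts hyt)
  rw [Metric.mem_ball, Real.dist_eq] at hxy
  have h3 : L * |x - y| ≤ ε / 2 := by
    calc L * |x - y| ≤ (L + 1) * (ε / 2 / (L + 1)) := by gcongr; linarith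
      _ = ε / 2 := by field_simp
  have h4 := norm_le_norm_add_norm_sub' (F k x) (F k y)
  linarith [hk y hyt]

/-! ### Approximation by elements of `Exp₊` -/

theorem exists_expPlus_of_bound {f : ℂ → ℂ} {β n : ℕ} {C : ℝ}
    (hd : DifferentiableOn ℂ f {z | -(1 / ((n : ℝ) + 1)) < z.im}) (hc : ContinuousOn f (region n))
    (hb : ∀ z ∈ region n, ‖f z‖ ≤ C * Real.exp (β * ‖z‖)) :
    ∃ φ : ExpPlus, ∀ z : ℂ, 0 ≤ z.im → φ z = f z := by
  have heq : Set.EqOn ((region n).indicator f) f (region n) :=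
    fun z hz => Set.indicator_of_mem hz f
  let F : ExpBanach β n := ⟨(region n).indicator f,
    hd.congr fun z hz => heq (by simp only [region, Set.mem_ofPred_eq] at hz ⊢; exact hz.le),
    hc.congr heq, fun z hz => Set.indicator_of_notMem hz f, C, fun z hz => by
      rw [heq hz, neg_mul, Real.exp_neg, inv_mul_le_iff₀ (Real.exp_pos _), mul_comm]
      exact hb z hz⟩
  exact ⟨inclusion β n F, fun z hz =>
    (inclusionLinear_apply F hz).trans (heq (real_mem_region n z hz))⟩

theorem exists_expPlus_exp (ξ : ℝ) :
    ∃ φ : ExpPlus, ∀ ω : ℝ, φ ω = Complex.exp (Complex.I * ξ * ω) := by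
  have hd : Differentiable ℂ fun z : ℂ => Complex.exp (Complex.I * ξ * z) := by fun_prop
  obtain ⟨φ, hφ⟩ := exists_expPlus_of_bound (β := ⌈|ξ|⌉₊) (n := 0) (C := 1) hd.differentiableOn
    hd.continuous.continuousOn fun z _ => by
      rw [Complex.norm_exp, one_mul]
      refine Real.exp_le_exp.2 ?_
      have h1 : (Complex.I * ξ * z).re = -(ξ * z.im) := by simp
      rw [h1]
      calc -(ξ * z.im) ≤ |ξ * z.im| := neg_le_abs _
        _ = |ξ| * |z.im| := abs_mul _ _
        _ ≤ ⌈|ξ|⌉₊ * ‖z‖ := by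
          gcongr
          · exact Nat.le_ceil _
          · exact Complex.abs_im_le_norm z
  exact ⟨φ, fun ω => hφ ω (by simp)⟩

theorem exists_expPlus_of_mem_span_fourier {T : ℝ} [Fact (0 < T)] {q : C(AddCircle T, ℂ)}
    (hq : q ∈ Submodule.span ℂ (Set.range (@fourier T))) :
    ∃ φ : ExpPlus, ∀ ω : ℝ, φ ω = q (ω : AddCircle T) := by
  induction hq using Submodule.span_induction with
  | mem x hx =>
    obtain ⟨n, rfl⟩ := hx
    obtain ⟨φ, hφ⟩ := exists_expPlus_exp (2 * Real.pi * n / T)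
    refine ⟨φ, fun ω => ?_⟩
    rw [hφ, fourier_coe_apply]
    congr 1
    push_cast
    ring
  | zero => exact ⟨0, fun ω => rfl⟩
  | add x y _ _ hx hy =>
    obtain ⟨φ, hφ⟩ := hx
    obtain ⟨ψ, hψ⟩ := hy
    refine ⟨φ + ψ, fun ω => ?_⟩
    rw [ContinuousMap.add_apply, ← hφ, ← hψ]
    rfl
  | smul c x _ hx =>
    obtain ⟨φ, hφ⟩ := hx
    refine ⟨c • φ, fun ω => ?_⟩
    rw [ContinuousMap.smul_apply, ← hφ]
    rfl

section Weight

/-- Trigonometric polynomials of period 2R belong to Exp₊ and approximate `F` uniformly on [-R, R].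
Outside they do not follow `F` but, being periodic, remain bounded, and the weight has little mass
there. -/
theorem exists_expPlus_approx_compactSupport (hg : IsGaussianType g G δ) (α : ℝ) {F : ℝ → ℂ}
    (hF : Continuous F) (hs : HasCompactSupport F) {ε : ℝ} (hε : 0 < ε) :
    ∃ φ : ExpPlus, ∫ ω : ℝ, ‖F ω - φ ω‖ * (Real.exp (α * |ω|) * g ω) ≤ ε := by
  obtain ⟨R₀, hR₀⟩ := hs.isCompact.isBounded.subset_closedBall 0
  obtain ⟨B, hB⟩ := hF.bounded_above_of_compact_support hs
  have hB0 : 0 ≤ B := (norm_nonneg _).trans (hB 0)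
  set I : ℝ := ∫ ω, Real.exp (α * |ω|) * g ω with hI
  have hI0 : 0 ≤ I := integral_nonneg fun ω => mul_nonneg (Real.exp_pos _).le (hg.nonneg ω)
  obtain ⟨R, hR, htail⟩ := hg.exists_tail_lt α (max R₀ 0)
    (show 0 < ε / 2 / (B + 1) by positivity)
  have hR0 : 0 < R := (le_max_right _ _).trans_lt hR
  have hF0 : ∀ ω : ℝ, R ≤ |ω| → F ω = 0 := fun ω hω => image_eq_zero_of_notMem_tsupport fun h => by
    have h1 := mem_closedBall_zero_iff.1 (hR₀ h)
    rw [Real.norm_eq_abs] at h1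
    linarith [le_max_left R₀ 0]
  -- The bound 1 ensures that the approximating polynomial is at most B + 1 everywhere; the tail was
  -- chosen for this constant.
  set ε' : ℝ := min 1 (ε / 2 / (I + 1)) with hε'
  have hε'0 : 0 < ε' := lt_min one_pos (by positivity)
  have hT : Fact (0 < 2 * R) := ⟨by positivity⟩
  have hend : F (-R) = F (-R + 2 * R) := by
    rw [hF0 _ (by rw [abs_neg, abs_of_pos hR0]),
      hF0 _ (by rw [show -R + 2 * R = R by ring, abs_of_pos hR0])]
  let F' : C(AddCircle (2 * R), ℂ) :=
    ⟨AddCircle.liftIco (2 * R) (-R) F, AddCircle.liftIco_continuous hend hF.continuousOn⟩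
  have hF'B : ∀ y, ‖F' y‖ ≤ B := fun y => hB _
  have hmem : F' ∈ closure ((Submodule.span ℂ (Set.range (@fourier (2 * R))) :
      Submodule ℂ C(AddCircle (2 * R), ℂ)) : Set C(AddCircle (2 * R), ℂ)) := by
    rw [← Submodule.topologicalClosure_coe, span_fourier_closure_eq_top]
    trivial
  obtain ⟨q, hq, hqd⟩ := Metric.mem_closure_iff.1 hmem ε' hε'0
  obtain ⟨φ, hφ⟩ := exists_expPlus_of_mem_span_fourier hq
  have hd : ∀ y, ‖F' y - q y‖ ≤ ε' := fun y => by
    rw [← dist_eq_norm]; exact (ContinuousMap.dist_apply_le_dist y).trans hqd.le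
  refine ⟨φ, ?_⟩
  have hle : ∀ ω : ℝ, ‖F ω - φ ω‖ * (Real.exp (α * |ω|) * g ω) ≤
      ε' * (Real.exp (α * |ω|) * g ω) + (Set.Icc (-R) R)ᶜ.indicator
        (fun ω => B * (Real.exp (α * |ω|) * g ω)) ω := by
    intro ω
    have hgω := hg.nonneg ω
    rw [hφ]
    by_cases hω : ω ∈ Set.Icc (-R) R
    · rw [Set.indicator_of_notMem (by simpa using hω), add_zero]
      gcongr
      have h1 : F' (ω : AddCircle (2 * R)) = F ω := by
        rcases hω.2.lt_or_eq with h | rfl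
        · exact AddCircle.liftIco_coe_apply ⟨hω.1, by linarith⟩
        · have h2 : ((ω : ℝ) : AddCircle (2 * ω)) = ((-ω : ℝ) : AddCircle (2 * ω)) := by
            rw [← AddCircle.coe_add_period (2 * ω) (-ω)]
            congr 1
            ring
          rw [h2]
          refine (AddCircle.liftIco_coe_apply ⟨le_rfl, by linarith⟩).trans ?_
          rw [hend]
          congr 1
          ring
      rw [← h1]
      exact hd _
    · rw [Set.indicator_of_mem hω, ← add_mul]
      gcongr
      rw [hF0 ω (by
        by_contra! h
        exact hω (abs_le.1 h.le)), zero_sub, norm_neg]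
      have := norm_le_norm_add_norm_sub (F' ω) (q ω)
      linarith [hd ω, hF'B ω]
  have hi2 : Integrable ((Set.Icc (-R) R)ᶜ.indicator
      fun ω => B * (Real.exp (α * |ω|) * g ω)) :=
    ((hg.integrable_exp α).const_mul B).indicator measurableSet_Icc.compl
  have hi1 : Integrable fun ω => ε' * (Real.exp (α * |ω|) * g ω) :=
    (hg.integrable_exp α).const_mul ε'
  refine (integral_mono_of_nonneg (Eventually.of_forall fun ω => mul_nonneg (norm_nonneg _)
    (mul_nonneg (Real.exp_pos _).le (hg.nonneg ω))) (hi1.add hi2)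
    (Eventually.of_forall hle)).trans ?_
  simp only [Pi.add_apply]
  rw [integral_add hi1 hi2, integral_const_mul, integral_indicator measurableSet_Icc.compl,
    integral_const_mul, ← hI]
  have h3 : ε' * I ≤ ε / 2 := by
    calc ε' * I ≤ ε / 2 / (I + 1) * (I + 1) := by
          gcongr
          · exact min_le_right _ _
          · linarith
      _ = ε / 2 := by field_simp
  have h4 : B * ∫ ω in (Set.Icc (-R) R)ᶜ, Real.exp (α * |ω|) * g ω ≤ ε / 2 := by
    calc B * ∫ ω in (Set.Icc (-R) R)ᶜ, Real.exp (α * |ω|) * g ω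
        ≤ (B + 1) * (ε / 2 / (B + 1)) := by
          gcongr
          · exact integral_nonneg fun ω => mul_nonneg (Real.exp_pos _).le (hg.nonneg ω)
          · linarith
      _ = ε / 2 := by field_simp
  linarith

/-- The density is real analytic and not identically zero, so its zeros form a discrete, hence null,
set. This permits division by g. -/
theorem IsGaussianType.ae_ne_zero (hg : IsGaussianType g G δ) : ∀ᵐ ω : ℝ, g ω ≠ 0 := by
  have han : AnalyticOnNhd ℝ (fun ω : ℝ => G ω) Set.univ := fun ω _ =>
    ((hg.analyticAt_real ω).restrictScalars (𝕜 := ℝ)).comp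
      (Complex.ofRealCLM.analyticAt ω)
  obtain ⟨x, hx⟩ : ∃ x : ℝ, g x ≠ 0 := by
    by_contra! h
    have := hg.integral_eq_one
    simp [h] at this
  have hmem := han.preimage_zero_mem_codiscrete (x := x) (by
    rw [hg.continuation]; exact_mod_cast hx)
  have h1 := ae_restrict_le_codiscreteWithin (μ := (volume : Measure ℝ)) MeasurableSet.univ hmem
  rw [Measure.restrict_univ] at h1
  filter_upwards [h1] with ω hω
  intro h0
  refine hω ?_
  change G ω = 0
  rw [hg.continuation, h0, Complex.ofReal_zero]

/-- Products of elements of `Exp₊` with `g` are dense in `L¹`, for the weight `exp (α |ω|)`. -/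
theorem exists_expPlus_approx (hg : IsGaussianType g G δ) (α : ℝ) {f : ℝ → ℂ}
    (hf : Integrable fun ω => (Real.exp (α * |ω|) : ℂ) * f ω) {ε : ℝ} (hε : 0 < ε) :
    ∃ φ : ExpPlus, ∫ ω : ℝ, ‖f ω - φ ω * g ω‖ * Real.exp (α * |ω|) ≤ ε := by
  set w : ℝ → ℝ := fun ω => Real.exp (α * |ω|) * g ω with hw
  have hw0 : ∀ ω, 0 ≤ w ω := fun ω => mul_nonneg (Real.exp_pos _).le (hg.nonneg ω)
  have hwc : Continuous w :=
    (Real.continuous_exp.comp (continuous_const.mul continuous_abs)).mul hg.continuous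
  -- For the measure e^{α|ω|} g dω, the claim becomes the approximation of f/g in L¹(ν) by elements
  -- of Exp₊; continuous functions of compact support serve as an intermediate stage.
  set ν : Measure ℝ := volume.withDensity fun ω => ENNReal.ofReal (w ω) with hν
  have hwm : Measurable fun ω => ENNReal.ofReal (w ω) := hwc.measurable.ennreal_ofReal
  have hwtop : ∀ᵐ ω : ℝ, ENNReal.ofReal (w ω) < ⊤ :=
    Eventually.of_forall fun ω => ENNReal.ofReal_lt_top
  have hνfin : IsFiniteMeasure ν := isFiniteMeasure_withDensity_ofReal
    (hg.integrable_exp α).2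
  have htoReal : ∀ ω, (ENNReal.ofReal (w ω)).toReal = w ω := fun ω =>
    ENNReal.toReal_ofReal (hw0 ω)
  have hFint : Integrable (fun ω => f ω / g ω) ν := by
    rw [integrable_withDensity_iff_integrable_smul' hwm hwtop]
    refine hf.congr ?_
    filter_upwards [hg.ae_ne_zero] with ω hω
    have : (g ω : ℂ) ≠ 0 := by exact_mod_cast hω
    rw [htoReal, Complex.real_smul, hw]
    push_cast
    field_simp
  obtain ⟨F', hF's, hF'd, hF'c, hF'i⟩ :=
    hFint.exists_hasCompactSupport_integral_sub_le (half_pos hε)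
  rw [hν, integral_withDensity_eq_integral_toReal_smul hwm hwtop] at hF'd
  obtain ⟨φ, hφ⟩ := exists_expPlus_approx_compactSupport hg α hF'c hF's (half_pos hε)
  refine ⟨φ, ?_⟩
  rw [integrable_withDensity_iff_integrable_smul' hwm hwtop] at hFint hF'i
  simp only [htoReal, smul_eq_mul] at hF'd hFint hF'i
  have hφi : Integrable fun ω : ℝ => w ω • φ ω := by
    have h := integrable_weightedNorm hg α φ
    have hm : AEStronglyMeasurable (fun ω : ℝ => w ω • φ ω) volume :=
      (hwc.smul (expPlus_continuous φ)).aestronglyMeasurable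
    refine (integrable_norm_iff hm).1 (h.congr (Eventually.of_forall fun ω => ?_))
    simp only [norm_smul, Real.norm_of_nonneg (hw0 ω)]
    rw [mul_comm]
  have hi1 : Integrable fun ω => w ω * ‖f ω / g ω - F' ω‖ := by
    refine (hFint.sub hF'i).norm.congr (Eventually.of_forall fun ω => ?_)
    simp only [Pi.sub_apply]
    rw [← smul_sub, norm_smul, Real.norm_of_nonneg (hw0 ω)]
  have hi2 : Integrable fun ω => ‖F' ω - φ ω‖ * w ω := by
    refine (hF'i.sub hφi).norm.congr (Eventually.of_forall fun ω => ?_)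
    simp only [Pi.sub_apply]
    rw [← smul_sub, norm_smul, Real.norm_of_nonneg (hw0 ω), mul_comm]
  refine (integral_mono_of_nonneg (Eventually.of_forall fun ω => mul_nonneg (norm_nonneg _)
    (Real.exp_pos _).le) (hi1.add hi2) ?_).trans
    (by simp only [Pi.add_apply]; rw [integral_add hi1 hi2]; linarith)
  filter_upwards [hg.ae_ne_zero] with ω hω
  have h0 : (g ω : ℂ) ≠ 0 := by exact_mod_cast hω
  have e : f ω - φ ω * g ω = (f ω / g ω - φ ω) * g ω := by field_simp
  have h1 := norm_sub_le_norm_sub_add_norm_sub (f ω / g ω) (F' ω) (φ ω)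
  simp only [Pi.add_apply]
  rw [e, norm_mul, Complex.norm_real, Real.norm_of_nonneg (hg.nonneg ω)]
  calc ‖f ω / g ω - φ ω‖ * g ω * Real.exp (α * |ω|) = w ω * ‖f ω / g ω - φ ω‖ := by
        rw [hw]; ring
    _ ≤ w ω * (‖f ω / g ω - F' ω‖ + ‖F' ω - φ ω‖) := mul_le_mul_of_nonneg_left h1 (hw0 ω)
    _ = _ := by ring

/-! ### Weakly null sequences -/

/-- A sequence of functions of uniform exponential growth in the upper half plane, the image of
which in the dual space tends to zero pointwise. -/
structure IsWeaklyNull (g : ℝ → ℝ) (M α : ℝ) (u : ℕ → ExpPlus) : Prop where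
  bound : ∀ k, ∀ z : ℂ, 0 ≤ z.im → ‖u k z‖ ≤ M * Real.exp (α * ‖z‖)
  null : ∀ φ : ExpPlus, Tendsto (fun k => ∫ ω : ℝ, φ ω * u k ω * (g ω : ℂ)) atTop (𝓝 0)

theorem IsWeaklyNull.nonneg {M α : ℝ} {u : ℕ → ExpPlus} (hu : IsWeaklyNull g M α u) : 0 ≤ M := by
  have h := hu.bound 0 0 (by simp)
  rw [norm_zero, mul_zero, Real.exp_zero, mul_one] at h
  exact (norm_nonneg _).trans h

theorem IsWeaklyNull.norm_le {M α : ℝ} {u : ℕ → ExpPlus} (hu : IsWeaklyNull g M α u)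
    (hα : 0 ≤ α) {ρ : ℝ} (k : ℕ) {z : ℂ} (hz : 0 ≤ z.im) (hρ : ‖z‖ ≤ ρ) :
    ‖u k z‖ ≤ M * Real.exp (α * ρ) :=
  (hu.bound k z hz).trans (by have := hu.nonneg; gcongr)

theorem integrable_mul_expPlus {M α : ℝ} {ψ : ExpPlus}
    (hψ : ∀ z : ℂ, 0 ≤ z.im → ‖ψ z‖ ≤ M * Real.exp (α * ‖z‖)) {f : ℝ → ℂ}
    (hf : Integrable fun ω => (Real.exp (α * |ω|) : ℂ) * f ω) :
    Integrable fun ω : ℝ => f ω * ψ ω := by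
  have hfm : AEStronglyMeasurable f volume := by
    have h1 : Continuous fun ω : ℝ => (Real.exp (-(α * |ω|)) : ℂ) := by fun_prop
    refine (h1.aestronglyMeasurable.mul hf.1).congr (Eventually.of_forall fun ω => ?_)
    change (Real.exp (-(α * |ω|)) : ℂ) * ((Real.exp (α * |ω|) : ℂ) * f ω) = f ω
    rw [← mul_assoc, ← Complex.ofReal_mul, ← Real.exp_add, neg_add_cancel, Real.exp_zero,
      Complex.ofReal_one, one_mul]
  refine (hf.norm.const_mul M).mono' (hfm.mul (expPlus_continuous ψ).aestronglyMeasurable)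
    (Eventually.of_forall fun ω => ?_)
  have h := hψ ω (by simp)
  rw [Complex.norm_real, Real.norm_eq_abs] at h
  rw [norm_mul, norm_mul, Complex.norm_real, Real.norm_of_nonneg (Real.exp_pos _).le]
  calc ‖f ω‖ * ‖ψ ω‖ ≤ ‖f ω‖ * (M * Real.exp (α * |ω|)) := by gcongr
    _ = _ := by ring

/-- A weakly null sequence is weak-* null in the dual of the weighted `L¹`-space. -/
theorem IsWeaklyNull.tendsto_integral (hg : IsGaussianType g G δ) {M α : ℝ} {u : ℕ → ExpPlus}
    (hu : IsWeaklyNull g M α u) {f : ℝ → ℂ}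
    (hf : Integrable fun ω => (Real.exp (α * |ω|) : ℂ) * f ω) :
    Tendsto (fun k => ∫ ω : ℝ, f ω * u k ω) atTop (𝓝 0) := by
  have hM := hu.nonneg
  rw [Metric.tendsto_nhds]
  intro ε hε
  -- Split f = φg + (f - φg). The first part tends to 0 by weak nullity, and the second is small
  -- uniformly in k by the common growth bound.
  obtain ⟨φ, hφ⟩ := exists_expPlus_approx hg α hf (show 0 < ε / 2 / (M + 1) by positivity)
  filter_upwards [(tendsto_zero_iff_norm_tendsto_zero.1 (hu.null φ)).eventually_lt_const
    (half_pos hε)] with k hk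
  rw [dist_zero_right]
  have hi1 := integrable_mul_expPlus (hu.bound k) hf
  have hi2 := integrable_pairing hg (u k) φ
  have e : ∫ ω : ℝ, f ω * u k ω =
      (∫ ω : ℝ, φ ω * u k ω * (g ω : ℂ)) + ∫ ω : ℝ, (f ω - φ ω * g ω) * u k ω := by
    rw [← integral_add hi2 ((hi1.sub hi2).congr (Eventually.of_forall fun ω => by
      simp only [Pi.sub_apply]; ring))]
    refine integral_congr_ae (Eventually.of_forall fun ω => ?_)
    ring
  have hi3 : Integrable fun ω : ℝ => ‖f ω - φ ω * g ω‖ * Real.exp (α * |ω|) := by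
    have h1 : Integrable fun ω : ℝ => (Real.exp (α * |ω|) : ℂ) * (φ ω * g ω) := by
      have h := integrable_weightedNorm hg α φ
      have hm : AEStronglyMeasurable (fun ω : ℝ => (Real.exp (α * |ω|) : ℂ) * (φ ω * g ω))
          volume := by
        have h1 : Continuous fun ω : ℝ => (Real.exp (α * |ω|) : ℂ) := by fun_prop
        exact (h1.mul ((expPlus_continuous φ).mul
          (Complex.continuous_ofReal.comp hg.continuous))).aestronglyMeasurable
      refine (integrable_norm_iff hm).1 (h.congr (Eventually.of_forall fun ω => ?_))
      simp only [norm_mul, Complex.norm_real, Real.norm_of_nonneg (hg.nonneg ω),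
        Real.norm_of_nonneg (Real.exp_pos _).le]
      ring
    refine (hf.sub h1).norm.congr (Eventually.of_forall fun ω => ?_)
    simp only [Pi.sub_apply]
    rw [← mul_sub, norm_mul, Complex.norm_real, Real.norm_of_nonneg (Real.exp_pos _).le, mul_comm]
  have h3 : ‖∫ ω : ℝ, (f ω - φ ω * g ω) * u k ω‖ ≤ ε / 2 := by
    calc ‖∫ ω : ℝ, (f ω - φ ω * g ω) * u k ω‖
        ≤ ∫ ω : ℝ, M * (‖f ω - φ ω * g ω‖ * Real.exp (α * |ω|)) := by
          refine norm_integral_le_of_norm_le (hi3.const_mul M) (Eventually.of_forall fun ω => ?_)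
          have h := hu.bound k ω (by simp)
          rw [Complex.norm_real, Real.norm_eq_abs] at h
          rw [norm_mul]
          calc ‖f ω - φ ω * g ω‖ * ‖u k ω‖
              ≤ ‖f ω - φ ω * g ω‖ * (M * Real.exp (α * |ω|)) := by gcongr
            _ = _ := by ring
      _ = M * ∫ ω : ℝ, ‖f ω - φ ω * g ω‖ * Real.exp (α * |ω|) := integral_const_mul _ _
      _ ≤ (M + 1) * (ε / 2 / (M + 1)) := by
          gcongr
          linarith
      _ = ε / 2 := by field_simp
  rw [e]
  linarith [norm_add_le (∫ ω : ℝ, φ ω * u k ω * (g ω : ℂ)) (∫ ω : ℝ, (f ω - φ ω * g ω) * u k ω)]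

end Weight

/-! ### Pointwise convergence of weakly null sequences -/

theorem ExpPlus.continuousOn (φ : ExpPlus) : ContinuousOn (fun z => φ z) {z : ℂ | 0 ≤ z.im} := by
  obtain ⟨-, β, n, F, hF, h⟩ := φ.2
  exact (hF.2.1.mono fun z hz => real_mem_region n z hz).congr fun z hz => h z hz

theorem ExpPlus.differentiableOn (φ : ExpPlus) :
    DifferentiableOn ℂ (fun z => φ z) {z : ℂ | 0 < z.im} := by
  obtain ⟨-, β, n, F, hF, h⟩ := φ.2
  refine (hF.1.mono fun z hz => ?_).congr fun z hz => h z (le_of_lt hz)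
  have : (0 : ℝ) < 1 / ((n : ℝ) + 1) := by positivity
  simp only [Set.mem_ofPred_eq] at hz ⊢
  linarith

theorem ExpPlus.measurable (φ : ExpPlus) : Measurable fun z => φ z := by
  classical
  have hs : MeasurableSet {z : ℂ | 0 ≤ z.im} :=
    (isClosed_le continuous_const Complex.continuous_im).measurableSet
  have h := φ.continuousOn.measurable_piecewise (g := fun _ => (0 : ℂ)) continuousOn_const hs
  convert h using 1
  funext z
  by_cases hz : 0 ≤ z.im
  · exact (Set.piecewise_eq_of_mem {z : ℂ | 0 ≤ z.im} _ _ hz).symm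
  · exact (φ.2.1 z (not_le.1 hz)).trans
      (Set.piecewise_eq_of_notMem {z : ℂ | 0 ≤ z.im} (fun z => φ z) (fun _ => (0 : ℂ)) hz).symm

theorem ExpPlus.exists_bound (φ : ExpPlus) :
    ∃ (β : ℕ) (C : ℝ), ∀ z : ℂ, 0 ≤ z.im → ‖φ z‖ ≤ C * Real.exp (β * ‖z‖) := by
  obtain ⟨β, n, f, rfl⟩ := φ.exists_inclusion
  refine ⟨β, ‖f‖, fun z hz => ?_⟩
  have e : inclusion β n f z = f.1 z := inclusionLinear_apply f hz
  rw [e]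
  exact expBanach_norm_apply_le f (real_mem_region n z hz)

theorem ExpPlus.continuousOn_comp_add (φ : ExpPlus) (h : ℝ) :
    ContinuousOn (fun z : ℂ => φ (z + h)) {z : ℂ | 0 ≤ z.im} :=
  φ.continuousOn.comp (by fun_prop) fun z hz => by simpa using hz

theorem ExpPlus.continuous_comp_add (φ : ExpPlus) {z : ℂ} (hz : 0 ≤ z.im) :
    Continuous fun t : ℝ => φ (z + t) :=
  φ.continuousOn.comp_continuous (by fun_prop) fun t => by simpa using hz

/-- The integral of `φ` over the horizontal segment `[z, z + h]`. -/
def segmentIntegral (φ : ExpPlus) (h : ℝ) (z : ℂ) : ℂ := ∫ t in Set.Ioc 0 h, φ (z + (t : ℝ))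

theorem segmentIntegral_ofReal (φ : ExpPlus) {h : ℝ} (hh : 0 ≤ h) (x : ℝ) :
    segmentIntegral φ h x = ∫ ω in x..x + h, φ (ω : ℝ) := by
  rw [segmentIntegral, ← intervalIntegral.integral_of_le hh]
  simp only [← Complex.ofReal_add]
  rw [intervalIntegral.integral_comp_add_left (fun ω : ℝ => φ (ω : ℂ)), add_zero]

theorem norm_segmentIntegral_le (φ : ExpPlus) {h B : ℝ} (hh : 0 ≤ h) {z : ℂ}
    (hB : ∀ t ∈ Set.Ioc 0 h, ‖φ (z + (t : ℝ))‖ ≤ B) : ‖segmentIntegral φ h z‖ ≤ B * h := by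
  rw [segmentIntegral, ← intervalIntegral.integral_of_le hh]
  have := intervalIntegral.norm_integral_le_of_norm_le_const (a := 0) (b := h)
    (f := fun t : ℝ => φ (z + t)) (C := B) fun t ht => hB t (by rwa [Set.uIoc_of_le hh] at ht)
  rwa [sub_zero, abs_of_nonneg hh] at this

section Weight

/-- An integral over a real segment is a pairing with an indicator function, which lies in the
weighted L¹-space. Point values are not such pairings, which is why segments are treated before
points. -/
theorem IsWeaklyNull.tendsto_segmentIntegral_ofReal (hg : IsGaussianType g G δ) {M α : ℝ}
    {u : ℕ → ExpPlus} (hu : IsWeaklyNull g M α u) {h : ℝ} (hh : 0 ≤ h) (x : ℝ) :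
    Tendsto (fun k => segmentIntegral (u k) h x) atTop (𝓝 0) := by
  have hf : Integrable fun ω : ℝ => (Real.exp (α * |ω|) : ℂ) *
      (Set.Ioc x (x + h)).indicator (fun _ => (1 : ℂ)) ω := by
    have h1 : Continuous fun ω : ℝ => (Real.exp (α * |ω|) : ℂ) := by fun_prop
    have h2 := (h1.integrableOn_Ioc (a := x) (b := x + h) (μ := volume)).integrable_indicator
      measurableSet_Ioc
    refine h2.congr (Eventually.of_forall fun ω => ?_)
    by_cases hω : ω ∈ Set.Ioc x (x + h) <;> simp [hω]
  refine (hu.tendsto_integral hg hf).congr fun k => ?_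
  rw [segmentIntegral_ofReal _ hh, intervalIntegral.integral_of_le (by linarith),
    ← integral_indicator measurableSet_Ioc]
  refine integral_congr_ae (Eventually.of_forall fun ω => ?_)
  by_cases hω : ω ∈ Set.Ioc x (x + h) <;> simp [hω]

/-- The segment integrals are uniformly Lipschitz in a real base point, so their convergence is
uniform on the bottom side of the square with centre c and half side Im c, which lies on the real
axis. The maximum principle on this square gives convergence at c. -/
theorem IsWeaklyNull.tendsto_segmentIntegral (hg : IsGaussianType g G δ) {M α : ℝ}
    {u : ℕ → ExpPlus} (hu : IsWeaklyNull g M α u) (hα : 0 ≤ α) {h : ℝ} (hh : 0 ≤ h) {c : ℂ}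
    (hc : 0 < c.im) : Tendsto (fun k => segmentIntegral (u k) h c) atTop (𝓝 0) := by
  have hM := hu.nonneg
  set s := c.im with hs
  set ρ : ℝ := ‖c‖ + 2 * s + h with hρ
  set B : ℝ := M * Real.exp (α * ρ) with hB
  have hB0 : 0 ≤ B := by positivity
  have hQ : ∀ z : ℂ, |(z - c).re| ≤ s → |(z - c).im| ≤ s → 0 ≤ z.im ∧ ‖z‖ ≤ ‖c‖ + 2 * s := by
    intro z h1 h2
    have h3 := Complex.norm_le_abs_re_add_abs_im (z - c)
    have h4 := norm_le_norm_add_norm_sub' z c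
    refine ⟨?_, by linarith⟩
    rw [Complex.sub_im] at h2
    linarith [(abs_le.1 h2).1]
  have hbd : ∀ k, ∀ z : ℂ, |(z - c).re| ≤ s → |(z - c).im| ≤ s → ∀ t ∈ Set.Ioc (0 : ℝ) h,
      ‖u k (z + t)‖ ≤ B := by
    intro k z h1 h2 t ht
    obtain ⟨h3, h4⟩ := hQ z h1 h2
    refine hu.norm_le hα k (by simpa using h3) ?_
    have h5 := norm_add_le z t
    rw [Complex.norm_real, Real.norm_of_nonneg ht.1.le] at h5
    linarith [ht.2]
  have hsq : ∀ k, ∀ η : ℝ, (∀ x ∈ Set.Icc (c.re - s) (c.re + s), ‖segmentIntegral (u k) h x‖ ≤ η) →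
      ‖segmentIntegral (u k) h c‖ ^ 4 ≤ (B * h) ^ 3 * η := by
    intro k η hη
    refine norm_pow_four_le_of_square (f := segmentIntegral (u k) h) hc ?_ ?_ ?_ ?_
    · refine continuousOn_of_dominated (bound := fun _ => B) ?_ ?_ (integrable_const B) ?_
      · exact fun z hz => ((u k).continuous_comp_add (hQ z hz.1 hz.2).1).aestronglyMeasurable
      · intro z hz
        filter_upwards [ae_restrict_mem measurableSet_Ioc] with t ht using hbd k z hz.1 hz.2 t ht
      · exact Eventually.of_forall fun t => ((u k).continuousOn_comp_add t).mono
          fun z hz => (hQ z hz.1 hz.2).1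
    · refine differentiableOn_integral_of_norm_le (B := B) ?_ ?_ ?_ ?_
      · have h1 : Continuous fun z : ℂ => |(z - c).re| := by fun_prop
        have h2 : Continuous fun z : ℂ => |(z - c).im| := by fun_prop
        exact (isOpen_lt h1 continuous_const).inter (isOpen_lt h2 continuous_const)
      · exact fun z hz =>
          ((u k).continuous_comp_add (hQ z hz.1.le hz.2.le).1).aestronglyMeasurable
      · refine Eventually.of_forall fun t => (u k).differentiableOn.comp (by fun_prop) ?_
        intro z hz
        have h1 := hz.2
        rw [Complex.sub_im] at h1
        have h2 := (abs_lt.1 h1).1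
        simp only [Set.mem_ofPred_eq, Complex.add_im, Complex.ofReal_im, add_zero]
        linarith
      · filter_upwards [ae_restrict_mem measurableSet_Ioc] with t ht z hz using
          hbd k z hz.1.le hz.2.le t ht
    · exact fun z h1 h2 => norm_segmentIntegral_le (u k) hh (hbd k z h1 h2)
    · intro z h1 h2
      rw [Complex.sub_im] at h2
      have h3 : z = (z.re : ℂ) := Complex.ext rfl (by simp; linarith)
      rw [Complex.sub_re] at h1
      rw [h3]
      exact hη z.re ⟨by linarith [(abs_le.1 h1).1], by linarith [(abs_le.1 h1).2]⟩
  have hreal : ∀ k, ∀ ω : ℝ, ω ∈ Set.Icc (c.re - s) (c.re + s + h) → ‖u k ω‖ ≤ B := by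
    intro k ω hω
    refine hu.norm_le hα k (by simp) ?_
    rw [Complex.norm_real, Real.norm_eq_abs]
    have := abs_le.1 (Complex.abs_re_le_norm c)
    exact abs_le.2 ⟨by linarith [hω.1], by linarith [hω.2]⟩
  have hlip : ∀ k, ∀ x ∈ Set.Icc (c.re - s) (c.re + s), ∀ y ∈ Set.Icc (c.re - s) (c.re + s),
      ‖segmentIntegral (u k) h x - segmentIntegral (u k) h y‖ ≤ (2 * B) * |x - y| := by
    intro k x hx y hy
    have hi : ∀ a b : ℝ, IntervalIntegrable (fun ω : ℝ => u k ω) volume a b :=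
      fun a b => (expPlus_continuous (u k)).intervalIntegrable a b
    rw [segmentIntegral_ofReal _ hh, segmentIntegral_ofReal _ hh,
      intervalIntegral.integral_interval_sub_interval_comm (hi _ _) (hi _ _) (hi _ _)]
    have h1 := intervalIntegral.norm_integral_le_of_norm_le_const (a := x) (b := y)
      (f := fun ω : ℝ => u k ω) (C := B) fun t ht => hreal k t (by
        have h2 := Set.uIoc_subset_uIcc ht
        have h3 := Set.uIcc_subset_Icc hx hy h2
        exact ⟨h3.1, by linarith [h3.2]⟩)
    have h2 := intervalIntegral.norm_integral_le_of_norm_le_const (a := x + h) (b := y + h)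
      (f := fun ω : ℝ => u k ω) (C := B) fun t ht => hreal k t (by
        have h2 := Set.uIoc_subset_uIcc ht
        have h3 := Set.uIcc_subset_Icc (a₂ := c.re - s) (b₂ := c.re + s + h)
          ⟨by linarith [hx.1], by linarith [hx.2]⟩ ⟨by linarith [hy.1], by linarith [hy.2]⟩ h2
        exact h3)
    rw [add_sub_add_right_eq_sub] at h2
    rw [abs_sub_comm] at h1 h2
    exact (norm_sub_le _ _).trans (by linarith)
  rw [Metric.tendsto_nhds]
  intro ε hε
  -- Smallness on the bottom side is prescribed to fourth order because the maximum principle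
  -- controls the fourth power of the value at the centre.
  have hpos : 0 < (ε / 2) ^ 4 / ((B * h) ^ 3 + 1) := by positivity
  filter_upwards [eventually_forall_norm_le_of_lipschitz (by positivity) hlip
    (fun x _ => hu.tendsto_segmentIntegral_ofReal hg hh x) hpos] with k hk
  rw [dist_zero_right]
  have h1 : ‖segmentIntegral (u k) h c‖ ^ 4 ≤ (ε / 2) ^ 4 := by
    refine (hsq k _ hk).trans ?_
    rw [mul_div_assoc', div_le_iff₀ (by positivity)]
    nlinarith [show 0 ≤ (ε / 2) ^ 4 by positivity]
  have h2 := le_of_pow_le_pow_left₀ (by norm_num) (by positivity) h1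
  linarith

/-- A weakly null sequence converges to zero at every point of the upper half plane. -/
theorem IsWeaklyNull.tendsto_apply (hg : IsGaussianType g G δ) {M α : ℝ} {u : ℕ → ExpPlus}
    (hu : IsWeaklyNull g M α u) (hα : 0 ≤ α) {c : ℂ} (hc : 0 < c.im) :
    Tendsto (fun k => u k c) atTop (𝓝 0) := by
  have hM := hu.nonneg
  set r : ℝ := c.im / 3 with hr
  have hr0 : 0 < r := by positivity
  set Λ : ℝ := M * Real.exp (α * (‖c‖ + 2 * r)) / r with hΛ
  have hΛ0 : 0 ≤ Λ := by positivity
  have hball : ∀ z ∈ Metric.closedBall c r, ∀ w ∈ Metric.closedBall z r,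
      0 < w.im ∧ ‖w‖ ≤ ‖c‖ + 2 * r := by
    intro z hz w hw
    have h1 := mem_closedBall_iff_norm.1 hz
    have h2 := mem_closedBall_iff_norm.1 hw
    have h3 : ‖w - c‖ ≤ 2 * r := by
      have := norm_sub_le_norm_sub_add_norm_sub w z c
      linarith
    have h4 := (Complex.abs_im_le_norm (w - c)).trans h3
    have h5 := norm_le_norm_add_norm_sub' w c
    rw [Complex.sub_im] at h4
    exact ⟨by linarith [(abs_le.1 h4).1], by linarith⟩
  have hlip : ∀ k, ∀ z ∈ Metric.closedBall c r, ‖u k z - u k c‖ ≤ Λ * ‖z - c‖ := by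
    intro k z hz
    have hopen : IsOpen {z : ℂ | 0 < z.im} := isOpen_lt continuous_const Complex.continuous_im
    refine Convex.norm_image_sub_le_of_norm_deriv_le (𝕜 := ℂ) (f := fun z => u k z)
      (s := Metric.closedBall c r) (fun w hw => ?_) (fun w hw => ?_) (convex_closedBall c r)
      (Metric.mem_closedBall_self hr0.le) hz
    · exact (u k).differentiableOn.differentiableAt (hopen.mem_nhds
        (hball w hw w (Metric.mem_closedBall_self hr0.le)).1)
    · refine Complex.norm_deriv_le_of_forall_mem_sphere_norm_le hr0 ?_ fun v hv => ?_
      · exact DifferentiableOn.diffContOnCl_ball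
          ((u k).differentiableOn.mono fun v hv => (hball w hw v hv).1) subset_rfl
      · obtain ⟨h1, h2⟩ := hball w hw v (Metric.sphere_subset_closedBall hv)
        exact hu.norm_le hα k h1.le h2
  rw [Metric.tendsto_nhds]
  intro ε hε
  -- With Lipschitz constant Λ near c, the segment integral differs from h · u_k(c) by at most Λh²,
  -- hence by at most h · ε/2. The length is fixed before k tends to infinity.
  set h : ℝ := min r (ε / 2 / (Λ + 1)) with hh
  have hh0 : 0 < h := lt_min hr0 (by positivity)
  have hΛh : Λ * h ≤ ε / 2 := by
    calc Λ * h ≤ (Λ + 1) * (ε / 2 / (Λ + 1)) := by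
          gcongr
          · linarith
          · exact min_le_right _ _
      _ = ε / 2 := by field_simp
  filter_upwards [(tendsto_zero_iff_norm_tendsto_zero.1
    (hu.tendsto_segmentIntegral hg hα hh0.le hc)).eventually_lt_const
    (show 0 < h * (ε / 2) by positivity)] with k hk
  rw [dist_zero_right]
  have h1 : ‖(h : ℂ) * u k c - segmentIntegral (u k) h c‖ ≤ Λ * h * h := by
    have e : (h : ℂ) * u k c - segmentIntegral (u k) h c =
        ∫ t in (0 : ℝ)..h, (u k c - u k (c + t)) := by
      rw [intervalIntegral.integral_sub (by simp)
        (((u k).continuous_comp_add hc.le).intervalIntegrable 0 h), segmentIntegral,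
        ← intervalIntegral.integral_of_le hh0.le, intervalIntegral.integral_const]
      simp
    rw [e]
    have := intervalIntegral.norm_integral_le_of_norm_le_const (a := 0) (b := h)
      (f := fun t : ℝ => u k c - u k (c + t)) (C := Λ * h) fun t ht => by
        rw [Set.uIoc_of_le hh0.le] at ht
        have h2 : ‖(c + t : ℂ) - c‖ = t := by
          rw [add_sub_cancel_left, Complex.norm_real, Real.norm_of_nonneg ht.1.le]
        have h3 := hlip k (c + t) (mem_closedBall_iff_norm.2 (by
          rw [h2]; exact ht.2.trans (min_le_left _ _)))
        rw [norm_sub_rev]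
        rw [h2] at h3
        exact h3.trans (by gcongr; exact ht.2)
    rwa [sub_zero, abs_of_pos hh0] at this
  have h2 : h * ‖u k c‖ < h * ε := by
    have h3 := norm_le_norm_add_norm_sub' ((h : ℂ) * u k c) (segmentIntegral (u k) h c)
    rw [norm_mul, Complex.norm_real, Real.norm_of_nonneg hh0.le] at h3
    nlinarith
  exact lt_of_mul_lt_mul_left h2 hh0.le

end Weight

/-! ### Functionals which are continuous along weakly null sequences -/

/-- A linear form on `Exp₊` which is bounded on every `Exp₊(β, n)` and tends to zero along all
weakly null sequences. -/
structure IsRegularFunctional (g : ℝ → ℝ) (L : ExpPlus →ₗ[ℂ] ℂ) : Prop where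
  bounded : ∀ β n : ℕ, ∃ B : ℝ, ∀ f : ExpBanach β n, ‖L (inclusion β n f)‖ ≤ B * ‖f‖
  null : ∀ (M α : ℝ) (u : ℕ → ExpPlus), 0 ≤ α → IsWeaklyNull g M α u →
    Tendsto (fun k => L (u k)) atTop (𝓝 0)

section Weight

theorem IsRegularFunctional.add {L L' : ExpPlus →ₗ[ℂ] ℂ} (h : IsRegularFunctional g L)
    (h' : IsRegularFunctional g L') : IsRegularFunctional g (L + L') where
  bounded β n := by
    obtain ⟨B, hB⟩ := h.bounded β n
    obtain ⟨B', hB'⟩ := h'.bounded β n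
    refine ⟨B + B', fun f => ?_⟩
    rw [add_mul]
    exact (norm_add_le _ _).trans (add_le_add (hB f) (hB' f))
  null M α u hα hu := by simpa using (h.null M α u hα hu).add (h'.null M α u hα hu)

theorem IsRegularFunctional.smul {L : ExpPlus →ₗ[ℂ] ℂ} (h : IsRegularFunctional g L) (c : ℂ) :
    IsRegularFunctional g (c • L) where
  bounded β n := by
    obtain ⟨B, hB⟩ := h.bounded β n
    refine ⟨‖c‖ * B, fun f => ?_⟩
    rw [LinearMap.smul_apply, norm_smul, mul_assoc]
    exact mul_le_mul_of_nonneg_left (hB f) (norm_nonneg c)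
  null M α u hα hu := by simpa using (h.null M α u hα hu).const_mul c

theorem IsRegularFunctional.continuous {L : ExpPlus →ₗ[ℂ] ℂ} (h : IsRegularFunctional g L) :
    Continuous L := by
  rw [continuous_expPlus_iff]
  intro β n
  obtain ⟨B, hB⟩ := h.bounded β n
  exact AddMonoidHomClass.continuous_of_bound (L.comp (inclusionLinear β n)) B hB

/-- Integration on the real line against a kernel that decays faster than exponentially. -/
theorem exists_isRegularFunctional_kernel (hg : IsGaussianType g G δ) {κ : ℝ → ℂ}
    (hκ : ∀ a : ℝ, Integrable fun ω => (Real.exp (a * |ω|) : ℂ) * κ ω) :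
    ∃ L : ExpPlus →ₗ[ℂ] ℂ, IsRegularFunctional g L ∧ ∀ φ, L φ = ∫ ω : ℝ, κ ω * φ ω := by
  have hi : ∀ φ : ExpPlus, Integrable fun ω : ℝ => κ ω * φ ω := fun φ => by
    obtain ⟨β, C, h⟩ := φ.exists_bound
    exact integrable_mul_expPlus h (hκ β)
  let L : ExpPlus →ₗ[ℂ] ℂ :=
    { toFun := fun φ => ∫ ω : ℝ, κ ω * φ ω
      map_add' := fun φ ψ => by
        rw [← integral_add (hi φ) (hi ψ)]
        refine integral_congr_ae (Eventually.of_forall fun ω => ?_)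
        change κ ω * (φ ω + ψ ω) = _
        ring
      map_smul' := fun c φ => by
        rw [RingHom.id_apply, smul_eq_mul, ← integral_const_mul]
        refine integral_congr_ae (Eventually.of_forall fun ω => ?_)
        change κ ω * (c * φ ω) = _
        ring }
  refine ⟨L, ⟨fun β n => ⟨∫ ω : ℝ, ‖(Real.exp (β * |ω|) : ℂ) * κ ω‖, fun f => ?_⟩, ?_⟩,
    fun φ => rfl⟩
  · rw [mul_comm, ← integral_const_mul]
    refine norm_integral_le_of_norm_le ((hκ β).norm.const_mul _) (Eventually.of_forall fun ω => ?_)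
    rw [norm_mul, norm_mul, Complex.norm_real, Real.norm_of_nonneg (Real.exp_pos _).le]
    calc ‖κ ω‖ * ‖inclusion β n f ω‖ ≤ ‖κ ω‖ * (‖f‖ * Real.exp (β * |ω|)) := by
          gcongr; exact norm_inclusion_ofReal_le f ω
      _ = _ := by ring
  · exact fun M α u _ hu => hu.tendsto_integral hg (hκ α)

/-- Integration along a path in the upper half plane. -/
theorem exists_isRegularFunctional_path (hg : IsGaussianType g G δ) {ν : Measure ℝ} {γ : ℝ → ℂ}
    {w : ℝ → ℂ} {ρ : ℝ} (hγ : Measurable γ) (hw : Integrable w ν)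
    (hγν : ∀ᵐ s ∂ν, 0 < (γ s).im ∧ ‖γ s‖ ≤ ρ) :
    ∃ L : ExpPlus →ₗ[ℂ] ℂ, IsRegularFunctional g L ∧ ∀ φ, L φ = ∫ s, φ (γ s) * w s ∂ν := by
  have hm : ∀ φ : ExpPlus, AEStronglyMeasurable (fun s => φ (γ s) * w s) ν := fun φ =>
    (φ.measurable.comp hγ).aestronglyMeasurable.mul hw.1
  have hle : ∀ (φ : ExpPlus) (β C : ℝ), 0 ≤ β → 0 ≤ C →
      (∀ z : ℂ, 0 ≤ z.im → ‖φ z‖ ≤ C * Real.exp (β * ‖z‖)) →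
      ∀ᵐ s ∂ν, ‖φ (γ s) * w s‖ ≤ (C * Real.exp (β * ρ)) * ‖w s‖ := by
    intro φ β C hβ hC h
    filter_upwards [hγν] with s hs
    rw [norm_mul]
    gcongr
    exact (h _ hs.1.le).trans (by gcongr; exact hs.2)
  have hi : ∀ φ : ExpPlus, Integrable (fun s => φ (γ s) * w s) ν := fun φ => by
    obtain ⟨β, C, h⟩ := φ.exists_bound
    have hC : 0 ≤ C := by
      have := (norm_nonneg _).trans (h 0 (by simp))
      simpa using this
    exact (hw.norm.const_mul _).mono' (hm φ) (hle φ β C (Nat.cast_nonneg β) hC h)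
  let L : ExpPlus →ₗ[ℂ] ℂ :=
    { toFun := fun φ => ∫ s, φ (γ s) * w s ∂ν
      map_add' := fun φ ψ => by
        rw [← integral_add (hi φ) (hi ψ)]
        refine integral_congr_ae (Eventually.of_forall fun s => ?_)
        change (φ (γ s) + ψ (γ s)) * w s = _
        ring
      map_smul' := fun c φ => by
        rw [RingHom.id_apply, smul_eq_mul, ← integral_const_mul]
        refine integral_congr_ae (Eventually.of_forall fun s => ?_)
        change (c * φ (γ s)) * w s = _
        ring }
  refine ⟨L, ⟨fun β n => ⟨Real.exp (β * ρ) * ∫ s, ‖w s‖ ∂ν, fun f => ?_⟩, ?_⟩, fun φ => rfl⟩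
  · have h := norm_integral_le_of_norm_le (hw.norm.const_mul _)
      (hle (inclusion β n f) β ‖f‖ (Nat.cast_nonneg β) (norm_nonneg f) fun z hz => by
        have e : inclusion β n f z = f.1 z := inclusionLinear_apply f hz
        rw [e]
        exact expBanach_norm_apply_le f (real_mem_region n z hz))
    rw [integral_const_mul] at h
    calc ‖L (inclusion β n f)‖ ≤ ‖f‖ * Real.exp (β * ρ) * ∫ s, ‖w s‖ ∂ν := h
      _ = _ := by ring
  · intro M α u hα hu
    have h := tendsto_integral_of_dominated_convergence (μ := ν)
      (F := fun k s => u k (γ s) * w s) (f := fun _ => (0 : ℂ)) _ (fun k => hm (u k))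
      (hw.norm.const_mul (M * Real.exp (α * ρ)))
      (fun k => hle (u k) α M hα hu.nonneg (hu.bound k)) (by
        filter_upwards [hγν] with s hs
        simpa using (hu.tendsto_apply hg hα hs.1).mul_const (w s))
    rwa [integral_zero] at h

/-- Evaluation is integration along a constant path against a Dirac mass. -/
theorem exists_isRegularFunctional_eval (hg : IsGaussianType g G δ) {z : ℂ} (hz : 0 < z.im)
    (c : ℂ) : ∃ L : ExpPlus →ₗ[ℂ] ℂ, IsRegularFunctional g L ∧ ∀ φ, L φ = φ z * c := by
  obtain ⟨L, hL, h⟩ := exists_isRegularFunctional_path hg (ν := Measure.dirac 0)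
    (γ := fun _ => z) (w := fun _ => c) (ρ := ‖z‖) measurable_const (integrable_const c)
    (Eventually.of_forall fun _ => ⟨hz, le_rfl⟩)
  exact ⟨L, hL, fun φ => by rw [h, integral_dirac]⟩

/-! ### Generalized eigenfunctions -/

theorem integrable_exp_mul_density_mul (hg : IsGaussianType g G δ) {c : ℝ → ℂ} {B : ℝ}
    (hm : Measurable c) (hb : ∀ ω, ‖c ω‖ ≤ B) (a : ℝ) :
    Integrable fun ω : ℝ => (Real.exp (a * |ω|) : ℂ) * ((g ω : ℂ) * c ω) := by
  have h1 : Continuous fun ω : ℝ => (Real.exp (a * |ω|) : ℂ) := by fun_prop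
  refine ((hg.integrable_exp a).mul_const B).mono' (h1.aestronglyMeasurable.mul
    ((Complex.continuous_ofReal.comp hg.continuous).aestronglyMeasurable.mul
      hm.aestronglyMeasurable)) (Eventually.of_forall fun ω => ?_)
  rw [norm_mul, norm_mul, Complex.norm_real, Complex.norm_real,
    Real.norm_of_nonneg (Real.exp_pos _).le, Real.norm_of_nonneg (hg.nonneg ω), ← mul_assoc]
  have := hg.nonneg ω
  gcongr
  exact hb ω

theorem tendsto_integral_div_ofReal_add {X : Type*} [MeasurableSpace X] {ν : Measure X}
    {v d : X → ℂ} {r : ℝ} (hv : Integrable v ν) (hd : Measurable d) (hr : 0 < r)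
    (hrd : ∀ᵐ s ∂ν, ∀ x : ℝ, 0 ≤ x → r ≤ ‖(x : ℂ) + d s‖) :
    Tendsto (fun x : ℝ => ∫ s, v s / ((x : ℂ) + d s) ∂ν) (𝓝[>] 0) (𝓝 (∫ s, v s / d s ∂ν)) := by
  refine tendsto_integral_filter_of_dominated_convergence (fun s => ‖v s‖ / r) ?_ ?_
    (hv.norm.div_const r) ?_
  · exact Eventually.of_forall fun x => by
      simp only [div_eq_mul_inv]
      exact hv.1.mul (hd.const_add (x : ℂ)).inv.aestronglyMeasurable
  · filter_upwards [self_mem_nhdsWithin] with x hx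
    filter_upwards [hrd] with s hs
    rw [norm_div]
    exact div_le_div_of_nonneg_left (norm_nonneg _) hr (hs x (le_of_lt hx))
  · filter_upwards [hrd] with s hs
    have h0 : d s ≠ 0 := fun h => by
      have := hs 0 le_rfl
      rw [h] at this
      simp at this
      linarith
    have h1 : Tendsto (fun x : ℝ => (x : ℂ) + d s) (𝓝[>] 0) (𝓝 (d s)) := by
      have h2 : Continuous fun x : ℝ => (x : ℂ) + d s := by fun_prop
      simpa using (h2.tendsto 0).mono_left nhdsWithin_le_nhds
    exact tendsto_const_nhds.div h1 h0

/-- The imaginary part of the denominator is Im λ - Re z and its real part is x + Re λ + Im z. The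
two alternatives bound one of these from below, uniformly in x ≥ 0. -/
theorem le_norm_ofReal_add {lam z : ℂ} {r : ℝ} (h : r ≤ |lam.im - z.re| ∨
    (lam.re = 0 ∧ 0 ≤ z.im ∧ r ≤ z.im)) {x : ℝ} (hx : 0 ≤ x) :
    r ≤ ‖(x : ℂ) + (lam - Complex.I * z)‖ := by
  rcases h with h | ⟨h1, h2, h3⟩
  · refine h.trans ?_
    have := Complex.abs_im_le_norm ((x : ℂ) + (lam - Complex.I * z))
    simpa using this
  · refine le_trans ?_ ((le_abs_self _).trans
      (Complex.abs_re_le_norm ((x : ℂ) + (lam - Complex.I * z))))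
    simp
    linarith

/-- Off the imaginary axis the kernel 1/(λ - iω) is bounded by 1/|Re λ|, and -iλ lies in the open
upper half plane, so a kernel functional and an evaluation suffice. -/
theorem exists_regular_eigenfunctional_of_re_neg (hg : IsGaussianType g G δ) {lam : ℂ}
    (hlam : lam.re < 0) :
    ∃ L : ExpPlus →ₗ[ℂ] ℂ, IsRegularFunctional g L ∧ ∀ φ : ExpPlus,
      L φ = (∫ ω : ℝ, φ ω * (g ω : ℂ) / (lam - Complex.I * ω)) +
        2 * Real.pi * φ (-Complex.I * lam) * G (-Complex.I * lam) := by
  have hb : ∀ ω : ℝ, ‖(lam - Complex.I * ω)⁻¹‖ ≤ (-lam.re)⁻¹ := fun ω => by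
    rw [norm_inv]
    refine inv_anti₀ (by linarith) ?_
    have := (neg_le_abs _).trans (Complex.abs_re_le_norm (lam - Complex.I * ω))
    simpa using this
  obtain ⟨L₁, hL₁, h₁⟩ := exists_isRegularFunctional_kernel hg
    (integrable_exp_mul_density_mul hg (c := fun ω : ℝ => (lam - Complex.I * ω)⁻¹)
      (by fun_prop) hb)
  obtain ⟨L₂, hL₂, h₂⟩ := exists_isRegularFunctional_eval hg (z := -Complex.I * lam)
    (by simpa using hlam) (2 * Real.pi * G (-Complex.I * lam))
  refine ⟨L₁ + L₂, hL₁.add hL₂, fun φ => ?_⟩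
  rw [LinearMap.add_apply, h₁, h₂]
  congr 1
  · refine integral_congr_ae (Eventually.of_forall fun ω => ?_)
    simp only [div_eq_mul_inv]
    ring
  · ring

/-- Deformation of a piece of the real line into the upper half plane. -/
theorem integral_div_eq_sub_add {v : ℂ → ℂ} {y₀ r x : ℝ} {lam : ℂ} (hr : 0 < r)
    (hlam : lam.re = 0) (hx : 0 < x)
    (hc : ContinuousOn v (Set.Icc (y₀ - r) (y₀ + r) ×ℂ Set.Icc 0 r))
    (hd : DifferentiableOn ℂ v (Set.Ioo (y₀ - r) (y₀ + r) ×ℂ Set.Ioo 0 r)) :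
    ∫ ω in Set.Ioc (y₀ - r) (y₀ + r), v (ω : ℝ) / (x + (lam - Complex.I * (ω : ℝ))) =
      (∫ ω in Set.Ioc (y₀ - r) (y₀ + r), v ((ω : ℝ) + r * Complex.I) /
        (x + (lam - Complex.I * ((ω : ℝ) + r * Complex.I)))) -
      Complex.I * (∫ y in Set.Ioc 0 r, v ((y₀ + r : ℝ) + (y : ℝ) * Complex.I) /
        (x + (lam - Complex.I * ((y₀ + r : ℝ) + (y : ℝ) * Complex.I)))) +
      Complex.I * (∫ y in Set.Ioc 0 r, v ((y₀ - r : ℝ) + (y : ℝ) * Complex.I) /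
        (x + (lam - Complex.I * ((y₀ - r : ℝ) + (y : ℝ) * Complex.I)))) := by
  -- For x > 0 the denominator has real part x + Im z > 0, so the integrand has no pole in the
  -- closed rectangle and its boundary integral vanishes.
  have hne : ∀ z : ℂ, 0 ≤ z.im → (x : ℂ) + (lam - Complex.I * z) ≠ 0 := fun z hz h => by
    have := congrArg Complex.re h
    simp [hlam] at this
    linarith
  set f : ℂ → ℂ := fun z => v z / (x + (lam - Complex.I * z)) with hf
  have h1 : y₀ - r ≤ y₀ + r := by linarith
  have h := Complex.integral_boundary_rect_eq_zero_of_continuousOn_of_differentiableOn f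
    ((y₀ - r : ℝ) : ℂ) ((y₀ + r : ℝ) + (r : ℝ) * Complex.I) (by
      have e : Set.uIcc ((y₀ - r : ℝ) : ℂ).re (((y₀ + r : ℝ) : ℂ) + (r : ℝ) * Complex.I).re ×ℂ
          Set.uIcc ((y₀ - r : ℝ) : ℂ).im (((y₀ + r : ℝ) : ℂ) + (r : ℝ) * Complex.I).im =
          Set.Icc (y₀ - r) (y₀ + r) ×ℂ Set.Icc 0 r := by
        simp only [Complex.add_re, Complex.add_im, Complex.ofReal_re, Complex.ofReal_im,
          Complex.re_ofReal_mul, Complex.im_ofReal_mul, Complex.I_re, Complex.I_im, mul_zero,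
          mul_one, add_zero, zero_add]
        rw [Set.uIcc_of_le h1, Set.uIcc_of_le hr.le]
      rw [e]
      refine hc.div (by fun_prop) fun z hz => hne z ?_
      exact (Complex.mem_reProdIm.1 hz).2.1) (by
      have e : Set.Ioo (min ((y₀ - r : ℝ) : ℂ).re (((y₀ + r : ℝ) : ℂ) + (r : ℝ) * Complex.I).re)
          (max ((y₀ - r : ℝ) : ℂ).re (((y₀ + r : ℝ) : ℂ) + (r : ℝ) * Complex.I).re) ×ℂ
          Set.Ioo (min ((y₀ - r : ℝ) : ℂ).im (((y₀ + r : ℝ) : ℂ) + (r : ℝ) * Complex.I).im)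
          (max ((y₀ - r : ℝ) : ℂ).im (((y₀ + r : ℝ) : ℂ) + (r : ℝ) * Complex.I).im) =
          Set.Ioo (y₀ - r) (y₀ + r) ×ℂ Set.Ioo 0 r := by
        simp only [Complex.add_re, Complex.add_im, Complex.ofReal_re, Complex.ofReal_im,
          Complex.re_ofReal_mul, Complex.im_ofReal_mul, Complex.I_re, Complex.I_im, mul_zero,
          mul_one, add_zero, zero_add]
        rw [min_eq_left h1, max_eq_right h1, min_eq_left hr.le, max_eq_right hr.le]
      rw [e]
      refine hd.div (by fun_prop) fun z hz => hne z ?_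
      exact (Complex.mem_reProdIm.1 hz).2.1.le)
  simp only [Complex.add_re, Complex.add_im, Complex.ofReal_re, Complex.ofReal_im,
    Complex.re_ofReal_mul, Complex.im_ofReal_mul, Complex.I_re, Complex.I_im, mul_zero,
    mul_one, add_zero, zero_add, Complex.ofReal_zero, zero_mul, smul_eq_mul] at h
  rw [intervalIntegral.integral_of_le h1, intervalIntegral.integral_of_le h1,
    intervalIntegral.integral_of_le hr.le, intervalIntegral.integral_of_le hr.le] at h
  simp only [hf] at h
  linear_combination h

/-- As x tends to 0 the pole reaches the real point Im λ. A short interval around it is pushed onto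
the other three sides of a rectangle on which G is analytic; there, and on the rest of the real
line, the denominator stays at least `r` in modulus, and dominated convergence gives the limit. The
limit is a kernel functional plus three path functionals. -/
theorem exists_regular_eigenfunctional_of_re_eq_zero (hg : IsGaussianType g G δ) {lam : ℂ}
    (hlam : lam.re = 0) :
    ∃ L : ExpPlus →ₗ[ℂ] ℂ, IsRegularFunctional g L ∧ ∀ φ : ExpPlus,
      Tendsto (fun x : ℝ => ∫ ω : ℝ, φ ω * (g ω : ℂ) / ((lam + x) - Complex.I * ω))
        (𝓝[>] 0) (𝓝 (L φ)) := by
  set y₀ := lam.im with hy₀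
  obtain ⟨R, hR0, hR⟩ := Metric.eventually_nhds_iff.1
    (hg.analyticAt_real y₀).eventually_analyticAt
  set r : ℝ := R / 3 with hr
  have hr0 : 0 < r := by positivity
  have hG : ∀ z ∈ Set.Icc (y₀ - r) (y₀ + r) ×ℂ Set.Icc 0 r, AnalyticAt ℂ G z := fun z hz => by
    refine hR ?_
    obtain ⟨h1, h2⟩ := Complex.mem_reProdIm.1 hz
    rw [dist_eq_norm]
    refine (Complex.norm_le_abs_re_add_abs_im _).trans_lt ?_
    have h3 : |(z - y₀).re| ≤ r := by
      rw [Complex.sub_re, Complex.ofReal_re]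
      exact abs_le.2 ⟨by linarith [h1.1], by linarith [h1.2]⟩
    have h4 : |(z - y₀).im| ≤ r := by
      rw [Complex.sub_im, Complex.ofReal_im, sub_zero]
      exact abs_le.2 ⟨by linarith [h2.1], h2.2⟩
    linarith
  have hGc : ContinuousOn G (Set.Icc (y₀ - r) (y₀ + r) ×ℂ Set.Icc 0 r) :=
    fun z hz => (hG z hz).continuousAt.continuousWithinAt
  set S : Set ℝ := Set.Ioc (y₀ - r) (y₀ + r) with hS
  set κ : ℝ → ℂ := fun ω => (g ω : ℂ) * Sᶜ.indicator (fun ω => (lam - Complex.I * ω)⁻¹) ω with hκ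
  have hout : ∀ ω ∈ Sᶜ, ∀ x : ℝ, 0 ≤ x → r ≤ ‖(x : ℂ) + (lam - Complex.I * ω)‖ := by
    intro ω hω x hx
    refine le_norm_ofReal_add (Or.inl ?_) hx
    rw [Complex.ofReal_re, ← hy₀]
    by_contra! h
    rw [abs_lt] at h
    exact hω ⟨by linarith, by linarith⟩
  have hκm : Measurable (Sᶜ.indicator fun ω : ℝ => (lam - Complex.I * ω)⁻¹) :=
    Measurable.indicator (by fun_prop) measurableSet_Ioc.compl
  obtain ⟨L₀, hL₀, h₀⟩ := exists_isRegularFunctional_kernel hg (κ := κ)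
    (integrable_exp_mul_density_mul hg hκm (B := r⁻¹) fun ω => by
      by_cases hω : ω ∈ Sᶜ
      · rw [Set.indicator_of_mem hω, norm_inv]
        have := hout ω hω 0 le_rfl
        rw [Complex.ofReal_zero, zero_add] at this
        exact inv_anti₀ hr0 this
      · rw [Set.indicator_of_notMem hω, norm_zero]
        positivity)
  -- The interval is half open so that a vertical side may start on the real axis: only its initial
  -- point has imaginary part 0, and path functionals need paths in the open half plane.
  have key : ∀ (γ : ℝ → ℂ) (a b : ℝ), Continuous γ →
      (∀ s ∈ Set.Icc a b, γ s ∈ Set.Icc (y₀ - r) (y₀ + r) ×ℂ Set.Icc 0 r) →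
      (∀ s ∈ Set.Ioc a b, 0 < (γ s).im ∧ (r ≤ |y₀ - (γ s).re| ∨ r ≤ (γ s).im)) →
      ∃ L : ExpPlus →ₗ[ℂ] ℂ, IsRegularFunctional g L ∧ ∀ φ : ExpPlus,
        Tendsto (fun x : ℝ => ∫ s in Set.Ioc a b, φ (γ s) * G (γ s) /
          (x + (lam - Complex.I * γ s))) (𝓝[>] 0) (𝓝 (L φ)) := by
    intro γ a b hγ hmem hpos
    have hne : ∀ s ∈ Set.Ioc a b, ∀ x : ℝ, 0 ≤ x → r ≤ ‖(x : ℂ) + (lam - Complex.I * γ s)‖ :=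
      fun s hs x hx => le_norm_ofReal_add ((hpos s hs).2.imp id
        fun h => ⟨hlam, (hpos s hs).1.le, h⟩) hx
    have hGγ : ContinuousOn (fun s => G (γ s)) (Set.Icc a b) := hGc.comp hγ.continuousOn hmem
    have hGi : IntegrableOn (fun s => G (γ s)) (Set.Ioc a b) :=
      hGγ.integrableOn_Icc.mono_set Set.Ioc_subset_Icc_self
    have hw : Integrable (fun s => G (γ s) * (lam - Complex.I * γ s)⁻¹)
        (volume.restrict (Set.Ioc a b)) := by
      refine (hGi.norm.mul_const r⁻¹).mono' (hGi.1.mul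
        (Measurable.aestronglyMeasurable (by fun_prop))) ?_
      filter_upwards [ae_restrict_mem measurableSet_Ioc] with s hs
      rw [norm_mul, norm_inv]
      have := hne s hs 0 le_rfl
      rw [Complex.ofReal_zero, zero_add] at this
      gcongr
    obtain ⟨L, hL, h⟩ := exists_isRegularFunctional_path hg (γ := γ) (ρ := |y₀| + 2 * r)
      hγ.measurable hw (by
        filter_upwards [ae_restrict_mem measurableSet_Ioc] with s hs
        refine ⟨(hpos s hs).1, (Complex.norm_le_abs_re_add_abs_im _).trans ?_⟩
        obtain ⟨h1, h2⟩ := Complex.mem_reProdIm.1 (hmem s (Set.Ioc_subset_Icc_self hs))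
        have h3 : |(γ s).re| ≤ |y₀| + r := abs_le.2
          ⟨by linarith [h1.1, neg_abs_le y₀], by linarith [h1.2, le_abs_self y₀]⟩
        have h4 : |(γ s).im| ≤ r := abs_le.2 ⟨by linarith [h2.1], h2.2⟩
        linarith)
    refine ⟨L, hL, fun φ => ?_⟩
    have hv : IntegrableOn (fun s => φ (γ s) * G (γ s)) (Set.Ioc a b) := by
      have h1 : ContinuousOn (fun s => φ (γ s)) (Set.Icc a b) :=
        φ.continuousOn.comp hγ.continuousOn fun s hs => (Complex.mem_reProdIm.1 (hmem s hs)).2.1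
      exact (h1.mul hGγ).integrableOn_Icc.mono_set Set.Ioc_subset_Icc_self
    have := tendsto_integral_div_ofReal_add (d := fun s => lam - Complex.I * γ s) hv
      (by fun_prop) hr0 (by
        filter_upwards [ae_restrict_mem measurableSet_Ioc] with s hs using hne s hs)
    rw [h]
    simpa only [div_eq_mul_inv, mul_assoc] using this
  have hab : y₀ - r ≤ y₀ + r := by linarith
  -- The top side is at height `r` above the pole, the vertical sides at horizontal distance `r`
  -- from it.
  obtain ⟨L₁, hL₁, h₁⟩ := key (fun s => (s : ℂ) + r * Complex.I) (y₀ - r) (y₀ + r) (by fun_prop)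
    (fun s hs => Complex.mem_reProdIm.2 ⟨by simpa using hs, by simp [hr0.le]⟩)
    (fun s hs => ⟨by simpa using hr0, Or.inr (by simp)⟩)
  obtain ⟨L₂, hL₂, h₂⟩ := key (fun s => ((y₀ + r : ℝ) : ℂ) + s * Complex.I) 0 r (by fun_prop)
    (fun s hs => Complex.mem_reProdIm.2 ⟨by simp; linarith, by simpa using hs⟩)
    (fun s hs => ⟨by simpa using hs.1, Or.inl (by simp [abs_of_pos hr0])⟩)
  obtain ⟨L₃, hL₃, h₃⟩ := key (fun s => ((y₀ - r : ℝ) : ℂ) + s * Complex.I) 0 r (by fun_prop)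
    (fun s hs => Complex.mem_reProdIm.2 ⟨by simp; linarith, by simpa using hs⟩)
    (fun s hs => ⟨by simpa using hs.1, Or.inl (by simp [abs_of_pos hr0])⟩)
  refine ⟨L₀ + (L₁ + (-Complex.I) • L₂ + Complex.I • L₃),
    hL₀.add ((hL₁.add (hL₂.smul _)).add (hL₃.smul _)), fun φ => ?_⟩
  have hφg : Integrable fun ω : ℝ => φ ω * (g ω : ℂ) := by
    obtain ⟨β, C, h⟩ := φ.exists_bound
    have h1 := integrable_mul_expPlus h
      (integrable_exp_mul_density_mul hg (c := fun _ => 1) (B := 1) measurable_const (by simp) β)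
    refine h1.congr (Eventually.of_forall fun ω => ?_)
    change (g ω : ℂ) * 1 * φ ω = _
    ring
  have hT₀ : Tendsto (fun x : ℝ => ∫ ω in Sᶜ, φ (ω : ℝ) * (g ω : ℂ) /
      (x + (lam - Complex.I * (ω : ℝ)))) (𝓝[>] 0) (𝓝 (L₀ φ)) := by
    have := tendsto_integral_div_ofReal_add (ν := volume.restrict Sᶜ)
      (d := fun ω : ℝ => lam - Complex.I * (ω : ℝ)) hφg.integrableOn (by fun_prop) hr0 (by
        filter_upwards [ae_restrict_mem measurableSet_Ioc.compl] with ω hω using hout ω hω)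
    rw [h₀]
    convert this using 2
    rw [← integral_indicator measurableSet_Ioc.compl]
    refine integral_congr_ae (Eventually.of_forall fun ω => ?_)
    by_cases hω : ω ∈ Sᶜ
    · refine Eq.trans ?_ (Set.indicator_of_mem hω _).symm
      simp only [hκ, Set.indicator_of_mem hω, div_eq_mul_inv]
      ring
    · refine Eq.trans ?_ (Set.indicator_of_notMem hω _).symm
      simp only [hκ, Set.indicator_of_notMem hω]
      ring
  have hT := hT₀.add (((h₁ φ).sub ((h₂ φ).const_mul Complex.I)).add
    ((h₃ φ).const_mul Complex.I))
  have e : (L₀ + (L₁ + (-Complex.I) • L₂ + Complex.I • L₃)) φ =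
      L₀ φ + (L₁ φ - Complex.I * L₂ φ + Complex.I * L₃ φ) := by
    simp only [LinearMap.add_apply, LinearMap.smul_apply, smul_eq_mul]
    ring
  rw [e]
  refine hT.congr' ?_
  filter_upwards [self_mem_nhdsWithin] with x hx
  have hx0 : (0 : ℝ) < x := hx
  rw [← integral_div_eq_sub_add (v := fun z => φ z * G z) hr0 hlam hx0
    ((φ.continuousOn.mono fun z hz => (Complex.mem_reProdIm.1 hz).2.1).mul hGc)
    ((φ.differentiableOn.mono fun z hz => (Complex.mem_reProdIm.1 hz).2.1).mul
      fun z hz => (hG z (Complex.mem_reProdIm.2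
        ⟨Set.Ioo_subset_Icc_self (Complex.mem_reProdIm.1 hz).1,
          Set.Ioo_subset_Icc_self (Complex.mem_reProdIm.1 hz).2⟩)).differentiableAt.differentiableWithinAt)]
  simp only [hg.continuation]
  have hi : Integrable fun ω : ℝ => φ ω * (g ω : ℂ) / (x + (lam - Complex.I * ω)) := by
    refine (hφg.norm.mul_const x⁻¹).mono' ?_ (Eventually.of_forall fun ω => ?_)
    · simp only [div_eq_mul_inv]
      exact hφg.1.mul (Measurable.aestronglyMeasurable (by fun_prop))
    · rw [norm_div, div_eq_mul_inv]
      gcongr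
      have := (le_abs_self _).trans (Complex.abs_re_le_norm ((x : ℂ) + (lam - Complex.I * ω)))
      simpa [hlam] using this
  rw [add_comm, integral_add_compl measurableSet_Ioc hi]
  refine integral_congr_ae (Eventually.of_forall fun ω => ?_)
  change φ ω * (g ω : ℂ) / (x + (lam - Complex.I * ω)) = _
  congr 1
  ring

/-! ### The projections -/

theorem sequentialSpace_of_metricSpace {X : Type*} (M : MetricSpace X) :
    @SequentialSpace X M.toPseudoMetricSpace.toUniformSpace.toTopologicalSpace :=
  inferInstance

/-- The differences ψ_k - χ form a weakly null sequence with constant 2C. -/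
theorem IsRegularFunctional.tendsto_of_tendsto_weak {L : ExpPlus →ₗ[ℂ] ℂ}
    (hg : IsGaussianType g G δ) (hL : IsRegularFunctional g L) {C α : ℝ} (hα : 0 ≤ α)
    {ψ : ℕ → ExpPlus} {χ : ExpPlus} (hψ : ∀ k, ψ k ∈ boundedSet C α) (hχ : χ ∈ boundedSet C α)
    (h : ∀ φ, Tendsto (fun k => canonicalInclusion hg (ψ k) φ) atTop
      (𝓝 (canonicalInclusion hg χ φ))) :
    Tendsto (fun k => L (ψ k)) atTop (𝓝 (L χ)) := by
  have hb : ∀ ψ ∈ boundedSet C α, ∀ z : ℂ, 0 ≤ z.im → ‖ψ z‖ ≤ C * Real.exp (α * ‖z‖) := by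
    intro ψ hψ z hz
    have h := hψ z hz
    rwa [neg_mul, Real.exp_neg, mul_inv_le_iff₀ (Real.exp_pos _)] at h
  have hnull : IsWeaklyNull g (2 * C) α fun k => ψ k - χ := by
    refine ⟨fun k z hz => ?_, fun φ => ?_⟩
    · have e : (ψ k - χ) z = ψ k z - χ z := rfl
      rw [e]
      exact (norm_sub_le _ _).trans (by linarith [hb _ (hψ k) z hz, hb _ hχ z hz])
    · have h1 := (h φ).sub_const (canonicalInclusion hg χ φ)
      rw [sub_self] at h1
      refine h1.congr fun k => ?_
      change (∫ ω : ℝ, φ ω * ψ k ω * (g ω : ℂ)) - (∫ ω : ℝ, φ ω * χ ω * (g ω : ℂ)) = _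
      rw [← integral_sub (integrable_pairing hg _ φ) (integrable_pairing hg _ φ)]
      refine integral_congr_ae (Eventually.of_forall fun ω => ?_)
      change φ ω * ψ k ω * (g ω : ℂ) - φ ω * χ ω * (g ω : ℂ) = φ ω * (ψ k ω - χ ω) * (g ω : ℂ)
      ring
  have h1 := (hL.null _ _ _ hα hnull).add_const (L χ)
  rw [zero_add] at h1
  refine h1.congr fun k => ?_
  rw [map_sub, sub_add_cancel]

/-- A preimage under i is chosen. The choice does not matter: two preimages of the same functional
give a constant sequence converging weakly to the other one, so μ takes equal values on them. -/
theorem exists_projection (hg : IsGaussianType g G δ) {C α : ℝ} (hC : 0 ≤ C) (hα : 0 ≤ α)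
    {μ : ExpPlusDual} (hμ : IsRegularFunctional g (μ : ExpPlus →ₗ[ℂ] ℂ)) (c : ℂ) :
    ∃ P : boundedImage hg C α → ExpPlusDual,
      (∀ (ψ : ExpPlus) (hψ : ψ ∈ boundedSet C α),
        P ⟨canonicalInclusion hg ψ, Set.mem_image_of_mem _ hψ⟩ = (c * μ ψ) • μ) ∧
      @Continuous _ _ (topologyOn projectiveTopology (boundedImage hg C α))
        projectiveTopology P ∧
      @SeqContinuous _ _ (topologyOn weakDualTopology (boundedImage hg C α))
        weakDualTopology P := by
  choose ψ hψ hψi using fun x : boundedImage hg C α => x.2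
  have hwd : ∀ (x : boundedImage hg C α) (χ : ExpPlus), χ ∈ boundedSet C α →
      canonicalInclusion hg χ = x.1 → μ (ψ x) = μ χ := by
    intro x χ hχ hx
    have h := hμ.tendsto_of_tendsto_weak hg hα (ψ := fun _ => ψ x) (χ := χ)
      (fun _ => hψ x) hχ fun φ => by
        rw [hψi x, hx]
        exact tendsto_const_nhds
    exact tendsto_nhds_unique tendsto_const_nhds h
  have hcont : @Continuous _ _ (topologyOn projectiveTopology (boundedImage hg C α)) _
      fun x => μ (ψ x) := by
    -- The functional is controlled along sequences only; since d metrizes the projective topology,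
    -- that suffices for continuity.
    have hseq : @SequentialSpace _ (topologyOn projectiveTopology (boundedImage hg C α)) := by
      rw [← dualMetricOn_topology]
      exact sequentialSpace_of_metricSpace _
    refine @SeqContinuous.continuous _ _ (topologyOn projectiveTopology (boundedImage hg C α)) _
      hseq _ fun x a hx => ?_
    refine hμ.tendsto_of_tendsto_weak hg hα (fun k => hψ (x k)) (hψ a) fun φ => ?_
    have h1 : Tendsto (fun k => (x k).1) atTop (@nhds _ projectiveTopology a.1) :=
      (@Continuous.tendsto _ _ (topologyOn projectiveTopology _) projectiveTopology _
        (@continuous_induced_dom _ _ _ projectiveTopology) a).comp hx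
    have h2 := tendsto_weak_iff.1 (h1.mono_right (nhds_mono projective_le_weak)) φ
    simpa only [Function.comp_apply, hψi] using h2
  have hP : @Continuous _ _ (topologyOn projectiveTopology (boundedImage hg C α))
      projectiveTopology fun x => (c * μ (ψ x)) • μ :=
    @Continuous.comp _ _ _ (topologyOn projectiveTopology (boundedImage hg C α)) _
      projectiveTopology _ _ (continuous_smul_projective μ)
      (@Continuous.comp _ _ _ (topologyOn projectiveTopology (boundedImage hg C α)) _ _ _ _
        (continuous_const_mul c) hcont)
  refine ⟨fun x => (c * μ (ψ x)) • μ, fun χ hχ => ?_, hP, ?_⟩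
  · exact congrArg (fun v => (c * v) • μ)
      (hwd ⟨canonicalInclusion hg χ, Set.mem_image_of_mem _ hχ⟩ χ hχ rfl)
  · refine @Continuous.seqContinuous _ _ (topologyOn weakDualTopology (boundedImage hg C α))
      weakDualTopology _ ?_
    rw [topologyOn_weak_eq_projective hg hC α (boundedImage_subset_dominatedSet hg C α)]
    exact @Continuous.comp _ _ _ (topologyOn projectiveTopology (boundedImage hg C α))
      projectiveTopology weakDualTopology _ _ (continuous_id_iff_le.2 projective_le_weak) hP

theorem exists_eigenfunction (hg : IsGaussianType g G δ) {lam : ℂ} (hlam : lam.re ≤ 0) :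
    ∃ μ : ExpPlusDual, IsGeneralizedEigenfunction g G lam μ ∧
      IsRegularFunctional g (μ : ExpPlus →ₗ[ℂ] ℂ) := by
  rcases hlam.lt_or_eq with h | h
  · obtain ⟨L, hL, hLφ⟩ := exists_regular_eigenfunctional_of_re_neg hg h
    exact ⟨⟨L, hL.continuous⟩, ⟨fun _ => hLφ, fun h0 => absurd h0 h.ne⟩, hL⟩
  · obtain ⟨L, hL, hLφ⟩ := exists_regular_eigenfunctional_of_re_eq_zero hg h
    exact ⟨⟨L, hL.continuous⟩, ⟨fun h0 => absurd h h0.ne, fun _ => hLφ⟩, hL⟩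

end Weight

/-! ### Linear differential equations depending on a parameter -/

theorem abs_integral_exp_mul_abs_le {L : ℝ} (hL : 0 < L) (t : ℝ) :
    |∫ s in (0 : ℝ)..t, Real.exp (L * |s|)| ≤ Real.exp (L * |t|) / L := by
  have key : ∀ t : ℝ, 0 ≤ t → |∫ s in (0 : ℝ)..t, Real.exp (L * |s|)| ≤ Real.exp (L * |t|) / L := by
    intro t ht
    have h1 : ∫ s in (0 : ℝ)..t, Real.exp (L * |s|) = ∫ s in (0 : ℝ)..t, Real.exp (L * s) := by
      refine intervalIntegral.integral_congr fun s hs => ?_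
      rw [Set.uIcc_of_le ht] at hs
      simp only [abs_of_nonneg hs.1]
    rw [h1, intervalIntegral.integral_comp_mul_left (fun s => Real.exp s) hL.ne', integral_exp,
      abs_of_nonneg ht, mul_zero, Real.exp_zero, smul_eq_mul, inv_mul_eq_div, abs_of_nonneg]
    · gcongr
      linarith
    · have : 1 ≤ Real.exp (L * t) := Real.one_le_exp (by positivity)
      have : 0 ≤ Real.exp (L * t) - 1 := by linarith
      positivity
  rcases le_total 0 t with ht | ht
  · exact key t ht
  · have h := key (-t) (by linarith)
    have h2 := intervalIntegral.integral_comp_neg (a := 0) (b := t) fun s => Real.exp (L * |s|)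
    simp only [abs_neg, neg_zero] at h2 h
    rw [h2, intervalIntegral.integral_symm, abs_neg]
    exact h

variable {E : Type*} [NormedAddCommGroup E] [NormedSpace ℂ E]

theorem continuous_exp_smul_clm_apply (L : ℝ) {A : ℝ → E →L[ℂ] E} (hA : Continuous A)
    {f : ℝ → E} (hf : Continuous f) : Continuous fun s => Real.exp (L * |s|) • A s (f s) := by
  have h1 : Continuous fun s => A s (f s) := hA.clm_apply hf
  have h2 : Continuous fun s : ℝ => Real.exp (L * |s|) := by fun_prop
  exact h2.smul h1

/-- The integral operator of the equation `x' = A x`, in the exponentially weighted unknown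
`e^{-L|t|} x(t)`. -/
theorem exists_weighted_volterra {A : ℝ → E →L[ℂ] E} (hA : Continuous A) {m : ℝ} (hm : 0 ≤ m)
    (hAm : ∀ s, ‖A s‖ ≤ m) {L : ℝ} (hL : 0 < L) :
    ∃ V : BoundedContinuousFunction ℝ E →L[ℂ] BoundedContinuousFunction ℝ E,
      (∀ f t, V f t = Real.exp (-(L * |t|)) • ∫ s in (0 : ℝ)..t, Real.exp (L * |s|) • A s (f s)) ∧
      ‖V‖ ≤ m / L := by
  have hcont : ∀ f : BoundedContinuousFunction ℝ E,
      Continuous fun s => Real.exp (L * |s|) • A s (f s) :=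
    fun f => continuous_exp_smul_clm_apply L hA f.continuous
  have hbound : ∀ (f : BoundedContinuousFunction ℝ E) (t : ℝ),
      ‖Real.exp (-(L * |t|)) • ∫ s in (0 : ℝ)..t, Real.exp (L * |s|) • A s (f s)‖ ≤
        m / L * ‖f‖ := by
    intro f t
    have h1 : ‖∫ s in (0 : ℝ)..t, Real.exp (L * |s|) • A s (f s)‖ ≤
        |∫ s in (0 : ℝ)..t, m * ‖f‖ * Real.exp (L * |s|)| := by
      refine intervalIntegral.norm_integral_le_abs_of_norm_le (ae_of_all _ fun s => ?_) ?_
      · rw [norm_smul, Real.norm_eq_abs, abs_of_pos (Real.exp_pos _), mul_comm]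
        gcongr
        exact (A s).le_of_opNorm_le_of_le (hAm s) (f.norm_coe_le_norm s)
      · exact Continuous.intervalIntegrable (by fun_prop) _ _
    rw [intervalIntegral.integral_const_mul, abs_mul, abs_of_nonneg (by positivity)] at h1
    rw [norm_smul, Real.norm_eq_abs, abs_of_pos (Real.exp_pos _)]
    calc Real.exp (-(L * |t|)) * ‖∫ s in (0 : ℝ)..t, Real.exp (L * |s|) • A s (f s)‖
        ≤ Real.exp (-(L * |t|)) * (m * ‖f‖ * (Real.exp (L * |t|) / L)) := by
          gcongr
          exact h1.trans (by gcongr; exact abs_integral_exp_mul_abs_le hL t)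
      _ = m / L * ‖f‖ * (Real.exp (-(L * |t|)) * Real.exp (L * |t|)) := by ring
      _ = m / L * ‖f‖ := by rw [← Real.exp_add]; simp
  have hc2 : ∀ f : BoundedContinuousFunction ℝ E, Continuous fun t : ℝ =>
      Real.exp (-(L * |t|)) • ∫ s in (0 : ℝ)..t, Real.exp (L * |s|) • A s (f s) := by
    intro f
    have h2 : Continuous fun s : ℝ => Real.exp (-(L * |s|)) := by fun_prop
    exact h2.smul (intervalIntegral.continuous_primitive
      (fun a b => (hcont f).intervalIntegrable a b) 0)
  let V₀ : BoundedContinuousFunction ℝ E →ₗ[ℂ] BoundedContinuousFunction ℝ E :=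
    { toFun := fun f => BoundedContinuousFunction.ofNormedAddCommGroup _ (hc2 f) _ (hbound f)
      map_add' := fun f h => by
        ext t
        simp only [BoundedContinuousFunction.coe_ofNormedAddCommGroup,
          BoundedContinuousFunction.coe_add, Pi.add_apply, map_add, smul_add]
        rw [intervalIntegral.integral_add ((hcont f).intervalIntegrable _ _)
          ((hcont h).intervalIntegrable _ _), smul_add]
      map_smul' := fun c f => by
        ext t
        simp only [BoundedContinuousFunction.coe_ofNormedAddCommGroup,
          BoundedContinuousFunction.coe_smul, map_smul, RingHom.id_apply]
        simp only [smul_comm _ c, intervalIntegral.integral_smul] }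
  refine ⟨V₀.mkContinuous (m / L) fun f => ?_, fun f t => rfl,
    LinearMap.mkContinuous_norm_le _ (by positivity) _⟩
  exact (BoundedContinuousFunction.norm_le (by positivity)).2 (hbound f)

/-- For the unknown e^{-L|t|} x(t), bounded and continuous, the integral equation reads (1 - ωV₁ -
V₀) f = e. Once the operator ωV₁ + V₀ has norm below 1, the solution is an inverse applied to e, and
inversion is analytic, so the solution is holomorphic in ω. -/
theorem exists_linear_ode_ball [CompleteSpace E] (A₁ : E →L[ℂ] E) {A₀ : ℝ → E →L[ℂ] E}
    (hA : Continuous A₀) {m : ℝ}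
    (hm : 0 ≤ m) (hAm : ∀ s, ‖A₀ s‖ ≤ m) (v : E) {R : ℝ} (hR : 0 < R) :
    ∃ x : ℂ → ℝ → E, (∀ ω ∈ Metric.ball (0 : ℂ) R, x ω 0 = v ∧
        ∀ t, HasDerivAt (x ω) (ω • A₁ (x ω t) + A₀ t (x ω t)) t) ∧
      ∀ t, DifferentiableOn ℂ (fun ω => x ω t) (Metric.ball 0 R) := by
  -- The weight divides the norms of the integral operators by `L`, so exceeding R‖A₁‖ + m makes ωV₁
  -- + V₀ a strict contraction on the whole ball of radius R.
  set L : ℝ := R * ‖A₁‖ + m + 1 with hLdef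
  have hL : 0 < L := by positivity
  obtain ⟨V₁, hV₁, hn₁⟩ := exists_weighted_volterra (A := fun _ => A₁) continuous_const
    (norm_nonneg A₁) (fun _ => le_rfl) hL
  obtain ⟨V₀, hV₀, hn₀⟩ := exists_weighted_volterra hA hm hAm hL
  let e : BoundedContinuousFunction ℝ E :=
    BoundedContinuousFunction.ofNormedAddCommGroup (fun t : ℝ => Real.exp (-(L * |t|)) • v)
      (by fun_prop) ‖v‖ (fun t => by
        rw [norm_smul, Real.norm_eq_abs, abs_of_pos (Real.exp_pos _)]
        refine mul_le_of_le_one_left (norm_nonneg _) (Real.exp_le_one_iff.2 ?_)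
        have : 0 ≤ L * |t| := by positivity
        linarith)
  have hnorm : ∀ ω ∈ Metric.ball (0 : ℂ) R, ‖ω • V₁ + V₀‖ < 1 := by
    intro ω hω
    rw [mem_ball_zero_iff] at hω
    calc ‖ω • V₁ + V₀‖ ≤ ‖ω‖ * ‖V₁‖ + ‖V₀‖ := (norm_add_le _ _).trans (by rw [norm_smul])
      _ ≤ R * (‖A₁‖ / L) + m / L := by gcongr
      _ = (R * ‖A₁‖ + m) / L := by ring
      _ < 1 := by rw [div_lt_one hL]; linarith
  let f : ℂ → BoundedContinuousFunction ℝ E := fun ω => Ring.inverse (1 - (ω • V₁ + V₀)) e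
  have hunit : ∀ ω ∈ Metric.ball (0 : ℂ) R, IsUnit (1 - (ω • V₁ + V₀)) := fun ω hω =>
    isUnit_one_sub_of_norm_lt_one (hnorm ω hω)
  have hfix : ∀ ω ∈ Metric.ball (0 : ℂ) R, f ω = e + (ω • V₁ (f ω) + V₀ (f ω)) := by
    intro ω hω
    have h1 : (1 - (ω • V₁ + V₀)) (f ω) = e := by
      change ((1 - (ω • V₁ + V₀)) * Ring.inverse (1 - (ω • V₁ + V₀))) e = e
      rw [Ring.mul_inverse_cancel _ (hunit ω hω)]
      rfl
    have h2 : f ω - (ω • V₁ (f ω) + V₀ (f ω)) = e := h1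
    rw [← h2]
    abel
  have hdiff : DifferentiableOn ℂ f (Metric.ball 0 R) := by
    intro ω hω
    have h1 : DifferentiableAt ℂ Ring.inverse (1 - (ω • V₁ + V₀)) :=
      (hasFDerivAt_ringInverse (𝕜 := ℂ) (hunit ω hω).unit).differentiableAt
    have h2 : DifferentiableAt ℂ (fun ω : ℂ => 1 - (ω • V₁ + V₀)) ω := by fun_prop
    have h3 := h1.comp ω h2
    exact (h3.clm_apply (differentiableAt_const e)).differentiableWithinAt
  have hint : ∀ ω ∈ Metric.ball (0 : ℂ) R, ∀ t, Real.exp (L * |t|) • f ω t =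
      v + ∫ s in (0 : ℝ)..t, (ω • A₁ (Real.exp (L * |s|) • f ω s) +
        A₀ s (Real.exp (L * |s|) • f ω s)) := by
    intro ω hω t
    have h1 : f ω t = Real.exp (-(L * |t|)) • v + (ω • V₁ (f ω) t + V₀ (f ω) t) :=
      congrArg (fun h : BoundedContinuousFunction ℝ E => h t) (hfix ω hω)
    rw [h1, hV₁, hV₀, smul_comm ω, ← smul_add, ← smul_add, smul_smul, ← Real.exp_add,
      add_neg_cancel, Real.exp_zero, one_smul, ← intervalIntegral.integral_smul,
      ← intervalIntegral.integral_add]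
    · congr 1
      refine intervalIntegral.integral_congr fun s _ => ?_
      simp only [ContinuousLinearMap.map_smul_of_tower]
    · exact ((continuous_exp_smul_clm_apply L continuous_const
        (f ω).continuous).const_smul ω).intervalIntegrable _ _
    · exact (continuous_exp_smul_clm_apply L hA (f ω).continuous).intervalIntegrable _ _
  refine ⟨fun ω t => Real.exp (L * |t|) • f ω t, fun ω hω => ⟨?_, fun t => ?_⟩, fun t => ?_⟩
  · change Real.exp (L * |0|) • f ω 0 = v
    rw [hint ω hω 0]
    simp
  · have hL' : Continuous fun s : ℝ => Real.exp (L * |s|) := by fun_prop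
    have hx : Continuous fun s : ℝ => Real.exp (L * |s|) • f ω s :=
      hL'.smul (f ω).continuous
    have hc : Continuous fun s : ℝ => ω • A₁ (Real.exp (L * |s|) • f ω s) +
        A₀ s (Real.exp (L * |s|) • f ω s) :=
      ((A₁.continuous.comp hx).const_smul ω).add (hA.clm_apply hx)
    have h1 := (intervalIntegral.integral_hasDerivAt_right (hc.intervalIntegrable 0 t)
      hc.stronglyMeasurable.stronglyMeasurableAtFilter hc.continuousAt).const_add v
    exact h1.congr_of_eventuallyEq (Eventually.of_forall fun s => hint ω hω s)
  · refine DifferentiableOn.fun_const_smul (c := Real.exp (L * |t|)) ?_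
    intro ω hω
    exact ((BoundedContinuousFunction.evalCLM ℂ t).differentiableAt.comp_differentiableWithinAt ω
      (hdiff ω hω) :)

theorem linear_ode_unique (A₁ : E →L[ℂ] E) {A₀ : ℝ → E →L[ℂ] E} {m : ℝ} (hm : 0 ≤ m)
    (hAm : ∀ s, ‖A₀ s‖ ≤ m) (ω : ℂ) {x y : ℝ → E} {t₀ : ℝ}
    (hx : ∀ t, HasDerivAt x (ω • A₁ (x t) + A₀ t (x t)) t)
    (hy : ∀ t, HasDerivAt y (ω • A₁ (y t) + A₀ t (y t)) t) (h0 : x t₀ = y t₀) : x = y := by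
  refine ODE_solution_unique_univ (v := fun t z => ω • A₁ z + A₀ t z) (s := fun _ => Set.univ)
    (K := (‖ω‖ * ‖A₁‖ + m).toNNReal) (t₀ := t₀) (fun t => ?_)
    (fun t => ⟨hx t, Set.mem_univ _⟩) (fun t => ⟨hy t, Set.mem_univ _⟩) h0
  refine LipschitzWith.lipschitzOnWith ?_
  have h1 : LipschitzWith ‖ω • A₁ + A₀ t‖₊ (ω • A₁ + A₀ t) := (ω • A₁ + A₀ t).lipschitz
  refine h1.weaken ?_
  rw [← NNReal.coe_le_coe, coe_nnnorm, Real.coe_toNNReal _ (by positivity)]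
  calc ‖ω • A₁ + A₀ t‖ ≤ ‖ω‖ * ‖A₁‖ + ‖A₀ t‖ := (norm_add_le _ _).trans (by rw [norm_smul])
    _ ≤ ‖ω‖ * ‖A₁‖ + m := by gcongr; exact hAm t

/-- The solution of the linear equation `x' = (ω A₁ + A₀(t)) x` is entire in the parameter `ω`. -/
theorem exists_linear_ode [CompleteSpace E] (A₁ : E →L[ℂ] E) {A₀ : ℝ → E →L[ℂ] E}
    (hA : Continuous A₀) {m : ℝ}
    (hm : 0 ≤ m) (hAm : ∀ s, ‖A₀ s‖ ≤ m) (v : E) :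
    ∃ x : ℂ → ℝ → E, (∀ ω, x ω 0 = v) ∧
      (∀ ω t, HasDerivAt (x ω) (ω • A₁ (x ω t) + A₀ t (x ω t)) t) ∧
      ∀ t, Differentiable ℂ fun ω => x ω t := by
  have hpos : ∀ ω : ℂ, 0 < ‖ω‖ + 1 := fun ω => by positivity
  choose X hX hXd using fun ω : ℂ => exists_linear_ode_ball A₁ hA hm hAm v (hpos ω)
  have hself : ∀ ω : ℂ, ω ∈ Metric.ball (0 : ℂ) (‖ω‖ + 1) := fun ω => by simp
  -- Each ω uses the family built on the ball of radius ‖ω‖ + 1. Near ω, uniqueness identifies it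
  -- with the single holomorphic family of that ball.
  refine ⟨fun ω => X ω ω, fun ω => (hX ω ω (hself ω)).1, fun ω => (hX ω ω (hself ω)).2,
    fun t ω => ?_⟩
  have hU : Metric.ball (0 : ℂ) (‖ω‖ + 1) ∈ 𝓝 ω := Metric.isOpen_ball.mem_nhds (hself ω)
  refine ((hXd ω t).differentiableAt hU).congr_of_eventuallyEq ?_
  filter_upwards [hU] with z hz
  have h1 := hX z z (hself z)
  have h2 := hX ω z hz
  exact congrFun (linear_ode_unique A₁ hm hAm z (t₀ := 0) h1.2 h2.2 (h1.1.trans h2.1.symm)) t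

/-! ### The linear system over the Riccati equation `ζ' = iωζ + (K/2) (η - conj η ζ²)` -/

/-- `(p, q)` solves the linear system for which `p / q` solves the Riccati equation. -/
structure IsRiccatiLift (K : ℝ) (η : ℝ → ℂ) (ω : ℂ) (p q : ℝ → ℂ) : Prop where
  fst : ∀ t, HasDerivAt p (Complex.I * ω / 2 * p t + K / 2 * η t * q t) t
  snd : ∀ t, HasDerivAt q
    (-(Complex.I * ω / 2) * q t + K / 2 * (starRingEnd ℂ) (η t) * p t) t

namespace IsRiccatiLift

variable {K : ℝ} {η : ℝ → ℂ} {ω : ℂ} {p q : ℝ → ℂ}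

theorem mul_add {a b c d : ℝ → ℂ} (hac : IsRiccatiLift K η ω a c) (hbd : IsRiccatiLift K η ω b d)
    (z : ℂ) : IsRiccatiLift K η ω (fun t => a t * z + b t) fun t => c t * z + d t := by
  constructor <;> intro t
  · refine (((hac.fst t).mul_const z).fun_add (hbd.fst t)).congr_deriv ?_
    ring
  · refine (((hac.snd t).mul_const z).fun_add (hbd.snd t)).congr_deriv ?_
    ring

/-- The coupling terms cancel: they lie in the Lie algebra of SU(1,1), which preserves |q|² - |p|².
Only the imaginary part of ω changes the form. -/
theorem hasDerivAt_normSq_sub (h : IsRiccatiLift K η ω p q) (t : ℝ) :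
    HasDerivAt (fun t => ‖q t‖ ^ 2 - ‖p t‖ ^ 2) (ω.im * (‖q t‖ ^ 2 + ‖p t‖ ^ 2)) t := by
  refine (((h.snd t).norm_sq).fun_sub ((h.fst t).norm_sq)).congr_deriv ?_
  simp only [Complex.inner, Complex.sq_norm, Complex.normSq_apply]
  simp
  ring

theorem hasDerivAt_normSq_add (h : IsRiccatiLift K η ω p q) (t : ℝ) :
    HasDerivAt (fun t => ‖q t‖ ^ 2 + ‖p t‖ ^ 2) (ω.im * (‖q t‖ ^ 2 - ‖p t‖ ^ 2) +
      2 * K * (η t * q t * (starRingEnd ℂ) (p t)).re) t := by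
  refine (((h.snd t).norm_sq).fun_add ((h.fst t).norm_sq)).congr_deriv ?_
  simp only [Complex.inner, Complex.sq_norm, Complex.normSq_apply]
  simp
  ring

theorem norm_eq (h : IsRiccatiLift K η ω p q) (hω : ω.im = 0) (h0 : ‖p 0‖ = ‖q 0‖) (t : ℝ) :
    ‖p t‖ = ‖q t‖ := by
  have h1 := is_const_of_deriv_eq_zero (fun s => (h.hasDerivAt_normSq_sub s).differentiableAt)
    (fun s => by rw [(h.hasDerivAt_normSq_sub s).deriv, hω, zero_mul]) t 0
  simp only [h0, sub_self] at h1
  exact (sq_eq_sq₀ (norm_nonneg _) (norm_nonneg _)).1 (by linarith)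

theorem norm_le (h : IsRiccatiLift K η ω p q) (hω : 0 ≤ ω.im) (h0 : ‖p 0‖ = ‖q 0‖) {t : ℝ}
    (ht : 0 ≤ t) : ‖p t‖ ≤ ‖q t‖ := by
  have h1 : Monotone fun t => ‖q t‖ ^ 2 - ‖p t‖ ^ 2 :=
    monotone_of_deriv_nonneg (fun s => (h.hasDerivAt_normSq_sub s).differentiableAt)
      fun s => by rw [(h.hasDerivAt_normSq_sub s).deriv]; positivity
  have h2 := h1 ht
  simp only [h0, sub_self] at h2
  exact (sq_le_sq₀ (norm_nonneg _) (norm_nonneg _)).1 (by linarith)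

/-- Below the real axis the form may decrease, at rate at most ε(|q|² + |p|²). The growing multiple
of |q|² + |p|² compensates: in its exponent, |K| pays for the coupling, 1 for the change of the sum
caused by Im ω ≥ -1, and 1 for the decrease of the form. -/
theorem normSq_sub_add_exp_nonneg (h : IsRiccatiLift K η ω p q) (hη : ∀ t, ‖η t‖ ≤ 1) {ε : ℝ}
    (hε : 0 ≤ ε) (hε1 : ε ≤ 1) (hω : -ε ≤ ω.im) (hω' : ω.im ≤ 0) (h0 : ‖p 0‖ = ‖q 0‖) {t : ℝ}
    (ht : 0 ≤ t) :
    0 ≤ ‖q t‖ ^ 2 - ‖p t‖ ^ 2 +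
      ε * Real.exp ((2 + |K|) * t) * (‖q t‖ ^ 2 + ‖p t‖ ^ 2) := by
  have hexp : ∀ s, HasDerivAt (fun s => ε * Real.exp ((2 + |K|) * s))
      (ε * (Real.exp ((2 + |K|) * s) * ((2 + |K|) * 1))) s := fun s =>
    (((hasDerivAt_id s).const_mul (2 + |K|)).exp).const_mul ε
  have hderiv := fun s => (h.hasDerivAt_normSq_sub s).add ((hexp s).mul (h.hasDerivAt_normSq_add s))
  have h1 : MonotoneOn (fun t => ‖q t‖ ^ 2 - ‖p t‖ ^ 2 +
      ε * Real.exp ((2 + |K|) * t) * (‖q t‖ ^ 2 + ‖p t‖ ^ 2)) (Set.Ici 0) := by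
    refine monotoneOn_of_deriv_nonneg (convex_Ici 0)
      (fun s _ => (hderiv s).continuousAt.continuousWithinAt)
      (fun s _ => (hderiv s).differentiableAt.differentiableWithinAt) fun s hs => ?_
    rw [interior_Ici] at hs
    refine le_of_le_of_eq ?_ (hderiv s).deriv.symm
    have he : 1 ≤ Real.exp ((2 + |K|) * s) := Real.one_le_exp (by
      have : 0 < s := hs
      positivity)
    set e := Real.exp ((2 + |K|) * s)
    set S := ‖q s‖ ^ 2 + ‖p s‖ ^ 2 with hS
    have hS0 : 0 ≤ S := by positivity
    have hre : |(η s * q s * (starRingEnd ℂ) (p s)).re| ≤ S / 2 := by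
      refine (Complex.abs_re_le_norm _).trans ?_
      rw [norm_mul, norm_mul, RCLike.norm_conj]
      have : ‖η s‖ * ‖q s‖ * ‖p s‖ ≤ 1 * ‖q s‖ * ‖p s‖ := by gcongr; exact hη s
      nlinarith [sq_nonneg (‖q s‖ - ‖p s‖)]
    have h2 : -(|K| * S) ≤ 2 * K * (η s * q s * (starRingEnd ℂ) (p s)).re := by
      have h3 : |2 * K * (η s * q s * (starRingEnd ℂ) (p s)).re| ≤ |K| * S := by
        rw [abs_mul, abs_mul, abs_of_pos (two_pos : (0 : ℝ) < 2)]
        have := mul_le_mul_of_nonneg_left hre (abs_nonneg K)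
        linarith
      exact (abs_le.1 h3).1
    have h4 : -S ≤ ω.im * (‖q s‖ ^ 2 - ‖p s‖ ^ 2) := by
      have h5 : ω.im * (‖q s‖ ^ 2 - ‖p s‖ ^ 2) ≥ ω.im * S := by
        have : ‖q s‖ ^ 2 - ‖p s‖ ^ 2 ≤ S := by rw [hS]; linarith [sq_nonneg ‖p s‖]
        exact mul_le_mul_of_nonpos_left this hω'
      nlinarith
    have h6 : -(ε * e * S) ≤ ω.im * S := by
      have h7 : ε * 1 ≤ ε * e := by gcongr
      nlinarith
    have h8 : 0 ≤ ε * e := by positivity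
    nlinarith
  have h2 := h1 Set.self_mem_Ici ht ht
  refine le_trans ?_ h2
  simp only [h0, sub_self, zero_add]
  positivity

/-- The width of the strip makes ε e^{(2+|K|)t} equal to 1/2, and |q|² - |p|² + (|q|² + |p|²)/2 ≥ 0
is the bound with factor 3. -/
theorem normSq_le (h : IsRiccatiLift K η ω p q) (hη : ∀ t, ‖η t‖ ≤ 1) {t : ℝ} (ht : 0 ≤ t)
    (hω : -(1 / 2 * Real.exp (-((2 + |K|) * t))) ≤ ω.im) (h0 : ‖p 0‖ = ‖q 0‖) :
    ‖p t‖ ^ 2 ≤ 3 * ‖q t‖ ^ 2 := by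
  rcases le_total 0 ω.im with h1 | h1
  · have h2 := h.norm_le h1 h0 ht
    have h3 : ‖p t‖ ^ 2 ≤ ‖q t‖ ^ 2 := by gcongr
    linarith [sq_nonneg ‖q t‖]
  · have he : Real.exp (-((2 + |K|) * t)) ≤ 1 := Real.exp_le_one_iff.2 (by
      have : 0 ≤ (2 + |K|) * t := by positivity
      linarith)
    have h2 := h.normSq_sub_add_exp_nonneg hη (by positivity) (by linarith) hω h1 h0 ht
    rw [mul_assoc (1 / 2 : ℝ), ← Real.exp_add, neg_add_cancel, Real.exp_zero] at h2
    linarith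

/-- The diagonal part of the system, multiplied by `ω`. -/
def diagonalPart : ℂ × ℂ →L[ℂ] ℂ × ℂ :=
  (Complex.I / 2) • (ContinuousLinearMap.inl ℂ ℂ ℂ ∘L ContinuousLinearMap.fst ℂ ℂ ℂ) -
    (Complex.I / 2) • (ContinuousLinearMap.inr ℂ ℂ ℂ ∘L ContinuousLinearMap.snd ℂ ℂ ℂ)

/-- The coupling part of the system. -/
def couplingPart (K : ℝ) (z : ℂ) : ℂ × ℂ →L[ℂ] ℂ × ℂ :=
  (K / 2 * z) • (ContinuousLinearMap.inl ℂ ℂ ℂ ∘L ContinuousLinearMap.snd ℂ ℂ ℂ) +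
    (K / 2 * (starRingEnd ℂ) z) • (ContinuousLinearMap.inr ℂ ℂ ℂ ∘L ContinuousLinearMap.fst ℂ ℂ ℂ)

theorem continuous_couplingPart (K : ℝ) : Continuous (couplingPart K) := by
  unfold couplingPart
  have : Continuous fun z : ℂ => (starRingEnd ℂ) z := Complex.continuous_conj
  fun_prop

theorem exists_norm_couplingPart_le (K : ℝ) :
    ∃ m : ℝ, 0 ≤ m ∧ ∀ z : ℂ, ‖z‖ ≤ 1 → ‖couplingPart K z‖ ≤ m := by
  obtain ⟨m, hm⟩ := (isCompact_closedBall (0 : ℂ) 1).exists_bound_of_continuousOn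
    (continuous_couplingPart K).continuousOn
  exact ⟨m, (norm_nonneg _).trans (hm 0 (by simp)), fun z hz => hm z (by simpa using hz)⟩

theorem vectorField_eq (K : ℝ) (ω z : ℂ) (x : ℂ × ℂ) :
    ω • diagonalPart x + couplingPart K z x =
      (Complex.I * ω / 2 * x.1 + K / 2 * z * x.2,
        -(Complex.I * ω / 2) * x.2 + K / 2 * (starRingEnd ℂ) z * x.1) := by
  ext <;> simp [diagonalPart, couplingPart] <;> ring

theorem hasDerivAt_prod (h : IsRiccatiLift K η ω p q) (t : ℝ) :
    HasDerivAt (fun t => (p t, q t))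
      (ω • diagonalPart (p t, q t) + couplingPart K (η t) (p t, q t)) t := by
  rw [vectorField_eq]
  exact (h.fst t).prodMk (h.snd t)

theorem eq_zero_of_eq_zero (h : IsRiccatiLift K η ω p q) (hη : ∀ t, ‖η t‖ ≤ 1) {t : ℝ}
    (hp : p t = 0) (hq : q t = 0) : q 0 = 0 := by
  obtain ⟨m, hm, hm'⟩ := exists_norm_couplingPart_le K
  have h0 : ∀ t, HasDerivAt (fun _ : ℝ => (0 : ℂ × ℂ))
      (ω • diagonalPart 0 + couplingPart K (η t) 0) t := fun t => by
    simpa using hasDerivAt_const t (0 : ℂ × ℂ)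
  have h1 := linear_ode_unique diagonalPart hm (fun s => hm' _ (hη s)) ω (t₀ := t)
    h.hasDerivAt_prod h0 (by simp [hp, hq])
  exact congrArg Prod.snd (congrFun h1 0)

/-- A zero of q would force p to vanish at the same time, and uniqueness would then make both vanish
at time 0. Thus the bound on p excludes poles of p/q. -/
theorem snd_ne_zero (h : IsRiccatiLift K η ω p q) (hη : ∀ t, ‖η t‖ ≤ 1) (h0 : q 0 ≠ 0) {t c : ℝ}
    (hc : ‖p t‖ ^ 2 ≤ c * ‖q t‖ ^ 2) : q t ≠ 0 := by
  intro hq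
  refine h0 (h.eq_zero_of_eq_zero hη ?_ hq)
  have h1 : ‖p t‖ ^ 2 ≤ 0 := by simpa [hq] using hc
  have h2 : ‖p t‖ ^ 2 = 0 := le_antisymm h1 (sq_nonneg _)
  simpa using h2

theorem hasDerivAt_div (h : IsRiccatiLift K η ω p q) {t : ℝ} (hq : q t ≠ 0) :
    HasDerivAt (fun t => p t / q t) (Complex.I * ω * (p t / q t) +
      K / 2 * (η t - (starRingEnd ℂ) (η t) * (p t / q t) ^ 2)) t := by
  refine ((h.fst t).fun_div (h.snd t) hq).congr_deriv ?_
  field_simp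
  ring

/-- Powers of one Riccati solution obey the moment hierarchy. The hierarchy is linear once η is
given, so averages over initial points obey it too. -/
theorem hasDerivAt_div_pow (h : IsRiccatiLift K η ω p q) {t : ℝ} (hq : q t ≠ 0) {j : ℕ}
    (hj : 1 ≤ j) :
    HasDerivAt (fun t => (p t / q t) ^ j) (j * Complex.I * ω * (p t / q t) ^ j + j * K / 2 *
      (η t * (p t / q t) ^ (j - 1) - (starRingEnd ℂ) (η t) * (p t / q t) ^ (j + 1))) t := by
  obtain ⟨k, rfl⟩ : ∃ k, j = k + 1 := ⟨j - 1, by omega⟩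
  refine ((h.hasDerivAt_div hq).fun_pow (k + 1)).congr_deriv ?_
  simp only [Nat.add_sub_cancel]
  push_cast
  ring

theorem exists_entire (K : ℝ) (hηc : Continuous η) (hη : ∀ t, ‖η t‖ ≤ 1) (p₀ q₀ : ℂ) :
    ∃ p q : ℂ → ℝ → ℂ, (∀ ω, IsRiccatiLift K η ω (p ω) (q ω)) ∧ (∀ ω, p ω 0 = p₀) ∧
      (∀ ω, q ω 0 = q₀) ∧ (∀ t, Differentiable ℂ fun ω => p ω t) ∧
      ∀ t, Differentiable ℂ fun ω => q ω t := by
  obtain ⟨m, hm, hm'⟩ := exists_norm_couplingPart_le K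
  obtain ⟨x, hx0, hx, hxd⟩ := exists_linear_ode diagonalPart
    ((continuous_couplingPart K).comp hηc) hm (fun s => hm' _ (hη s)) (p₀, q₀)
  have hx' : ∀ ω t, HasDerivAt (x ω) (Complex.I * ω / 2 * (x ω t).1 + K / 2 * η t * (x ω t).2,
        -(Complex.I * ω / 2) * (x ω t).2 + K / 2 * (starRingEnd ℂ) (η t) * (x ω t).1) t := by
    intro ω t
    rw [← vectorField_eq]
    exact hx ω t
  exact ⟨fun ω t => (x ω t).1, fun ω t => (x ω t).2,
    fun ω => ⟨fun t => (hx' ω t).fst, fun t => (hx' ω t).snd⟩, fun ω => congrArg Prod.fst (hx0 ω),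
    fun ω => congrArg Prod.snd (hx0 ω), fun t => (hxd t).fst, fun t => (hxd t).snd⟩

end IsRiccatiLift

/-! ### Uniqueness for the hierarchy of moments -/

/-- Summation by parts: what remains of the differences are terms T_{k+1}/((k+1)(k+2)), which the
weights 1/k² control. The flux through the end is kept on the left, and the subtracted half of the
last term is the reserve that pays for the next induction step. -/
theorem abs_sum_sub_div_add_le {y T : ℕ → ℝ} (hy : ∀ k, 0 ≤ y k) (hT0 : T 0 = 0)
    (hT : ∀ k, |T k| ≤ (y k + y (k + 1)) / 2) (m : ℕ) :
    |(∑ k ∈ Finset.range (m + 1), (T k - T (k + 1)) / ((k : ℝ) + 1)) + T (m + 1) / ((m : ℝ) + 1)| ≤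
      3 / 2 * ∑ k ∈ Finset.range (m + 1), y (k + 1) / ((k : ℝ) + 1) ^ 2 -
        1 / 2 * (y (m + 1) / ((m : ℝ) + 1) ^ 2) := by
  induction m with
  | zero =>
    have := hy 1
    simp [hT0]
    linarith
  | succ m ih =>
    rw [Finset.sum_range_succ, Finset.sum_range_succ (fun k => y (k + 1) / ((k : ℝ) + 1) ^ 2)]
    push_cast
    set A := ∑ k ∈ Finset.range (m + 1), (T k - T (k + 1)) / ((k : ℝ) + 1)
    set B := ∑ k ∈ Finset.range (m + 1), y (k + 1) / ((k : ℝ) + 1) ^ 2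
    set u : ℝ := (m : ℝ) + 1 with hu
    have hu1 : 1 ≤ u := by rw [hu]; linarith [(Nat.cast_nonneg m : (0 : ℝ) ≤ m)]
    have e : A + (T (m + 1) - T (m + 1 + 1)) / (u + 1) + T (m + 1 + 1) / (u + 1) =
        (A + T (m + 1) / u) - T (m + 1) / (u * (u + 1)) := by
      field_simp
      ring
    rw [e]
    have h1 : |T (m + 1) / (u * (u + 1))| ≤
        1 / 2 * (y (m + 1) / u ^ 2) + y (m + 1 + 1) / (u + 1) ^ 2 := by
      rw [abs_div, abs_of_pos (by positivity : 0 < u * (u + 1))]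
      have h2 : y (m + 1) / (u * (u + 1)) ≤ y (m + 1) / u ^ 2 := by
        have := hy (m + 1)
        gcongr
        nlinarith
      have h3 : y (m + 1 + 1) / (u * (u + 1)) ≤ 2 * (y (m + 1 + 1) / (u + 1) ^ 2) := by
        rw [← mul_div_assoc, div_le_div_iff₀ (by positivity) (by positivity)]
        have h4 : (u + 1) ^ 2 ≤ 2 * (u * (u + 1)) := by nlinarith
        have := mul_le_mul_of_nonneg_left h4 (hy (m + 1 + 1))
        linarith
      calc |T (m + 1)| / (u * (u + 1)) ≤ ((y (m + 1) + y (m + 1 + 1)) / 2) / (u * (u + 1)) := by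
            gcongr; exact hT (m + 1)
        _ = (y (m + 1) / (u * (u + 1)) + y (m + 1 + 1) / (u * (u + 1))) / 2 := by ring
        _ ≤ _ := by linarith
    have h5 := abs_sub (A + T (m + 1) / u) (T (m + 1) / (u * (u + 1)))
    linarith

/-- Bounded solutions of the homogeneous hierarchy with vanishing initial values vanish. -/
theorem moment_hierarchy_eq_zero {K ω : ℝ} {η : ℝ → ℂ} {X : ℕ → ℝ → ℂ}
    (hη : ∀ t, 0 ≤ t → ‖η t‖ ≤ 1) (h0 : ∀ t, 0 ≤ t → X 0 t = 0) {b : ℝ}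
    (hb : ∀ j t, 0 ≤ t → ‖X j t‖ ≤ b) (hi : ∀ j, X j 0 = 0)
    (hd : ∀ j : ℕ, 1 ≤ j → ∀ t, 0 ≤ t → HasDerivWithinAt (X j)
      (j * Complex.I * ω * X j t + j * K / 2 *
        (η t * X (j - 1) t - (starRingEnd ℂ) (η t) * X (j + 1) t)) (Set.Ici 0) t)
    (j : ℕ) {t : ℝ} (ht : 0 ≤ t) : X j t = 0 := by
  rcases Nat.eq_zero_or_pos j with rfl | hj
  · exact h0 t ht
  have hb0 : 0 ≤ b := (norm_nonneg _).trans (hb 0 0 le_rfl)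
  let T : ℕ → ℝ → ℝ := fun k s => (η s * X k s * (starRingEnd ℂ) (X (k + 1) s)).re
  -- The derivative of ‖X_j‖² is jK(T_{j-1} - T_j), the frequency term being orthogonal to X_j. The
  -- factor j is unbounded in the hierarchy; after division by j² a weight 1/j is left, which
  -- summation by parts can handle.
  let N : ℕ → ℝ → ℝ := fun m s => ∑ k ∈ Finset.range (m + 1), ‖X (k + 1) s‖ ^ 2 / ((k : ℝ) + 1) ^ 2
  let N' : ℕ → ℝ → ℝ := fun m s =>
    K * ∑ k ∈ Finset.range (m + 1), (T k s - T (k + 1) s) / ((k : ℝ) + 1)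
  have hT : ∀ k s, 0 ≤ s → |T k s| ≤ (‖X k s‖ ^ 2 + ‖X (k + 1) s‖ ^ 2) / 2 := by
    intro k s hs
    refine (Complex.abs_re_le_norm _).trans ?_
    rw [norm_mul, norm_mul, RCLike.norm_conj]
    have : ‖η s‖ * ‖X k s‖ * ‖X (k + 1) s‖ ≤ 1 * ‖X k s‖ * ‖X (k + 1) s‖ := by
      gcongr; exact hη s hs
    nlinarith [sq_nonneg (‖X k s‖ - ‖X (k + 1) s‖)]
  have hN : ∀ m s, 0 ≤ s → HasDerivWithinAt (N m) (N' m s) (Set.Ici 0) s := by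
    intro m s hs
    simp only [N', Finset.mul_sum]
    refine HasDerivWithinAt.fun_sum fun k _ => ?_
    refine (((hd (k + 1) (by omega) s hs).norm_sq).div_const (((k : ℝ) + 1) ^ 2)).congr_deriv ?_
    simp only [T, Complex.inner, Nat.add_sub_cancel]
    have hk : ((k : ℝ) + 1) ≠ 0 := by positivity
    simp
    field_simp
    ring
  -- Truncating at `m` leaves only the flux through the last level, of size b²/(m + 1) by
  -- boundedness, as an inhomogeneity in Grönwall's inequality.
  have hbound : ∀ m s, 0 ≤ s → ‖N' m s‖ ≤
      (3 / 2 * |K| + 1) * ‖N m s‖ + |K| * b ^ 2 / ((m : ℝ) + 1) := by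
    intro m s hs
    have hN0 : 0 ≤ N m s := Finset.sum_nonneg fun k _ => by positivity
    have h1 := abs_sum_sub_div_add_le (y := fun k => ‖X k s‖ ^ 2) (T := fun k => T k s)
      (fun k => sq_nonneg _) (by simp [T, h0 s hs]) (fun k => hT k s hs) m
    have h2 : |T (m + 1) s / ((m : ℝ) + 1)| ≤ b ^ 2 / ((m : ℝ) + 1) := by
      rw [abs_div, abs_of_pos (by positivity : 0 < (m : ℝ) + 1)]
      gcongr
      have h3 : ‖X (m + 1) s‖ ^ 2 ≤ b ^ 2 := by gcongr; exact hb _ s hs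
      have h4 : ‖X (m + 1 + 1) s‖ ^ 2 ≤ b ^ 2 := by gcongr; exact hb _ s hs
      exact (hT (m + 1) s hs).trans (by linarith)
    have h5 : |∑ k ∈ Finset.range (m + 1), (T k s - T (k + 1) s) / ((k : ℝ) + 1)| ≤
        3 / 2 * N m s + b ^ 2 / ((m : ℝ) + 1) := by
      have h6 := abs_sub ((∑ k ∈ Finset.range (m + 1), (T k s - T (k + 1) s) / ((k : ℝ) + 1)) +
        T (m + 1) s / ((m : ℝ) + 1)) (T (m + 1) s / ((m : ℝ) + 1))
      rw [add_sub_cancel_right] at h6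
      have h7 : 0 ≤ ‖X (m + 1) s‖ ^ 2 / ((m : ℝ) + 1) ^ 2 := by positivity
      change |_ + T (m + 1) s / ((m : ℝ) + 1)| ≤ 3 / 2 * N m s -
        1 / 2 * (‖X (m + 1) s‖ ^ 2 / ((m : ℝ) + 1) ^ 2) at h1
      linarith
    rw [Real.norm_eq_abs, Real.norm_eq_abs, abs_of_nonneg hN0, abs_mul]
    calc |K| * _ ≤ |K| * (3 / 2 * N m s + b ^ 2 / ((m : ℝ) + 1)) := by gcongr
      _ ≤ _ := by
        rw [mul_add, mul_div_assoc]
        linarith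
  have hgron : ∀ m, N m t ≤
      gronwallBound 0 (3 / 2 * |K| + 1) (|K| * b ^ 2 / ((m : ℝ) + 1)) t := by
    intro m
    have h1 := norm_le_gronwallBound_of_norm_deriv_right_le (f := N m) (f' := N' m) (δ := 0)
      (K := 3 / 2 * |K| + 1) (ε := |K| * b ^ 2 / ((m : ℝ) + 1)) (a := 0) (b := t)
      (fun s hs => ((hN m s hs.1).mono Set.Icc_subset_Ici_self).continuousWithinAt)
      (fun s hs => (hN m s hs.1).mono (Set.Ici_subset_Ici.2 hs.1)) (by simp [N, hi])
      (fun s hs => hbound m s hs.1) t ⟨ht, le_rfl⟩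
    rw [sub_zero] at h1
    exact (le_abs_self _).trans h1
  -- The initial value is 0 and the inhomogeneity tends to 0, so the Grönwall bound tends to 0 at
  -- fixed `t`; the j-th term, present in every truncation with m ≥ j, must vanish.
  have hlim : Tendsto (fun m : ℕ =>
      gronwallBound 0 (3 / 2 * |K| + 1) (|K| * b ^ 2 / ((m : ℝ) + 1)) t) atTop (𝓝 0) := by
    have h1 := (gronwallBound_continuous_ε 0 (3 / 2 * |K| + 1) t).tendsto 0
    have h2 : gronwallBound 0 (3 / 2 * |K| + 1) 0 t = 0 := by
      rw [gronwallBound_ε0]; simp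
    rw [h2] at h1
    refine h1.comp ?_
    exact (tendsto_const_nhds.div_atTop
      (tendsto_atTop_add_const_right _ 1 tendsto_natCast_atTop_atTop))
  have hle : ‖X j t‖ ^ 2 / (j : ℝ) ^ 2 ≤ 0 := by
    refine ge_of_tendsto hlim (eventually_atTop.2 ⟨j, fun m hm => le_trans ?_ (hgron m)⟩)
    have h1 := Finset.single_le_sum (s := Finset.range (m + 1))
      (f := fun k : ℕ => ‖X (k + 1) t‖ ^ 2 / ((k : ℝ) + 1) ^ 2) (fun k _ => by positivity)
      (Finset.mem_range.2 (by omega : j - 1 < m + 1))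
    have h2 : ((j - 1 : ℕ) : ℝ) + 1 = j := by
      rw [Nat.cast_sub hj]; simp
    simp only [h2, Nat.sub_add_cancel hj] at h1
    exact h1
  have hj0 : (0 : ℝ) < (j : ℝ) ^ 2 := by positivity
  have h1 : ‖X j t‖ ^ 2 ≤ 0 := by
    rw [div_le_iff₀ hj0, zero_mul] at hle
    exact hle
  have h2 : ‖X j t‖ ^ 2 = 0 := le_antisymm h1 (sq_nonneg _)
  simpa using h2

/-! ### Moments and the order parameter -/

theorem fourier_eq_pow {T : ℝ} (j : ℕ) (θ : AddCircle T) :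
    (fourier (j : ℤ) θ : ℂ) = (fourier 1 θ : ℂ) ^ j := by
  rw [fourier_apply, fourier_apply, one_zsmul, AddCircle.toCircle_zsmul]
  simp

theorem norm_fourier_apply {T : ℝ} (j : ℤ) (θ : AddCircle T) : ‖(fourier j θ : ℂ)‖ = 1 := by
  rw [fourier_apply]
  exact Circle.norm_coe _

namespace IsKuramotoSolution

variable {K : ℝ} {g : ℝ → ℝ} {h : Measure (AddCircle (2 * Real.pi))}
  {ρ : ℝ → Kernel ℝ (AddCircle (2 * Real.pi))}

theorem norm_circleMoment_le (hρ : IsKuramotoSolution K g h ρ) (j : ℕ) {t : ℝ} (ht : 0 ≤ t)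
    (ω : ℝ) : ‖circleMoment ρ j t ω‖ ≤ 1 := by
  have := hρ.markov t ht
  have h1 := norm_integral_le_of_norm_le_const (μ := ρ t ω) (C := 1)
    (ae_of_all _ fun θ => (norm_fourier_apply (j : ℤ) θ).le)
  simpa [circleMoment] using h1

theorem circleMoment_zero (hρ : IsKuramotoSolution K g h ρ) {t : ℝ} (ht : 0 ≤ t) (ω : ℝ) :
    circleMoment ρ 0 t ω = 1 := by
  have := hρ.markov t ht
  simp [circleMoment]

theorem stronglyMeasurable_circleMoment (hρ : IsKuramotoSolution K g h ρ) (j : ℕ) {t : ℝ}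
    (ht : 0 ≤ t) : StronglyMeasurable (circleMoment ρ j t) := by
  have := hρ.markov t ht
  exact StronglyMeasurable.integral_kernel (fourier (j : ℤ)).continuous.stronglyMeasurable

theorem continuousOn_circleMoment (hρ : IsKuramotoSolution K g h ρ) {j : ℕ} (hj : 1 ≤ j) (ω : ℝ) :
    ContinuousOn (fun t => circleMoment ρ j t ω) (Set.Ici 0) :=
  fun t ht => (hρ.moments j hj ω t ht).continuousWithinAt

theorem continuousOn_orderParameter (hρ : IsKuramotoSolution K g h ρ) (hg : Integrable g) :
    ContinuousOn (orderParameter g ρ) (Set.Ici 0) := by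
  intro t ht
  refine continuousWithinAt_of_dominated (bound := fun ω => ‖g ω‖) ?_ ?_ hg.norm
    (ae_of_all _ fun ω => ?_)
  · filter_upwards [self_mem_nhdsWithin] with s hs
    exact (hρ.stronglyMeasurable_circleMoment 1 hs).aestronglyMeasurable.mul
      hg.ofReal.aestronglyMeasurable
  · filter_upwards [self_mem_nhdsWithin] with s hs
    refine ae_of_all _ fun ω => ?_
    rw [norm_mul, Complex.norm_real]
    exact mul_le_of_le_one_left (norm_nonneg _) (hρ.norm_circleMoment_le 1 hs ω)
  · exact (hρ.continuousOn_circleMoment le_rfl ω t ht).mul continuousWithinAt_const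

theorem norm_orderParameter_le (hρ : IsKuramotoSolution K g h ρ) (hg : Integrable g)
    (hg0 : ∀ ω, 0 ≤ g ω) (hg1 : ∫ ω, g ω = 1) {t : ℝ} (ht : 0 ≤ t) :
    ‖orderParameter g ρ t‖ ≤ 1 := by
  rw [← hg1]
  refine norm_integral_le_of_norm_le hg (ae_of_all _ fun ω => ?_)
  rw [norm_mul, Complex.norm_real, Real.norm_of_nonneg (hg0 ω)]
  exact mul_le_of_le_one_left (hg0 ω) (hρ.norm_circleMoment_le 1 ht ω)

end IsKuramotoSolution

/-! ### Transport of the initial distribution by Möbius maps -/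

/-- The columns `(a, c)` and `(b, d)` are the solutions with initial values `(1, 0)` and `(0, 1)`
of the linear system over the Riccati equation. -/
structure IsFundamentalSystem (K : ℝ) (η : ℝ → ℂ) (a b c d : ℂ → ℝ → ℂ) : Prop where
  left : ∀ ω, IsRiccatiLift K η ω (a ω) (c ω)
  right : ∀ ω, IsRiccatiLift K η ω (b ω) (d ω)
  a_zero : ∀ ω, a ω 0 = 1
  b_zero : ∀ ω, b ω 0 = 0
  c_zero : ∀ ω, c ω 0 = 0
  d_zero : ∀ ω, d ω 0 = 1

/-- The moments of the image of `h` under the Möbius transformations of a fundamental matrix. -/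
def moebiusMoment (h : Measure (AddCircle (2 * Real.pi))) (a b c d : ℂ → ℝ → ℂ) (j : ℕ) (t : ℝ)
    (ω : ℂ) : ℂ :=
  ∫ θ, ((a ω t * fourier 1 θ + b ω t) / (c ω t * fourier 1 θ + d ω t)) ^ j ∂h

theorem aestronglyMeasurable_moebius (h : Measure (AddCircle (2 * Real.pi)))
    (a b c d : ℂ → ℝ → ℂ) (j : ℕ) (t : ℝ) (ω : ℂ) :
    AEStronglyMeasurable (fun θ : AddCircle (2 * Real.pi) =>
      ((a ω t * fourier 1 θ + b ω t) / (c ω t * fourier 1 θ + d ω t)) ^ j) h := by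
  have h1 : Measurable fun θ : AddCircle (2 * Real.pi) => (fourier 1 θ : ℂ) :=
    (fourier 1).continuous.measurable
  exact Measurable.aestronglyMeasurable (by fun_prop)

namespace IsFundamentalSystem

variable {K : ℝ} {η : ℝ → ℂ} {a b c d : ℂ → ℝ → ℂ}

theorem lift (hF : IsFundamentalSystem K η a b c d) (ω z : ℂ) :
    IsRiccatiLift K η ω (fun t => a ω t * z + b ω t) fun t => c ω t * z + d ω t :=
  (hF.left ω).mul_add (hF.right ω) z

theorem norm_lift_zero (hF : IsFundamentalSystem K η a b c d) (ω : ℂ)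
    (θ : AddCircle (2 * Real.pi)) :
    ‖a ω 0 * fourier 1 θ + b ω 0‖ = ‖c ω 0 * fourier 1 θ + d ω 0‖ := by
  rw [hF.a_zero, hF.b_zero, hF.c_zero, hF.d_zero, one_mul, zero_mul, add_zero, zero_add, norm_one,
    norm_fourier_apply]

theorem norm_moebius_eq_one (hF : IsFundamentalSystem K η a b c d) {ω : ℂ} (hω : ω.im = 0) (t : ℝ) (θ : AddCircle (2 * Real.pi)) :
    ‖a ω t * fourier 1 θ + b ω t‖ = ‖c ω t * fourier 1 θ + d ω t‖ :=
  (hF.lift ω (fourier 1 θ)).norm_eq hω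
    (hF.norm_lift_zero ω θ) t

theorem norm_moebiusMoment_le {h : Measure (AddCircle (2 * Real.pi))} [IsProbabilityMeasure h]
    (hF : IsFundamentalSystem K η a b c d) {ω : ℂ} (hω : 0 ≤ ω.im) (j : ℕ) {t : ℝ} (ht : 0 ≤ t) :
    ‖moebiusMoment h a b c d j t ω‖ ≤ 1 := by
  have h1 := norm_integral_le_of_norm_le_const (μ := h) (C := 1) (f := fun θ =>
    ((a ω t * fourier 1 θ + b ω t) / (c ω t * fourier 1 θ + d ω t)) ^ j) (ae_of_all _ fun θ => by
      rw [norm_pow, norm_div]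
      refine pow_le_one₀ (by positivity) (div_le_one_of_le₀ ?_ (norm_nonneg _))
      exact (hF.lift ω (fourier 1 θ)).norm_le hω
        (hF.norm_lift_zero ω θ) ht)
  simpa [moebiusMoment] using h1

theorem normSq_moebius_le (hF : IsFundamentalSystem K η a b c d) (hη : ∀ t, ‖η t‖ ≤ 1) {ω : ℂ} {t : ℝ} (ht : 0 ≤ t)
    (hω : -(1 / 2 * Real.exp (-((2 + |K|) * t))) ≤ ω.im) (θ : AddCircle (2 * Real.pi)) :
    ‖a ω t * fourier 1 θ + b ω t‖ ^ 2 ≤ 3 * ‖c ω t * fourier 1 θ + d ω t‖ ^ 2 :=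
  (hF.lift ω (fourier 1 θ)).normSq_le hη ht hω
    (hF.norm_lift_zero ω θ)

theorem moebius_denom_ne_zero (hF : IsFundamentalSystem K η a b c d) (hη : ∀ t, ‖η t‖ ≤ 1) {ω : ℂ} {t C : ℝ} {θ : AddCircle (2 * Real.pi)}
    (hC : ‖a ω t * fourier 1 θ + b ω t‖ ^ 2 ≤ C * ‖c ω t * fourier 1 θ + d ω t‖ ^ 2) :
    c ω t * fourier 1 θ + d ω t ≠ 0 :=
  (hF.lift ω (fourier 1 θ)).snd_ne_zero hη (by simp [hF.c_zero, hF.d_zero]) hC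

/-- The bound √3 is rounded up to 2. It holds in a strip whose depth does not depend on θ, as
holomorphy of the integral requires. -/
theorem norm_moebius_le_two (hF : IsFundamentalSystem K η a b c d) (hη : ∀ t, ‖η t‖ ≤ 1) {ω : ℂ} {t : ℝ} (ht : 0 ≤ t)
    (hω : -(1 / 2 * Real.exp (-((2 + |K|) * t))) ≤ ω.im) (θ : AddCircle (2 * Real.pi)) :
    ‖(a ω t * fourier 1 θ + b ω t) / (c ω t * fourier 1 θ + d ω t)‖ ≤ 2 := by
  have h1 := hF.normSq_moebius_le hη ht hω θ
  have h2 := hF.moebius_denom_ne_zero hη h1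
  rw [norm_div, div_le_iff₀ (norm_pos_iff.2 h2)]
  refine (sq_le_sq₀ (norm_nonneg _) (by positivity)).1 ?_
  nlinarith [sq_nonneg ‖c ω t * fourier 1 θ + d ω t‖]

theorem differentiableOn_moebiusMoment {h : Measure (AddCircle (2 * Real.pi))} [IsProbabilityMeasure h]
    (hF : IsFundamentalSystem K η a b c d) (hη : ∀ t, ‖η t‖ ≤ 1) (ha : ∀ t, Differentiable ℂ fun ω => a ω t)
    (hb : ∀ t, Differentiable ℂ fun ω => b ω t) (hc : ∀ t, Differentiable ℂ fun ω => c ω t)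
    (hd : ∀ t, Differentiable ℂ fun ω => d ω t) (j : ℕ) {t : ℝ} (ht : 0 ≤ t) :
    DifferentiableOn ℂ (moebiusMoment h a b c d j t)
      {ω | -(1 / 2 * Real.exp (-((2 + |K|) * t))) < ω.im} := by
  refine differentiableOn_integral_of_norm_le (B := 2 ^ j)
    (isOpen_lt continuous_const Complex.continuous_im)
    (fun ω _ => aestronglyMeasurable_moebius h a b c d j t ω) (ae_of_all _ fun θ => ?_)
    (ae_of_all _ fun θ ω hω => ?_)
  · refine DifferentiableOn.fun_pow (DifferentiableOn.fun_div
      ((((ha t).mul_const _).add (hb t)).differentiableOn)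
      ((((hc t).mul_const _).add (hd t)).differentiableOn) fun ω hω => ?_) j
    exact hF.moebius_denom_ne_zero hη
      (hF.normSq_moebius_le hη ht (le_of_lt hω) θ)
  · rw [norm_pow]
    gcongr
    exact hF.norm_moebius_le_two hη ht (le_of_lt hω) θ

/-- For real ω the maps preserve the unit circle, so the integrands and their time derivatives are
bounded uniformly in time and angle, and one may differentiate under the integral. -/
theorem hasDerivAt_moebiusMoment {h : Measure (AddCircle (2 * Real.pi))} [IsProbabilityMeasure h]
    (hF : IsFundamentalSystem K η a b c d) (hη : ∀ t, ‖η t‖ ≤ 1) {j : ℕ} (hj : 1 ≤ j) (ω : ℝ) (t : ℝ) :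
    HasDerivAt (fun s => moebiusMoment h a b c d j s ω)
      (j * Complex.I * ω * moebiusMoment h a b c d j t ω + j * K / 2 *
        (η t * moebiusMoment h a b c d (j - 1) t ω -
          (starRingEnd ℂ) (η t) * moebiusMoment h a b c d (j + 1) t ω)) t := by
  let ζ : ℝ → AddCircle (2 * Real.pi) → ℂ := fun s θ =>
    (a ω s * fourier 1 θ + b ω s) / (c ω s * fourier 1 θ + d ω s)
  have hnorm : ∀ s θ, ‖a ω s * fourier 1 θ + b ω s‖ = ‖c ω s * fourier 1 θ + d ω s‖ :=
    hF.norm_moebius_eq_one (by simp)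
  have hne : ∀ s θ, c ω s * fourier 1 θ + d ω s ≠ 0 := fun s θ =>
    hF.moebius_denom_ne_zero hη (C := 1) (by rw [hnorm, one_mul])
  have hζ : ∀ s θ, ‖ζ s θ‖ = 1 := fun s θ => by
    rw [norm_div, hnorm, div_self (norm_ne_zero_iff.2 (hne s θ))]
  have hmeas : ∀ (k : ℕ) s, AEStronglyMeasurable (fun θ => ζ s θ ^ k) h := fun k s =>
    aestronglyMeasurable_moebius h a b c d k s ω
  have hintegrable : ∀ (k : ℕ) s, Integrable (fun θ => ζ s θ ^ k) h := fun k s =>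
    Integrable.of_bound (hmeas k s) 1 (ae_of_all _ fun θ => by rw [norm_pow, hζ, one_pow])
  let F' : ℝ → AddCircle (2 * Real.pi) → ℂ := fun s θ => j * Complex.I * ω * ζ s θ ^ j +
    j * K / 2 * (η s * ζ s θ ^ (j - 1) - (starRingEnd ℂ) (η s) * ζ s θ ^ (j + 1))
  have hF'int : ∀ s, Integrable (F' s) h := fun s =>
    ((hintegrable j s).const_mul _).add ((((hintegrable (j - 1) s).const_mul _).sub
      ((hintegrable (j + 1) s).const_mul _)).const_mul _)
  have h1 := (hasDerivAt_integral_of_dominated_loc_of_deriv_le (μ := h)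
    (F := fun s θ => ζ s θ ^ j) (F' := F') (x₀ := t) (s := Set.univ)
    (bound := fun _ => j * |ω| + j * |K| / 2 * 2) univ_mem
    (Eventually.of_forall fun s => hmeas j s) (hintegrable j t)
    (hF'int t).aestronglyMeasurable (ae_of_all _ fun θ s _ => ?_) (integrable_const _)
    (ae_of_all _ fun θ s _ =>
      (hF.lift ω (fourier 1 θ)).hasDerivAt_div_pow (hne s θ) hj)).2
  · refine h1.congr_deriv ?_
    simp only [F']
    rw [integral_add ((hintegrable j t).const_mul _)
      (Integrable.const_mul (Integrable.sub' ((hintegrable (j - 1) t).const_mul _)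
        ((hintegrable (j + 1) t).const_mul _)) _), integral_const_mul, integral_const_mul,
      integral_sub ((hintegrable (j - 1) t).const_mul _) ((hintegrable (j + 1) t).const_mul _),
      integral_const_mul, integral_const_mul]
    rfl
  · have h2 : ‖η s * ζ s θ ^ (j - 1) - (starRingEnd ℂ) (η s) * ζ s θ ^ (j + 1)‖ ≤ 2 := by
      refine (norm_sub_le _ _).trans ?_
      rw [norm_mul, norm_mul, norm_pow, norm_pow, hζ, RCLike.norm_conj, one_pow, one_pow]
      linarith [hη s]
    refine (norm_add_le _ _).trans (add_le_add (le_of_eq ?_) ?_)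
    · rw [norm_mul, norm_pow, hζ]
      simp
    · rw [norm_mul]
      refine mul_le_mul (le_of_eq ?_) h2 (norm_nonneg _) (by positivity)
      simp

end IsFundamentalSystem

/-- The moments of a solution of the Kuramoto model extend to bounded holomorphic functions on a
neighbourhood of the closed upper half plane. -/
theorem IsKuramotoSolution.exists_expPlus {K : ℝ} {g : ℝ → ℝ}
    {h : Measure (AddCircle (2 * Real.pi))} [IsProbabilityMeasure h]
    {ρ : ℝ → Kernel ℝ (AddCircle (2 * Real.pi))} (hρ : IsKuramotoSolution K g h ρ)
    (hg : Integrable g) (hg0 : ∀ ω, 0 ≤ g ω) (hg1 : ∫ ω, g ω = 1) {t : ℝ} (ht : 0 ≤ t) (j : ℕ) :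
    ∃ φ ∈ boundedSet 1 0, ∀ ω : ℝ, φ ω = circleMoment ρ j t ω := by
  -- Freezing the order parameter at its initial value for negative times gives a continuous
  -- function on ℝ bounded by 1, so the linear system is posed on the whole line.
  let η : ℝ → ℂ := fun s => orderParameter g ρ (max s 0)
  have hηc : Continuous η := (hρ.continuousOn_orderParameter hg).comp_continuous
    (continuous_id.max continuous_const) fun s => Set.mem_Ici.2 (le_max_right _ _)
  have hη : ∀ s, ‖η s‖ ≤ 1 := fun s => hρ.norm_orderParameter_le hg hg0 hg1 (le_max_right _ _)
  have hηeq : ∀ s, 0 ≤ s → η s = orderParameter g ρ s := fun s hs => by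
    simp only [η, max_eq_left hs]
  obtain ⟨a, c, hac, ha0, hc0, ha, hc⟩ := IsRiccatiLift.exists_entire K hηc hη 1 0
  obtain ⟨b, d, hbd, hb0, hd0, hb, hd⟩ := IsRiccatiLift.exists_entire K hηc hη 0 1
  have hF : IsFundamentalSystem K η a b c d := ⟨hac, hbd, ha0, hb0, hc0, hd0⟩
  -- Both families solve the hierarchy driven by the same η and start from the moments of h. Their
  -- difference solves the homogeneous hierarchy, has zeroth term 1 - 1 = 0, and is bounded by 2.
  have hreal : ∀ ω : ℝ, moebiusMoment h a b c d j t ω = circleMoment ρ j t ω := by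
    intro ω
    refine sub_eq_zero.1 (moment_hierarchy_eq_zero (K := K) (ω := ω) (η := η) (b := 2)
      (X := fun k s => moebiusMoment h a b c d k s ω - circleMoment ρ k s ω)
      (fun s _ => hη s) (fun s hs => ?_) (fun k s hs => ?_) (fun k => ?_) (fun k hk s hs => ?_) j ht)
    · rw [hρ.circleMoment_zero hs]
      simp [moebiusMoment]
    · refine (norm_sub_le _ _).trans ?_
      have h1 := hF.norm_moebiusMoment_le (h := h)
        (ω := ω) (by simp) k hs
      have h2 := hρ.norm_circleMoment_le k hs ω
      linarith
    · simp only [moebiusMoment, circleMoment, hρ.initial, ha0, hb0, hc0, hd0,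
        fourier_eq_pow k]
      simp
    · refine (((hF.hasDerivAt_moebiusMoment (h := h) hη hk ω
        s).hasDerivWithinAt).fun_sub (hρ.moments k hk ω s hs)).congr_deriv ?_
      rw [hηeq s hs]
      ring
  -- The strip shrinks as t grows, so the index depends on `t`. In the strip the bound is only 2^j;
  -- the bound 1 of V_{1,0} concerns the closed half plane.
  obtain ⟨n, hn⟩ := exists_nat_one_div_lt
    (by positivity : 0 < 1 / 2 * Real.exp (-((2 + |K|) * t)))
  have hdiff := hF.differentiableOn_moebiusMoment (h := h) hη
    ha hb hc hd j ht
  have hsub : region n ⊆ {ω | -(1 / 2 * Real.exp (-((2 + |K|) * t))) < ω.im} := fun z hz => by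
    simp only [region, Set.mem_ofPred_eq] at hz ⊢
    linarith
  obtain ⟨φ, hφ⟩ := exists_expPlus_of_bound (f := moebiusMoment h a b c d j t)
    (β := 0) (n := n) (C := 2 ^ j)
    (hdiff.mono fun z hz => hsub (by
      simp only [region, Set.mem_ofPred_eq] at hz ⊢
      exact hz.le))
    (hdiff.continuousOn.mono hsub) fun z hz => by
      have h1 := norm_integral_le_of_norm_le_const (μ := h) (C := 2 ^ j) (f := fun θ =>
        ((a z t * fourier 1 θ + b z t) / (c z t * fourier 1 θ + d z t)) ^ j)
        (ae_of_all _ fun θ => by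
          rw [norm_pow]
          gcongr
          exact hF.norm_moebius_le_two hη ht (hsub hz).le θ)
      simpa [moebiusMoment] using h1
  refine ⟨φ, fun z hz => ?_, fun ω => (hφ ω (by simp)).trans (hreal ω)⟩
  rw [neg_zero, zero_mul, Real.exp_zero, mul_one]
  refine le_trans (le_of_eq (congrArg norm (hφ z hz))) ?_
  exact hF.norm_moebiusMoment_le hz j ht

end

end Kuramoto

/-! ### The four assertions together -/

open Kuramoto in
theorem theorem5p10 (g : ℝ → ℝ) (G : ℂ → ℂ) (δ : ℝ) (hg : IsGaussianType g G δ) (K : ℝ) :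
    (∀ C α : ℝ, 1 ≤ C → 0 ≤ α →
      -- (i) the three topologies coincide on `i(V_{C,α})`
      (topologyOn weakDualTopology (boundedImage hg C α) =
          topologyOn projectiveTopology (boundedImage hg C α) ∧
        topologyOn projectiveTopology (boundedImage hg C α) =
          topologyOn strongDualTopology (boundedImage hg C α)) ∧
      -- (ii) for each of them, the closure is connected, compact, and metrized by `d`
      (∀ τ ∈ ({weakDualTopology, projectiveTopology, strongDualTopology} :
          Set (TopologicalSpace ExpPlusDual)),
        @IsConnected _ τ (@closure _ τ (boundedImage hg C α)) ∧
        @IsCompact _ τ (@closure _ τ (boundedImage hg C α)) ∧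
        ∃ M : MetricSpace (@closure _ τ (boundedImage hg C α)),
          M.toPseudoMetricSpace.toUniformSpace.toTopologicalSpace =
            topologyOn τ (@closure _ τ (boundedImage hg C α)) ∧
          ∀ x y : @closure _ τ (boundedImage hg C α), dist x y = dualDist x y) ∧
      -- (iii) the projection to the generalized eigenspace of a simple resonance pole
      (((K : ℂ) : OnePoint ℂ) ∉ exceptionalCouplings g G δ →
        ∀ lam Dn : ℂ, IsResonancePole K g G lam → HasPoleConstant K g G lam Dn → Dn ≠ 0 →
          ∃ μ : ExpPlusDual, IsGeneralizedEigenfunction g G lam μ ∧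
            ∃ P : boundedImage hg C α → ExpPlusDual,
              (∀ (ψ : ExpPlus) (hψ : ψ ∈ boundedSet C α),
                P ⟨canonicalInclusion hg ψ, Set.mem_image_of_mem _ hψ⟩ =
                  (K / (2 * Dn) * μ ψ) • μ) ∧
              @Continuous _ _ (topologyOn projectiveTopology (boundedImage hg C α))
                projectiveTopology P ∧
              @SeqContinuous _ _ (topologyOn weakDualTopology (boundedImage hg C α))
                weakDualTopology P)) ∧
    -- (iv) the solutions of the Kuramoto model stay in `V_{1,0}`
    (∀ h : MeasureTheory.Measure (AddCircle (2 * Real.pi)), MeasureTheory.IsProbabilityMeasure h →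
      ∀ ρ : ℝ → ProbabilityTheory.Kernel ℝ (AddCircle (2 * Real.pi)),
        IsKuramotoSolution K g h ρ → ∀ t : ℝ, 0 ≤ t → ∀ j : ℕ, 1 ≤ j →
          ∃ φ ∈ boundedSet 1 0, ∀ ω : ℝ, φ ω = circleMoment ρ j t ω) := by
  refine ⟨fun C α hC hα => ?_, fun h hh ρ hρ t ht j _ => ?_⟩
  · have hC0 : 0 ≤ C := zero_le_one.trans hC
    refine ⟨⟨topologyOn_weak_eq_projective hg hC0 α (boundedImage_subset_dominatedSet hg C α), ?_⟩,
      ?_, ?_⟩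
    · rw [projective_eq_strong]
    · intro τ hτ
      refine closure_boundedImage_properties hg hC0 α ?_
      rcases hτ with h | h | h
      · exact Or.inl h
      · exact Or.inr h
      · exact Or.inr (Eq.trans h projective_eq_strong.symm)
    · intro _ lam Dn hlam _ _
      -- Both kinds of resonance pole lie in the closed left half plane, where one of the two
      -- formulas for μ_λ applies.
      have hre : lam.re ≤ 0 := by
        rcases hlam with h | h
        · exact h.1.le
        · exact h.1.le
      obtain ⟨μ, hμ, hμ'⟩ := exists_eigenfunction hg hre
      exact ⟨μ, hμ, exists_projection hg hC0 hα hμ' (K / (2 * Dn))⟩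
  · have hint : MeasureTheory.Integrable g := by
      refine MeasureTheory.Integrable.of_integral_ne_zero ?_
      rw [hg.integral_eq_one]
      exact one_ne_zero
    exact hρ.exists_expPlus hint hg.nonneg hg.integral_eq_one ht j
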